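/- Let $g\ge 2$ and let $\Sigma_g$ be a closed connected oriented smooth surface of genus $g$ with a Riemannian metric, with unit tangent bundle $p\colon UT\Sigma_g\to\Sigma_g$. Let $D\subset\Sigma_g$ be a smoothly embedded closed disc (given with a parametrization that extends to a smooth open embedding of the plane), $v_0$ a unit tangent vector at the centre $*$ of $D$, and $\Sigma_g^1=\Sigma_g\setminus\operatorname{int}D$, with boundary curve $\eta$. Let $\mathrm{Mod}_g^1$ be the group of isotopy classes, relative to $\eta$, of self-homeomorphisms of $\Sigma_g^1$ that fix $\eta$ pointwise. For $\alpha\in\pi_1(UT\Sigma_g,v_0)$ let $\mathrm{Push}(\alpha)\in\mathrm{Mod}_g^1$ be the class of $\varphi_1|_{\Sigma_g^1}$, where $(\varphi_t)_{t\in[0,1]}$ is a smooth isotopy of $\Sigma_g$ with $\varphi_0=\mathrm{id}$ and $\varphi_1|_D=\mathrm{id}$ such that the loop $t\mapsto d\varphi_t(v_0)/\lVert d\varphi_t(v_0)\rVert$ represents $\alpha$. Let $F\colon(\Sigma_g^1,\eta)\to(\Sigma_g^1,\eta)$ be a self-homeomorphism (for instance an orientation-reversing diffeomorphism), let $\Sigma_{2g}$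 be the closed surface of genus $2g$ obtained from two copies of $\Sigma_g^1$ by identifying each point $a\in\eta$ of the second copy with the point $F(a)$ of the first, and let $h\colon\mathrm{Mod}_g^1\times\mathrm{Mod}_g^1\to\mathrm{Mod}_{2g}$ be the homomorphism that juxtaposes mapping classes on the two copies. Then there is a unique homomorphism $\rho\colon\pi_1(\Sigma_g,*)\to\mathrm{Mod}_{2g}$ with $$\rho(p_*\alpha)=h\bigl(\mathrm{Push}(\alpha),\,F^{-1}\circ\mathrm{Push}(\alpha)\circ F\bigr)\qquad\text{for all }\alpha\in\pi_1(UT\Sigma_g,v_0),$$ and its image is contained in the Torelli group $\mathcal I_{2g}$, the group of classes of orientation-preserving homeomorphisms of $\Sigma_{2g}$ that act trivially on $H_1(\Sigma_{2g};\mathbb Z)$. -/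

import Mathlib

open Bundle
open scoped Manifold ContDiff unitInterval

noncomputable section

/-! ## Mapping class groups -/

/-- The group of self-homeomorphisms of `X` that fix the subset `A` pointwise. -/
def HomeoRel (X : Type) [TopologicalSpace X] (A : Set X) : Subgroup (X ≃ₜ X) where
  carrier := {f | ∀ a ∈ A, f a = a}
  mul_mem' := by
    intro f g hf hg a ha
    change f (g a) = a
    rw [hg a ha, hf a ha]
  one_mem' := fun _ _ => rfl
  inv_mem' := by
    intro f hf a ha
    change f.symm a = a
    rw [Homeomorph.symm_apply_eq, hf a ha]

/-- `f` is isotopic to the identity, through homeomorphisms that fix `A` pointwise. -/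
def IsotopicToId {X : Type} [TopologicalSpace X] {A : Set X} (f : HomeoRel X A) : Prop :=
  ∃ H : C(I × X, X), (∀ t, IsHomeomorph (fun x => H (t, x))) ∧ (∀ t, ∀ a ∈ A, H (t, a) = a) ∧
    (∀ x, H (0, x) = x) ∧ ∀ x, H (1, x) = (f : X ≃ₜ X) x

/-- The subgroup of the homeomorphisms that are isotopic to the identity relative to `A`. -/
def isotopicToId (X : Type) [TopologicalSpace X] (A : Set X) : Subgroup (HomeoRel X A) where
  carrier := {f | IsotopicToId f}
  mul_mem' := by
    rintro f g ⟨H, h1, h2, h3, h4⟩ ⟨K, k1, k2, k3, k4⟩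
    refine ⟨⟨fun q => H (q.1, K q), by fun_prop⟩, fun t => (h1 t).comp (k1 t), fun t a ha => ?_,
      fun x => ?_, fun x => ?_⟩
    · simp [k2 t a ha, h2 t a ha]
    · simp [h3, k3]
    · simp only [ContinuousMap.coe_mk, k4, h4]; rfl
  one_mem' := ⟨⟨fun q => q.2, by fun_prop⟩, fun _ => IsHomeomorph.id, fun _ _ _ => rfl,
    fun _ => rfl, fun _ => rfl⟩
  inv_mem' := by
    rintro f ⟨H, h1, h2, h3, h4⟩
    have hc : Continuous (f : X ≃ₜ X).symm := (f : X ≃ₜ X).symm.continuous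
    refine ⟨⟨fun q => (f : X ≃ₜ X).symm (H (unitInterval.symm q.1, q.2)), by fun_prop⟩,
      fun t => (f : X ≃ₜ X).symm.isHomeomorph.comp (h1 (unitInterval.symm t)),
      fun t a ha => ?_, fun x => ?_, fun x => ?_⟩
    · simp only [ContinuousMap.coe_mk]
      rw [h2 _ a ha]
      exact f⁻¹.2 a ha
    · simp [h4]
    · simp only [ContinuousMap.coe_mk, unitInterval.symm_one, h3]; rfl

instance isotopicToId_normal (X : Type) [TopologicalSpace X] (A : Set X) :
    (isotopicToId X A).Normal where
  conj_mem := by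
    rintro f ⟨H, h1, h2, h3, h4⟩ g
    have hc : Continuous (g : X ≃ₜ X).symm := (g : X ≃ₜ X).symm.continuous
    have hc' : Continuous (g : X ≃ₜ X) := (g : X ≃ₜ X).continuous
    refine ⟨⟨fun q => (g : X ≃ₜ X) (H (q.1, (g : X ≃ₜ X).symm q.2)), by fun_prop⟩,
      fun t => (g : X ≃ₜ X).isHomeomorph.comp ((h1 t).comp (g : X ≃ₜ X).symm.isHomeomorph),
      fun t a ha => ?_, fun x => ?_, fun x => ?_⟩
    · have hg : (g : X ≃ₜ X).symm a = a := g⁻¹.2 a ha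
      simp only [ContinuousMap.coe_mk, hg, h2 t a ha]
      exact g.2 a ha
    · simp [h3]
    · simp only [ContinuousMap.coe_mk, h4]; rfl

/-- Isotopy classes, relative to `A`, of the self-homeomorphisms of `X` fixing `A` pointwise.

If `X` is a compact connected orientable surface with nonempty boundary `A`, such homeomorphisms
preserve orientation automatically, and this is the mapping class group `Mod(X)`. If `X` is a
closed orientable surface, `MCG X ∅` is the extended mapping class group, and `Mod(X)` is the
subgroup `ModClosed X` below. -/
abbrev MCG (X : Type) [TopologicalSpace X] (A : Set X) : Type :=
  HomeoRel X A ⧸ isotopicToId X A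

/-- The class of a homeomorphism. -/
abbrev MCG.mk {X : Type} [TopologicalSpace X] {A : Set X} : HomeoRel X A →* MCG X A :=
  QuotientGroup.mk' (isotopicToId X A)

/-! ## Orientation-preserving classes and the Torelli group of a closed surface -/

/-- The embedded open discs of `S`, as a subset of `C(ℝ², S)`. -/
def embeddedDiscs (S : Type) [TopologicalSpace S] : Set C(EuclideanSpace ℝ (Fin 2), S) :=
  {e | Topology.IsOpenEmbedding e}

/-- The orientation-preserving self-homeomorphisms of a connected orientable surface `S`: they
carry every parametrized embedded open disc to one that is isotopic to it through embedded discs,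
that is, they preserve the local orientations (the two local orientations at a point correspond to
the two isotopy classes of parametrized embedded discs). -/
def homeoPlus (S : Type) [TopologicalSpace S] : Subgroup (HomeoRel S ∅) where
  carrier := {f | ∀ e ∈ embeddedDiscs S,
    JoinedIn (embeddedDiscs S) e (((f : S ≃ₜ S) : C(S, S)).comp e)}
  mul_mem' := by
    intro f g hf hg e he
    refine (hg e he).trans (hf (((g : S ≃ₜ S) : C(S, S)).comp e) ?_)
    exact (g : S ≃ₜ S).isOpenEmbedding.comp he
  one_mem' := fun e he => JoinedIn.refl he
  inv_mem' := by
    intro f hf e he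
    have h := hf ((((f⁻¹ : HomeoRel S ∅) : S ≃ₜ S) : C(S, S)).comp e)
      ((f : S ≃ₜ S).symm.isOpenEmbedding.comp he)
    have e' : (((f : S ≃ₜ S) : C(S, S)).comp
        ((((f⁻¹ : HomeoRel S ∅) : S ≃ₜ S) : C(S, S)).comp e)) = e := by
      ext x
      exact (f : S ≃ₜ S).apply_symm_apply (e x)
    rw [e'] at h
    exact h.symm

/-- First singular homology with integer coefficients. -/
abbrev H1 : CategoryTheory.Functor TopCat.{0} (ModuleCat.{0} ℤ) :=
  (AlgebraicTopology.singularHomologyFunctor (ModuleCat.{0} ℤ) 1).obj (ModuleCat.of ℤ ℤ)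

/-- The self-homeomorphisms of `S` that act trivially on `H₁(S; ℤ)`. -/
def homologyTrivial (S : Type) [TopologicalSpace S] : Subgroup (HomeoRel S ∅) where
  carrier := {f | H1.map (TopCat.ofHom ((f : S ≃ₜ S) : C(S, S))) =
    CategoryTheory.CategoryStruct.id _}
  mul_mem' := by
    intro f g hf hg
    have e : TopCat.ofHom (((f * g : HomeoRel S ∅) : S ≃ₜ S) : C(S, S)) =
        CategoryTheory.CategoryStruct.comp (TopCat.ofHom ((g : S ≃ₜ S) : C(S, S)))
          (TopCat.ofHom ((f : S ≃ₜ S) : C(S, S))) := rfl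
    change H1.map _ = _
    rw [e, CategoryTheory.Functor.map_comp, hf, hg, CategoryTheory.Category.comp_id]
  one_mem' := H1.map_id _
  inv_mem' := by
    intro f hf
    have e : CategoryTheory.CategoryStruct.comp (TopCat.ofHom ((f : S ≃ₜ S) : C(S, S)))
        (TopCat.ofHom (((f⁻¹ : HomeoRel S ∅) : S ≃ₜ S) : C(S, S))) =
          CategoryTheory.CategoryStruct.id _ := by
      ext x
      exact (f : S ≃ₜ S).symm_apply_apply x
    have h := congrArg (fun k => H1.map k) e
    simp only [CategoryTheory.Functor.map_comp, CategoryTheory.Functor.map_id] at h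
    change H1.map _ = _
    rw [← h]
    have hf' : H1.map (TopCat.ofHom ((f : S ≃ₜ S) : C(S, S))) =
      CategoryTheory.CategoryStruct.id _ := hf
    rw [hf', CategoryTheory.Category.id_comp]

/-- The mapping class group `Mod(S)` of a closed orientable surface: the classes of
orientation-preserving homeomorphisms. -/
def ModClosed (S : Type) [TopologicalSpace S] : Subgroup (MCG S ∅) :=
  (homeoPlus S).map MCG.mk

/-- The Torelli group of a closed orientable surface `S`: the classes of orientation-preserving
homeomorphisms that act trivially on `H₁(S; ℤ)`. -/
def Torelli (S : Type) [TopologicalSpace S] : Subgroup (MCG S ∅) :=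
  (homeoPlus S ⊓ homologyTrivial S).map MCG.mk

lemma torelli_le_modClosed (S : Type) [TopologicalSpace S] : Torelli S ≤ ModClosed S :=
  Subgroup.map_mono inf_le_left

/-! ## Gluing two copies of a surface and juxtaposing mapping classes -/

/-- Two copies of `X`, glued by identifying `a` in the second copy with `F a` in the first, for
`a ∈ A`. -/
def Glue {X : Type} (A : Set X) (F : X → X) : Type :=
  Quot (fun p q : X ⊕ X => ∃ a ∈ A, p = Sum.inr a ∧ q = Sum.inl (F a))

instance {X : Type} [TopologicalSpace X] (A : Set X) (F : X → X) :
    TopologicalSpace (Glue A F) :=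
  inferInstanceAs (TopologicalSpace (Quot _))

/-- The map of `Glue A F` given by `u` on the first copy and by `v` on the second. -/
def Glue.map {X : Type} {A : Set X} {F : X → X} (hF : ∀ a ∈ A, F a ∈ A) (u v : X → X)
    (hu : ∀ a ∈ A, u a = a) (hv : ∀ a ∈ A, v a = a) : Glue A F → Glue A F :=
  Quot.map (Sum.map u v) (by
    rintro _ _ ⟨a, ha, rfl, rfl⟩
    exact ⟨a, ha, by simp [hv a ha], by simp [hu _ (hF a ha)]⟩)

lemma Glue.continuous_map {X : Type} [TopologicalSpace X] {A : Set X} {F : X → X}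
    (hF : ∀ a ∈ A, F a ∈ A) (u v : X → X) (hu : ∀ a ∈ A, u a = a) (hv : ∀ a ∈ A, v a = a)
    (cu : Continuous u) (cv : Continuous v) : Continuous (Glue.map hF u v hu hv) :=
  continuous_quot_lift _ (continuous_quot_mk.comp (cu.sumMap cv))

/-- Juxtaposition of homeomorphisms: `u` on the first copy of `X`, `v` on the second. -/
def glueHomeo {X : Type} [TopologicalSpace X] {A : Set X} {F : X → X}
    (hF : ∀ a ∈ A, F a ∈ A) (u v : HomeoRel X A) : HomeoRel (Glue A F) ∅ where
  val :=
    { toFun := Glue.map hF (u : X ≃ₜ X) (v : X ≃ₜ X) u.2 v.2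
      invFun := Glue.map hF ((u⁻¹ : HomeoRel X A) : X ≃ₜ X) ((v⁻¹ : HomeoRel X A) : X ≃ₜ X)
        u⁻¹.2 v⁻¹.2
      left_inv := by
        rintro ⟨x | x⟩
        · exact congrArg (fun y => Quot.mk _ (Sum.inl y)) ((u : X ≃ₜ X).symm_apply_apply x)
        · exact congrArg (fun y => Quot.mk _ (Sum.inr y)) ((v : X ≃ₜ X).symm_apply_apply x)
      right_inv := by
        rintro ⟨x | x⟩
        · exact congrArg (fun y => Quot.mk _ (Sum.inl y)) ((u : X ≃ₜ X).apply_symm_apply x)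
        · exact congrArg (fun y => Quot.mk _ (Sum.inr y)) ((v : X ≃ₜ X).apply_symm_apply x)
      continuous_toFun := Glue.continuous_map hF _ _ _ _
        (u : X ≃ₜ X).continuous (v : X ≃ₜ X).continuous
      continuous_invFun := Glue.continuous_map hF _ _ _ _
        (u : X ≃ₜ X).symm.continuous (v : X ≃ₜ X).symm.continuous }
  property := fun _ h => h.elim

lemma glueHomeo_mul {X : Type} [TopologicalSpace X] {A : Set X} {F : X → X}
    (hF : ∀ a ∈ A, F a ∈ A) (u v u' v' : HomeoRel X A) :
    glueHomeo hF (u * u') (v * v') = glueHomeo hF u v * glueHomeo hF u' v' := by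
  apply Subtype.ext
  apply Homeomorph.ext
  rintro ⟨x | x⟩ <;> rfl

lemma glueHomeo_one {X : Type} [TopologicalSpace X] {A : Set X} {F : X → X}
    (hF : ∀ a ∈ A, F a ∈ A) : glueHomeo hF 1 1 = 1 := by
  apply Subtype.ext
  apply Homeomorph.ext
  rintro ⟨x | x⟩ <;> rfl

lemma glueHomeo_isotopicToId {X : Type} [TopologicalSpace X] {A : Set X} {F : X → X}
    (hF : ∀ a ∈ A, F a ∈ A) {u v : HomeoRel X A} (hu : u ∈ isotopicToId X A)
    (hv : v ∈ isotopicToId X A) : glueHomeo hF u v ∈ isotopicToId (Glue A F) ∅ := by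
  obtain ⟨H, h1, h2, h3, h4⟩ := hu
  obtain ⟨K, k1, k2, k3, k4⟩ := hv
  let q : X ⊕ X → Glue A F := Quot.mk _
  have hq : Continuous q := continuous_quot_mk
  let L : C(X, C(I, Glue A F)) :=
    ContinuousMap.curry ⟨fun p => q (Sum.inl (H (p.2, p.1))), by fun_prop⟩
  let R : C(X, C(I, Glue A F)) :=
    ContinuousMap.curry ⟨fun p => q (Sum.inr (K (p.2, p.1))), by fun_prop⟩
  have hLR : ∀ p p' : X ⊕ X, (∃ a ∈ A, p = Sum.inr a ∧ p' = Sum.inl (F a)) →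
      Sum.elim L R p = Sum.elim L R p' := by
    rintro _ _ ⟨a, ha, rfl, rfl⟩
    ext t
    change q (Sum.inr (K (t, a))) = q (Sum.inl (H (t, F a)))
    rw [k2 t a ha, h2 t _ (hF a ha)]
    exact Quot.sound ⟨a, ha, rfl, rfl⟩
  let G : C(Glue A F, C(I, Glue A F)) :=
    ⟨Quot.lift (Sum.elim L R) hLR, continuous_quot_lift _ (L.continuous.sumElim R.continuous)⟩
  refine ⟨⟨fun p => G p.2 p.1, by fun_prop⟩, fun t => ?_, fun _ _ h => h.elim, ?_, ?_⟩
  · let u' : HomeoRel X A := ⟨(h1 t).homeomorph, fun a ha => h2 t a ha⟩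
    let v' : HomeoRel X A := ⟨(k1 t).homeomorph, fun a ha => k2 t a ha⟩
    have e : (fun x => G x t) = ((glueHomeo hF u' v' : HomeoRel (Glue A F) ∅) :
        Glue A F ≃ₜ Glue A F) := by
      funext x
      rcases x with ⟨x | x⟩ <;> rfl
    change IsHomeomorph (fun x => G x t)
    rw [e]
    exact Homeomorph.isHomeomorph _
  · rintro ⟨x | x⟩
    · exact congrArg (fun y => q (Sum.inl y)) (h3 x)
    · exact congrArg (fun y => q (Sum.inr y)) (k3 x)
  · rintro ⟨x | x⟩
    · exact congrArg (fun y => q (Sum.inl y)) (h4 x)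
    · exact congrArg (fun y => q (Sum.inr y)) (k4 x)

/-- Juxtaposition of mapping classes `(x, y)` on the two halves of the glued surface. -/
def juxtapose {X : Type} [TopologicalSpace X] {A : Set X} {F : X → X}
    (hF : ∀ a ∈ A, F a ∈ A) : MCG X A × MCG X A →* MCG (Glue A F) ∅ where
  toFun p := Quotient.liftOn₂' p.1 p.2 (fun u v => MCG.mk (glueHomeo hF u v)) (by
    intro u v u' v' hu hv
    rw [QuotientGroup.leftRel_apply] at hu hv
    refine QuotientGroup.eq.2 ?_
    have h := glueHomeo_isotopicToId hF hu hv
    have e : glueHomeo hF (u⁻¹ * u') (v⁻¹ * v') =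
        (glueHomeo hF u v)⁻¹ * glueHomeo hF u' v' := by
      rw [eq_inv_mul_iff_mul_eq, ← glueHomeo_mul, mul_inv_cancel_left, mul_inv_cancel_left]
    rwa [e] at h)
  map_one' := congrArg MCG.mk (glueHomeo_one hF)
  map_mul' := by
    rintro ⟨⟨u⟩, ⟨v⟩⟩ ⟨⟨u'⟩, ⟨v'⟩⟩
    exact congrArg MCG.mk (glueHomeo_mul hF u v u' v')

lemma juxtapose_mk {X : Type} [TopologicalSpace X] {A : Set X} {F : X → X}
    (hF : ∀ a ∈ A, F a ∈ A) (u v : HomeoRel X A) :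
    juxtapose hF (MCG.mk u, MCG.mk v) = MCG.mk (glueHomeo hF u v) := rfl

/-- Conjugation `φ ↦ F⁻¹ ∘ φ ∘ F` of homeomorphisms by a self-homeomorphism of `(X, A)`. -/
def conjHomeo {X : Type} [TopologicalSpace X] {A : Set X} (F : X ≃ₜ X)
    (hF : ∀ a ∈ A, F a ∈ A) : HomeoRel X A →* HomeoRel X A where
  toFun φ := ⟨F⁻¹ * φ * F, fun a ha => by
    change F.symm ((φ : X ≃ₜ X) (F a)) = a
    rw [φ.2 _ (hF a ha), F.symm_apply_apply]⟩
  map_one' := Subtype.ext (by simp)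
  map_mul' φ ψ := Subtype.ext (by simp [mul_assoc])

/-- Conjugation `φ ↦ F⁻¹ ∘ φ ∘ F` of mapping classes by a self-homeomorphism of `(X, A)`. -/
def conjMCG {X : Type} [TopologicalSpace X] {A : Set X} (F : X ≃ₜ X)
    (hF : ∀ a ∈ A, F a ∈ A) : MCG X A →* MCG X A :=
  QuotientGroup.map _ _ (conjHomeo F hF) (by
    rintro f ⟨H, h1, h2, h3, h4⟩
    have hc : Continuous F.symm := F.symm.continuous
    have hc' : Continuous F := F.continuous
    refine ⟨⟨fun q => F.symm (H (q.1, F q.2)), by fun_prop⟩,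
      fun t => F.symm.isHomeomorph.comp ((h1 t).comp F.isHomeomorph),
      fun t a ha => ?_, fun x => ?_, fun x => ?_⟩
    · simp [h2 t _ (hF a ha)]
    · simp [h3]
    · simp only [ContinuousMap.coe_mk, h4]; rfl)

/-! ## Closed oriented smooth surfaces -/

/-- The Euclidean plane. -/
abbrev Plane : Type := EuclideanSpace ℝ (Fin 2)

/-- The atlas of the smooth surface `M` is oriented: all coordinate changes have positive
Jacobian. -/
def OrientedAtlas (M : Type) [TopologicalSpace M] [ChartedSpace Plane M] : Prop :=
  ∀ c ∈ atlas Plane M, ∀ c' ∈ atlas Plane M, ∀ x ∈ (c.symm.trans c').source,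
    0 < (fderiv ℝ (c.symm.trans c') x).det

/-- The point `exp(2πit)` of the closed unit disc. -/
def discBoundaryPoint (t : ℝ) : Metric.closedBall (0 : ℂ) 1 :=
  ⟨Complex.exp (2 * Real.pi * t * Complex.I), by
    have h := Complex.norm_exp_ofReal_mul_I (2 * Real.pi * t)
    push_cast at h
    simp [h]⟩

/-- The standard surface of genus `g ≥ 1`: a `4g`-gon (the closed unit disc, with its boundary cut
into `4g` equal arcs) with its sides identified in pairs according to the word
`a₁ b₁ a₁⁻¹ b₁⁻¹ ⋯ a_g b_g a_g⁻¹ b_g⁻¹`. -/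
def StandardSurface (g : ℕ) : Type :=
  Quot (fun p q : Metric.closedBall (0 : ℂ) 1 => ∃ i < g, ∃ s ∈ Set.Icc (0 : ℝ) 1,
    (p = discBoundaryPoint ((4 * i + s) / (4 * g)) ∧
      q = discBoundaryPoint ((4 * i + 3 - s) / (4 * g))) ∨
    (p = discBoundaryPoint ((4 * i + 1 + s) / (4 * g)) ∧
      q = discBoundaryPoint ((4 * i + 4 - s) / (4 * g))))

instance (g : ℕ) : TopologicalSpace (StandardSurface g) :=
  inferInstanceAs (TopologicalSpace (Quot _))

/-- A smoothly embedded disc in `M`, given with a smooth extension of its parametrization to an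
open embedding of the plane. The disc is the image of the closed unit ball. -/
structure SmoothDisc (M : Type) [TopologicalSpace M] [ChartedSpace Plane M] where
  /-- the parametrization -/
  toFun : Plane → M
  injective : Function.Injective toFun
  isLocalDiffeomorph : IsLocalDiffeomorph (𝓡 2) (𝓡 2) ∞ toFun

namespace SmoothDisc

variable {M : Type} [TopologicalSpace M] [ChartedSpace Plane M]

/-- The surface with boundary obtained from `M` by removing the interior of the disc. -/
abbrev Compl (δ : SmoothDisc M) : Type :=
  {x : M // x ∉ δ.toFun '' Metric.ball 0 1}

/-- The boundary curve of `δ.Compl`. -/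
def boundary (δ : SmoothDisc M) : Set δ.Compl :=
  {x | (x : M) ∈ δ.toFun '' Metric.sphere 0 1}

end SmoothDisc

/-! ## The unit tangent bundle and the push map -/

section Push

variable (M : Type) [TopologicalSpace M] [ChartedSpace Plane M] [IsManifold (𝓡 2) ∞ M]
  [RiemannianBundle (fun x : M => TangentSpace (𝓡 2) x)]

/-- The unit tangent bundle of a Riemannian surface. -/
abbrev UnitTangent : Type :=
  {v : TangentBundle (𝓡 2) M // ‖v.2‖ = 1}

/-- The projection of the unit tangent bundle to the surface. -/
def UnitTangent.proj : C(UnitTangent M, M) where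
  toFun v := v.1.proj
  continuous_toFun :=
    (FiberBundle.continuous_proj Plane (TangentSpace (𝓡 2))).comp continuous_subtype_val

variable {M}

/-- `IsPush δ v₀ α m` says that `m` is the class `Push(α)` obtained by pushing the disc `δ`, and so
the boundary of `δ.Compl`, along the loop `α` of unit tangent vectors based at `v₀`, a vector at the
centre of the disc: there is a smooth isotopy `φ` of `M`, starting at the identity and ending at a
diffeomorphism that is the identity on the disc, that carries `v₀`, up to normalization, along a
loop in the class `α`, and whose end restricts to `δ.Compl` as a homeomorphism in the class `m`. -/
def IsPush (δ : SmoothDisc M) (v₀ : UnitTangent M) (α : FundamentalGroup (UnitTangent M) v₀)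
    (m : MCG δ.Compl δ.boundary) : Prop :=
  ∃ φ : ℝ → Diffeomorph (𝓡 2) (𝓡 2) M M ∞,
    ContMDiff (𝓘(ℝ, ℝ).prod (𝓡 2)) (𝓡 2) ∞ (fun q : ℝ × M => φ q.1 q.2) ∧
    (∀ x, φ 0 x = x) ∧
    (∀ x ∈ δ.toFun '' Metric.closedBall 0 1, φ 1 x = x) ∧
    (∃ c : Path v₀ v₀, α = FundamentalGroup.fromPath (Path.Homotopic.Quotient.mk c) ∧
      ∀ t : I, ∃ r : ℝ, 0 < r ∧
        (c t : TangentBundle (𝓡 2) M) =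
          ⟨φ t v₀.1.proj, r • mfderiv (𝓡 2) (𝓡 2) (φ t) v₀.1.proj v₀.1.2⟩) ∧
    ∃ f : HomeoRel δ.Compl δ.boundary,
      (∀ x : δ.Compl, (((f : δ.Compl ≃ₜ δ.Compl) x : δ.Compl) : M) = φ 1 x) ∧ m = MCG.mk f

/-- `ρ : π₁(M) → Mod` is the homomorphism induced by `α ↦ h(Push(α), F⁻¹ ∘ Push(α) ∘ F)`: the
composite of `ρ` with `π₁(UT M) → π₁(M)` is the latter map. Here `h` juxtaposes mapping classes on
the two halves of the closed surface glued from two copies of `δ.Compl` along the boundary,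
by `F`. -/
def IsKorkmaz (δ : SmoothDisc M) (v₀ : UnitTangent M) (F : δ.Compl ≃ₜ δ.Compl)
    (hF : ∀ a ∈ δ.boundary, F a ∈ δ.boundary)
    (ρ : FundamentalGroup M (UnitTangent.proj M v₀) →* MCG (Glue δ.boundary F) ∅) : Prop :=
  ∀ (α : FundamentalGroup (UnitTangent M) v₀) (m : MCG δ.Compl δ.boundary), IsPush δ v₀ α m →
    ρ (FundamentalGroup.map (UnitTangent.proj M) v₀ α) = juxtapose hF (m, conjMCG F hF m)

end Push

end

noncomputable section

/-! ## Additive functionals on paths -/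

/-! A point push along a class `γ` of loops of points is the end `φ₁` of a smooth isotopy of `M`
that is the identity on the disc at time 1 and moves the centre along a loop in `γ`; its double is
`φ₁` on one half of the glued surface and `F⁻¹φ₁F` on the other (`IsPointPush`). Tangent vectors
then enter only through their base points, and the theorem reduces to facts about these doubles.

The class of the double depends only on `γ` (`IsPointPush.unique`). Two pushes along homotopic loops
differ by the end of an isotopy whose trace of the centre is null-homotopic. A family of
diffeomorphisms straightens this trace to a point (`tamelyMoved_of_homotopic_refl`); it is only
continuous in time, but it depends smoothly on a continuously moving parameter (`IsTame`), so its
derivatives at the centre still vary continuously. The corrected isotopy fixes the centre, and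
blowing the centre up turns it into an isotopy of the surface with boundary (`continuous_blowUp`,
`SmoothDisc.exists_isotopy_compl`). That isotopy preserves the boundary but may move its points, so
it is not an isotopy relative to the boundary. In the double this does no harm: `H_t` and `F⁻¹H_tF`
agree across the seam (`glueHomeo_conj_isotopicToId`). Composing isotopies concatenates traces up to
homotopy, so the class is multiplicative in `γ`.

Every `γ` occurs (`exists_isotopy_of_loop`). Short paths are followed by translations in discs. The
germ at the centre of the resulting end map has positive determinant (`det_germ_pos`), so it is
isotoped to the identity, because matrices near the identity generate all plane matrices of positive
determinant. Conjugation by a contraction enlarges the set of fixed points to the disc of radius 2.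
Normalizing the differentials gives a loop of unit tangent vectors above the trace, so `ρ` is
determined on every `γ`.

The double acts trivially on homology. Homology is handled through additive homotopy-invariant
functions of paths with values in an abelian group (`PathFunctional`), the universal example being
the class of a path modulo singular boundaries. Such a function on the outside of the disc vanishes
on loops close to the disc, because the boundary of the polygon is a product of commutators
(`val_eq_zero_of_annulus`). Hence, by a van Kampen argument, it takes equal values on loops that are
freely homotopic in the whole of `M` (`val_eq_of_freeHomotopy_cover`), such as `c` and `φ₁ ∘ c`. The
change of the functional under `φ₁` is therefore a coboundary on each half, with a primitive that
vanishes near the seam; the two primitives glue (`IsDouble.mem_homologyTrivial`). The double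
preserves orientation because every embedded disc can be moved into the fixed neighbourhood of the
seam. -/

instance contractibleSpace_unitSquare : ContractibleSpace (I × I) := by
  have h : ContractibleSpace (Set.Icc (0 : ℝ × ℝ) 1) :=
    (convex_Icc (0 : ℝ × ℝ) 1).contractibleSpace ⟨0, by simp⟩
  refine @Homeomorph.contractibleSpace (I × I) (Set.Icc (0 : ℝ × ℝ) 1) _ _ h ?_
  exact
    { toFun := fun p => ⟨(p.1, p.2), ⟨⟨p.1.2.1, p.2.2.1⟩, ⟨p.1.2.2, p.2.2.2⟩⟩⟩
      invFun := fun p => (⟨p.1.1, p.2.1.1, p.2.2.1⟩, ⟨p.1.2, p.2.1.2, p.2.2.2⟩)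
      left_inv := fun _ => rfl
      right_inv := fun _ => rfl }

/-- Induction principle: a property of paths that is stable under homotopy and concatenation and
holds for the paths inside the members of an open cover holds for all paths. -/
theorem Path.induction_openCover {Y : Type*} [TopologicalSpace Y] {ι : Type*} {U : ι → Set Y}
    (hU : ∀ i, IsOpen (U i)) (hcov : ∀ y, ∃ i, y ∈ U i)
    (P : ∀ {x y : Y}, Path x y → Prop)
    (htrans : ∀ {x y z : Y} (p : Path x y) (q : Path y z), P p → P q → P (p.trans q))
    (hcongr : ∀ {x y : Y} (p q : Path x y), p.Homotopic q → P p → P q)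
    (hsmall : ∀ i {x y : Y} (p : Path x y), (∀ t, p t ∈ U i) → P p)
    {x y : Y} (p : Path x y) : P p := by
  obtain ⟨t, ht0, hmono, ⟨n, hn⟩, hc⟩ := exists_monotone_Icc_subset_open_cover_unitInterval
    (c := fun i => p ⁻¹' U i) (fun i => (hU i).preimage p.continuous)
    (fun s _ => by simpa using hcov (p s))
  have key : ∀ m, P (p.subpath (t 0) (t m)) := by
    intro m
    induction m with
    | zero =>
      obtain ⟨i, hi⟩ := hcov (p (t 0))
      exact hsmall i _ (fun s => by simpa using hi)
    | succ m ih =>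
      refine hcongr _ _ ⟨Path.Homotopy.subpathTransSubpath p (t 0) (t m) (t (m + 1))⟩
        (htrans _ _ ih ?_)
      obtain ⟨i, hi⟩ := hc m
      refine hsmall i _ (fun s => ?_)
      have h : p.subpath (t m) (t (m + 1)) s ∈ Set.range (p.subpath (t m) (t (m + 1))) := ⟨s, rfl⟩
      rw [Path.range_subpath_of_le p _ _ (hmono (Nat.le_succ m))] at h
      obtain ⟨r, hr, e⟩ := h
      rw [← e]
      exact hi hr
  have h := key n
  rw [ht0, hn n le_rfl, Path.subpath_zero_one] at h
  -- `subpath 0 1` is `p` with its endpoints rewritten, so the property has to be carried across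
  -- that cast.
  have cast_iff : ∀ {a b a' b' : Y} (q : Path a b) (ha : a' = a) (hb : b' = b),
      P (q.cast ha hb) → P q := by
    rintro a b a' b' q rfl rfl h
    exact h
  exact cast_iff _ _ _ h

/-- A function on the paths of `Y` with values in an abelian group that is additive under
concatenation and invariant under homotopy: a functor on the fundamental groupoid. -/
structure PathFunctional (Y : Type*) [TopologicalSpace Y] (H : Type*) [AddCommGroup H] where
  /-- the value at a path -/
  val : ∀ {x y : Y}, Path x y → H
  val_trans : ∀ {x y z : Y} (p : Path x y) (q : Path y z), val (p.trans q) = val p + val q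
  val_congr : ∀ {x y : Y} (p q : Path x y), p.Homotopic q → val p = val q

namespace PathFunctional

variable {Y Z : Type*} [TopologicalSpace Y] [TopologicalSpace Z] {H : Type*} [AddCommGroup H]

lemma val_refl (θ : PathFunctional Y H) (x : Y) : θ.val (Path.refl x) = 0 := by
  have h := θ.val_trans (Path.refl x) (Path.refl x)
  rw [Path.refl_trans_refl] at h
  simpa using h

lemma val_symm (θ : PathFunctional Y H) {x y : Y} (p : Path x y) : θ.val p.symm = -θ.val p := by
  have h := θ.val_congr _ _ (Path.Homotopic.trans_symm p)
  rw [θ.val_trans, θ.val_refl] at h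
  exact (neg_eq_of_add_eq_zero_right h).symm

lemma val_cast (θ : PathFunctional Y H) {x y x' y' : Y} (p : Path x y) (hx : x' = x)
    (hy : y' = y) : θ.val (p.cast hx hy) = θ.val p := by
  subst hx hy
  rfl

/-- Equal underlying maps force equal endpoints, so values can be compared even when the two path
types differ syntactically. Paths whose endpoints agree only propositionally are compared through
this lemma. -/
lemma val_eq_of_forall_eq (θ : PathFunctional Y H) {x y x' y' : Y} (p : Path x y) (q : Path x' y')
    (h : ∀ t, p t = q t) : θ.val p = θ.val q := by
  have hx : x' = x := by simpa using (h 0).symm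
  have hy : y' = y := by simpa using (h 1).symm
  subst hx hy
  congr 1
  ext t
  exact h t

lemma val_eq_zero_of_const (θ : PathFunctional Y H) {x y : Y} (p : Path x y)
    (h : ∀ t, p t = x) : θ.val p = 0 := by
  rw [θ.val_eq_of_forall_eq p (Path.refl x) h, θ.val_refl]

lemma val_subpath_add (θ : PathFunctional Y H) {x y : Y} (p : Path x y) (a b c : I) :
    θ.val (p.subpath a b) + θ.val (p.subpath b c) = θ.val (p.subpath a c) := by
  rw [← θ.val_trans]
  exact θ.val_congr _ _ ⟨Path.Homotopy.subpathTransSubpath p a b c⟩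

lemma val_eq_of_simplyConnected [SimplyConnectedSpace Y] (θ : PathFunctional Y H) {x y : Y}
    (p q : Path x y) : θ.val p = θ.val q :=
  θ.val_congr _ _ (SimplyConnectedSpace.paths_homotopic p q)

/-- The pullback of a path functional along a continuous map. -/
def pullback (θ : PathFunctional Y H) (f : C(Z, Y)) : PathFunctional Z H where
  val p := θ.val (p.map f.continuous)
  val_trans p q := by rw [Path.map_trans, θ.val_trans]
  val_congr p q h := θ.val_congr _ _ (h.map f)

instance : Sub (PathFunctional Y H) where
  sub θ τ :=
    { val := fun p => θ.val p - τ.val p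
      val_trans := fun p q => by rw [θ.val_trans, τ.val_trans]; abel
      val_congr := fun p q h => by rw [θ.val_congr p q h, τ.val_congr p q h] }

lemma sub_val (θ τ : PathFunctional Y H) {x y : Y} (p : Path x y) :
    (θ - τ).val p = θ.val p - τ.val p := rfl

/-- The path functional that takes the difference of the values of `h` at the endpoints. -/
def diff (h : Y → H) : PathFunctional Y H where
  val {x y} _ := h y - h x
  val_trans _ _ := by abel
  val_congr _ _ _ := rfl

lemma diff_val (h : Y → H) {x y : Y} (p : Path x y) : (diff h).val p = h y - h x := rfl

/-- If a path functional is locally the difference of the values of a fixed function at the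
endpoints, then it is so globally. -/
theorem eq_diff_of_openCover (θ : PathFunctional Y H) {ι : Type*} {U : ι → Set Y}
    (hU : ∀ i, IsOpen (U i)) (hcov : ∀ y, ∃ i, y ∈ U i) (h : Y → H)
    (hsmall : ∀ i {x y : Y} (p : Path x y), (∀ t, p t ∈ U i) → θ.val p = h y - h x)
    {x y : Y} (p : Path x y) : θ.val p = h y - h x := by
  refine Path.induction_openCover hU hcov (fun {x y} p => θ.val p = h y - h x) ?_ ?_ hsmall p
  · intro x y z p q hp hq
    rw [θ.val_trans, hp, hq]
    abel
  · intro x y p q hpq hp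
    rw [← θ.val_congr p q hpq, hp]

/-- A path functional that vanishes on loops is a difference of values, on a path-connected set. -/
theorem exists_eq_diff_of_loops (θ : PathFunctional Y H) {b : Y} {A : Set Y}
    (hA : ∀ x ∈ A, ∃ q : Path b x, ∀ t, q t ∈ A)
    (hloop : ∀ {x : Y} (p : Path x x), (∀ t, p t ∈ A) → θ.val p = 0) :
    ∃ h : Y → H, ∀ {x y : Y} (p : Path x y), (∀ t, p t ∈ A) → θ.val p = h y - h x := by
  classical
  choose q hq using hA
  refine ⟨fun x => if hx : x ∈ A then θ.val (q x hx) else 0, fun {x y} p hp => ?_⟩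
  have hx : x ∈ A := by simpa using hp 0
  have hy : y ∈ A := by simpa using hp 1
  simp only [dif_pos hx, dif_pos hy]
  -- The primitive at `x` is the value of a chosen path from `b` to `x`; going out to `x`, along `p`
  -- and back from `y` gives a loop in `A`.
  have h := hloop (((q x hx).trans p).trans (q y hy).symm) (fun t => by
    have ht := Set.mem_range_self (f := ((q x hx).trans p).trans (q y hy).symm) t
    rw [Path.trans_range, Path.trans_range, Path.symm_range] at ht
    rcases ht with (⟨s, hs⟩ | ⟨s, hs⟩) | ⟨s, hs⟩
    · exact hs ▸ hq x hx s
    · exact hs ▸ hp s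
    · exact hs ▸ hq y hy s)
  rw [θ.val_trans, θ.val_trans, θ.val_symm] at h
  rw [eq_sub_iff_add_eq, ← sub_eq_zero, ← h]
  abel

end PathFunctional

/-- The path `t ↦ K (s, t)`. -/
def horizontalPath {Y : Type*} [TopologicalSpace Y] (K : C(I × I, Y)) (s : I) :
    Path (K (s, 0)) (K (s, 1)) where
  toFun t := K (s, t)
  source' := rfl
  target' := rfl

/-- The path `s ↦ K (s, t)`. -/
def verticalPath {Y : Type*} [TopologicalSpace Y] (K : C(I × I, Y)) (t : I) :
    Path (K (0, t)) (K (1, t)) where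
  toFun s := K (s, t)
  source' := rfl
  target' := rfl

/-- The two routes between opposite corners are homotopic in the unit square itself, which is simply
connected; `K` carries that homotopy to `Y`. -/
lemma homotopic_of_square {Y : Type*} [TopologicalSpace Y] (K : C(I × I, Y)) :
    ((horizontalPath K 0).trans (verticalPath K 1)).Homotopic
      ((verticalPath K 0).trans (horizontalPath K 1)) := by
  let i : C(I × I, I × I) := .id _
  have h := (SimplyConnectedSpace.paths_homotopic
    ((horizontalPath i 0).trans (verticalPath i 1))
    ((verticalPath i 0).trans (horizontalPath i 1))).map K
  rw [Path.map_trans, Path.map_trans] at h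
  exact h

namespace PathFunctional

variable {Y : Type*} [TopologicalSpace Y] {H : Type*} [AddCommGroup H]

lemma val_square (θ : PathFunctional Y H) (K : C(I × I, Y)) :
    θ.val (horizontalPath K 0) + θ.val (verticalPath K 1) =
      θ.val (verticalPath K 0) + θ.val (horizontalPath K 1) := by
  rw [← θ.val_trans, ← θ.val_trans]
  exact θ.val_congr _ _ (homotopic_of_square K)

/-- Freely homotopic loops have the same value. -/
lemma val_eq_of_freeHomotopy (θ : PathFunctional Y H) (K : C(I × I, Y))
    (hK : ∀ s, K (s, 0) = K (s, 1)) {a b : Y} (p : Path a a) (q : Path b b)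
    (hp : ∀ t, p t = K (0, t)) (hq : ∀ t, q t = K (1, t)) : θ.val p = θ.val q := by
  have h := θ.val_square K
  -- The left and right sides of the square are the same path, so they cancel from the square
  -- relation.
  rw [θ.val_eq_of_forall_eq (verticalPath K 0) (verticalPath K 1) hK, add_comm] at h
  rw [θ.val_eq_of_forall_eq p (horizontalPath K 0) hp,
    θ.val_eq_of_forall_eq q (horizontalPath K 1) hq]
  exact add_left_cancel h

/-- Extension by zero of a path functional on a subspace. -/
def extendVal {U : Set Y} (θ : PathFunctional U H) (γ : C(I, Y)) : H :=
  open Classical in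
  if h : ∀ t, γ t ∈ U then
    θ.val (x := ⟨γ 0, h 0⟩) (y := ⟨γ 1, h 1⟩) ⟨⟨fun t => ⟨γ t, h t⟩, by fun_prop⟩, rfl, rfl⟩
  else 0

lemma extendVal_eq {U : Set Y} (θ : PathFunctional U H) (γ : C(I, Y)) {x y : U} (p : Path x y)
    (h : ∀ t, γ t = p t) : θ.extendVal γ = θ.val p := by
  have h' : ∀ t, γ t ∈ U := fun t => h t ▸ (p t).2
  rw [extendVal, dif_pos h']
  exact θ.val_eq_of_forall_eq _ _ (fun t => Subtype.ext (h t))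

/-- Let `U` and `V` be an open cover of `Y` and `θ` a path functional on `U` that vanishes on the
paths inside `U ∩ V`. Then loops in `U` that are freely homotopic in `Y` have the same value. -/
theorem val_eq_of_freeHomotopy_cover {U V : Set Y} (hU : IsOpen U) (hV : IsOpen V)
    (hUV : U ∪ V = Set.univ) (θ : PathFunctional U H)
    (hθ : ∀ {x y : U} (p : Path x y), (∀ t, (p t : Y) ∈ V) → θ.val p = 0)
    (K : C(I × I, Y)) (hK : ∀ s, K (s, 0) = K (s, 1)) {a b : U} (p : Path a a) (q : Path b b)
    (hp : ∀ t, p t = K (0, t)) (hq : ∀ t, q t = K (1, t)) : θ.val p = θ.val q := by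
  -- A Lebesgue subdivision: each cell of the grid is mapped into `U` or into `V`.
  obtain ⟨t, ht0, hmono, ⟨n, hn⟩, hc⟩ := exists_monotone_Icc_subset_open_cover_unitInterval_prod_self
    (c := fun i : Bool => K ⁻¹' (bif i then U else V))
    (fun i => by cases i; exacts [hV.preimage K.continuous, hU.preimage K.continuous])
    (fun s _ => by
      have h : K s ∈ U ∪ V := hUV ▸ Set.mem_univ _
      rw [Set.mem_iUnion]
      rcases h with h | h
      exacts [⟨true, h⟩, ⟨false, h⟩])
  let c : ℕ → I → I := fun i r => Set.Icc.convexComb (t i) (t (i + 1)) r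
  have hcc : ∀ i, Continuous (c i) := fun i => by
    refine Set.Icc.continuous_convexComb_prod.comp (?_ : Continuous fun r : I => (t i, t (i + 1), r))
    fun_prop
  have hc0 : ∀ i, c i 0 = t i := fun i => Set.Icc.convexComb_zero _ _
  have hc1 : ∀ i, c i 1 = t (i + 1) := fun i => Set.Icc.convexComb_one _ _
  have hcmem : ∀ i r, c i r ∈ Set.Icc (t i) (t (i + 1)) := fun i r => by
    have := Set.mem_range_self (f := c i) r
    rwa [Path.range_subpathAux, Set.uIcc_of_le (hmono (Nat.le_succ i))] at this
  let hor : ℕ → ℕ → C(I, Y) := fun i j => ⟨fun r => K (t i, c j r), by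
    have := hcc j; fun_prop⟩
  let ver : ℕ → ℕ → C(I, Y) := fun i j => ⟨fun r => K (c i r, t j), by
    have := hcc i; fun_prop⟩
  -- The van Kampen step: the boundary relation of a cell holds by homotopy invariance if the cell
  -- lies in `U`, and because all four terms vanish if it lies in `V`.
  have sq : ∀ i j, θ.extendVal (hor i j) + θ.extendVal (ver i (j + 1)) =
      θ.extendVal (ver i j) + θ.extendVal (hor (i + 1) j) := by
    intro i j
    obtain ⟨s, hs⟩ := hc i j
    have hin : ∀ r r', K (c i r, c j r') ∈ (bif s then U else V) := fun r r' =>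
      hs ⟨hcmem i r, hcmem j r'⟩
    cases s with
    | true =>
      let k : C(I × I, U) := ⟨fun x => ⟨K (c i x.1, c j x.2), hin _ _⟩, by
        have := hcc i; have := hcc j; fun_prop⟩
      have h := θ.val_square k
      rw [← θ.extendVal_eq (hor i j) (horizontalPath k 0) (fun r => by
          change K (t i, c j r) = K (c i 0, c j r); rw [hc0]),
        ← θ.extendVal_eq (ver i (j + 1)) (verticalPath k 1) (fun r => by
          change K (c i r, t (j + 1)) = K (c i r, c j 1); rw [hc1]),
        ← θ.extendVal_eq (ver i j) (verticalPath k 0) (fun r => by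
          change K (c i r, t j) = K (c i r, c j 0); rw [hc0]),
        ← θ.extendVal_eq (hor (i + 1) j) (horizontalPath k 1) (fun r => by
          change K (t (i + 1), c j r) = K (c i 1, c j r); rw [hc1])] at h
      exact h
    | false =>
      -- An edge in `V` has value zero by `hθ` if it also lies in `U`, and by the default value of
      -- `extendVal` if it does not.
      have z : ∀ γ : C(I, Y), (∀ r, γ r ∈ V) → θ.extendVal γ = 0 := by
        intro γ hγ
        rw [extendVal]
        split_ifs with h
        · exact hθ _ (fun r => hγ r)
        · rfl
      rw [z, z, z, z]
      · intro r; change K (t (i + 1), c j r) ∈ V; rw [← hc1]; exact hin 1 r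
      · intro r; change K (c i r, t j) ∈ V; rw [← hc0]; exact hin r 0
      · intro r; change K (c i r, t (j + 1)) ∈ V; rw [← hc1]; exact hin r 1
      · intro r; change K (t i, c j r) ∈ V; rw [← hc0]; exact hin 0 r
  -- Summing the cells of a row cancels the interior vertical edges; the two outer ones agree
  -- because every `K (s, ·)` is a loop.
  have row : ∀ i m, ∑ j ∈ Finset.range m, θ.extendVal (hor i j) + θ.extendVal (ver i m) =
      θ.extendVal (ver i 0) + ∑ j ∈ Finset.range m, θ.extendVal (hor (i + 1) j) := by
    intro i m
    induction m with
    | zero => simp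
    | succ m ih =>
      rw [Finset.sum_range_succ, Finset.sum_range_succ, add_assoc, sq, ← add_assoc, ih, add_assoc]
  have side : ∀ i, θ.extendVal (ver i n) = θ.extendVal (ver i 0) := by
    intro i
    congr 1
    ext r
    change K (c i r, t n) = K (c i r, t 0)
    rw [ht0, hn n le_rfl, hK]
  have const : ∀ i, ∑ j ∈ Finset.range n, θ.extendVal (hor i j) =
      ∑ j ∈ Finset.range n, θ.extendVal (hor 0 j) := by
    intro i
    induction i with
    | zero => rfl
    | succ i ih =>
      have h := row i n
      rw [side, add_comm] at h
      rw [← ih, add_left_cancel h]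
  have edge : ∀ i {a : U} (u : Path a a), (∀ r, (u r : Y) = K (t i, r)) →
      ∑ j ∈ Finset.range n, θ.extendVal (hor i j) = θ.val u := by
    intro i a u hu
    have hsum : ∀ m, ∑ j ∈ Finset.range m, θ.extendVal (hor i j) =
        θ.val (u.subpath (t 0) (t m)) := by
      intro m
      induction m with
      | zero => rw [Path.subpath_self, θ.val_refl]; rfl
      | succ m ih =>
        rw [Finset.sum_range_succ, ih, ← θ.val_subpath_add u (t 0) (t m) (t (m + 1))]
        congr 1
        exact θ.extendVal_eq _ _ (fun r => (hu _).symm)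
    rw [hsum, ht0, hn n le_rfl, Path.subpath_zero_one, θ.val_cast]
  rw [← edge 0 p (fun r => by rw [ht0]; exact hp r), ← const n,
    edge n q (fun r => by rw [hn n le_rfl]; exact hq r)]

end PathFunctional

/-! ## The singular path functional and its relation to first homology -/

section SingularHomology

open CategoryTheory Simplicial

variable (S : Type) [TopologicalSpace S]

/-- The integral singular chain complex of `S`. -/
abbrev singularChains : ChainComplex (ModuleCat.{0} ℤ) ℕ :=
  (TopCat.toSSet.obj (TopCat.of S)).chainComplex (ModuleCat.of ℤ ℤ)

/-- The group of 1-chains modulo boundaries, in the form of morphisms from `ℤ`. -/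
abbrev ChainsModBoundaries : Type :=
  ModuleCat.of ℤ ℤ ⟶ (singularChains S).opcycles 1

variable {S}

/-- The singular simplex given by a continuous map. -/
def singularSimplex {n : ℕ} (k : C(stdSimplex ℝ (Fin (n + 1)), S)) :
    (TopCat.toSSet.obj (TopCat.of S)) _⦋n⦌ :=
  (TopCat.toSSetObjEquiv (TopCat.of S) (Opposite.op ⦋n⦌)).symm k

lemma singularSimplex_surjective {n : ℕ} (x : (TopCat.toSSet.obj (TopCat.of S)) _⦋n⦌) :
    ∃ k : C(stdSimplex ℝ (Fin (n + 1)), S), x = singularSimplex k :=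
  ⟨TopCat.toSSetObjEquiv (TopCat.of S) (Opposite.op ⦋n⦌) x, (Equiv.symm_apply_apply _ _).symm⟩

lemma singularSimplex_δ {n : ℕ} (k : C(stdSimplex ℝ (Fin (n + 2)), S)) (i : Fin (n + 2)) :
    (TopCat.toSSet.obj (TopCat.of S)).δ i (singularSimplex k) =
      singularSimplex (k.comp ⟨stdSimplex.map (SimplexCategory.δ i),
        stdSimplex.continuous_map _⟩) := rfl

/-- The class of a singular 1-simplex modulo boundaries. -/
def simplexClass (k : C(stdSimplex ℝ (Fin 2), S)) : ChainsModBoundaries S :=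
  (TopCat.toSSet.obj (TopCat.of S)).ιChainComplex (singularSimplex k) ≫
    (singularChains S).pOpcycles 1

/-- The boundary of a singular 2-simplex is the alternating sum of its faces, and it dies in
`opcycles`. -/
lemma simplexClass_triangle (k : C(stdSimplex ℝ (Fin 3), S)) :
    simplexClass (k.comp ⟨stdSimplex.map (SimplexCategory.δ (n := 1) 1),
        stdSimplex.continuous_map _⟩) =
      simplexClass (k.comp ⟨stdSimplex.map (SimplexCategory.δ (n := 1) 0),
        stdSimplex.continuous_map _⟩) +
      simplexClass (k.comp ⟨stdSimplex.map (SimplexCategory.δ (n := 1) 2),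
        stdSimplex.continuous_map _⟩) := by
  have h := congrArg (CategoryStruct.comp ((TopCat.toSSet.obj (TopCat.of S)).ιChainComplex
    (singularSimplex k))) ((singularChains S).d_pOpcycles 2 1)
  simp only [Limits.comp_zero] at h
  rw [SSet.ιChainComplex_d_assoc, Fin.sum_univ_three] at h
  simp only [Preadditive.add_comp, singularSimplex_δ] at h
  simp only [Fin.val_zero, pow_zero, one_smul, Fin.val_one, pow_one, Fin.val_two, even_two,
    Even.neg_pow, one_pow, neg_smul, Preadditive.neg_comp] at h
  rw [simplexClass, simplexClass, simplexClass, ← sub_eq_zero, ← neg_eq_zero, ← h]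
  abel

lemma stdSimplex_map_δ_apply (i : Fin 3) (x : stdSimplex ℝ (Fin 2)) (m : Fin 3) :
    (stdSimplex.map (SimplexCategory.δ (n := 1) i) x) m =
      (if i.succAbove 0 = m then x 0 else 0) + (if i.succAbove 1 = m then x 1 else 0) := by
  rw [stdSimplex.map_coe, FunOnFinite.linearMap_apply_apply, Finset.sum_filter, Fin.sum_univ_two]
  rfl

/-- The affine singular 1-simplex from `a` to `b` in the plane, mapped by `K`. -/
def segmentSimplex (K : C(ℝ × ℝ, S)) (a b : ℝ × ℝ) : C(stdSimplex ℝ (Fin 2), S) where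
  toFun x := K (x 0 • a + x 1 • b)
  continuous_toFun := by
    have h : ∀ i, Continuous fun x : stdSimplex ℝ (Fin 2) => x i := fun i =>
      (continuous_apply i).comp continuous_subtype_val
    exact K.continuous.comp (((h 0).smul continuous_const).add ((h 1).smul continuous_const))

/-- The triangle relation for the affine 2-simplex with vertices `a`, `b`, `c`, whose faces are the
three segments. The triangle may be degenerate, which is what the concatenation of paths uses. -/
lemma simplexClass_segment_add (K : C(ℝ × ℝ, S)) (a b c : ℝ × ℝ) :
    simplexClass (segmentSimplex K a c) =
      simplexClass (segmentSimplex K b c) + simplexClass (segmentSimplex K a b) := by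
  have h : ∀ i, Continuous fun x : stdSimplex ℝ (Fin 3) => x i := fun i =>
    (continuous_apply i).comp continuous_subtype_val
  have e := simplexClass_triangle (S := S)
    ⟨fun x => K (x 0 • a + x 1 • b + x 2 • c), K.continuous.comp ((((h 0).smul continuous_const).add
      ((h 1).smul continuous_const)).add ((h 2).smul continuous_const))⟩
  convert e using 2
  · ext x
    simp only [segmentSimplex, ContinuousMap.coe_mk, ContinuousMap.comp_apply,
      stdSimplex_map_δ_apply]
    simp [Fin.succAbove]
  · congr 1
    ext x
    simp only [segmentSimplex, ContinuousMap.coe_mk, ContinuousMap.comp_apply,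
      stdSimplex_map_δ_apply]
    simp [Fin.succAbove]
  · congr 1
    ext x
    simp only [segmentSimplex, ContinuousMap.coe_mk, ContinuousMap.comp_apply,
      stdSimplex_map_δ_apply]
    simp [Fin.succAbove, Fin.lt_def]

lemma simplexClass_const (c : S) : simplexClass (ContinuousMap.const _ c) = 0 := by
  have h := simplexClass_segment_add (ContinuousMap.const (ℝ × ℝ) c) 0 0 0
  have e : segmentSimplex (ContinuousMap.const (ℝ × ℝ) c) 0 0 = ContinuousMap.const _ c := rfl
  rw [e] at h
  simpa using h

/-- The coordinate of a point of the standard 1-simplex. -/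
def simplexCoord : C(stdSimplex ℝ (Fin 2), I) where
  toFun x := ⟨x 1, stdSimplex.zero_le x 1, stdSimplex.le_one x 1⟩
  continuous_toFun :=
    Continuous.subtype_mk ((continuous_apply 1).comp continuous_subtype_val) _

/-- The class of a path modulo boundaries. -/
def pathClass {x y : S} (p : Path x y) : ChainsModBoundaries S :=
  simplexClass ((p : C(I, S)).comp simplexCoord)

/-- Once paths are presented as images of segments under one map of the plane, relations between
them follow from triangles. -/
lemma pathClass_eq_segment {x y : S} (p : Path x y) (K : C(ℝ × ℝ, S)) (a b : ℝ × ℝ)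
    (h : ∀ t : I, K ((1 - t : ℝ) • a + (t : ℝ) • b) = p t) :
    pathClass p = simplexClass (segmentSimplex K a b) := by
  unfold pathClass
  congr 1
  ext u
  have e := stdSimplex.add_eq_one u
  have := h (simplexCoord u)
  simp only [ContinuousMap.comp_apply, segmentSimplex, ContinuousMap.coe_mk]
  rw [show u 0 = 1 - u 1 by linarith]
  exact this.symm

variable (S) in
/-- The functional that takes a path to its class modulo boundaries. -/
def singularPathFunctional : PathFunctional S (ChainsModBoundaries S) where
  val p := pathClass p
  val_trans {x y z} p q := by
    -- Concatenation comes from a degenerate triangle: `K` ignores the second coordinate, and the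
    -- vertices lie on a line at `0`, `1/2` and `1`.
    let K : C(ℝ × ℝ, S) := ⟨fun u => (p.trans q).extend u.1, by fun_prop⟩
    rw [pathClass_eq_segment (p.trans q) K 0 (1, 0) (fun t => by simp [K]),
      pathClass_eq_segment p K 0 (1 / 2, 0) (fun t => ?_),
      pathClass_eq_segment q K (1 / 2, 0) (1, 0) (fun t => ?_),
      simplexClass_segment_add K 0 (1 / 2, 0) (1, 0), add_comm]
    · have h : (2⁻¹ * (1 - t) + t : ℝ) ∈ I := ⟨by linarith [t.2.1, t.2.2], by linarith [t.2.1, t.2.2]⟩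
      simp only [K, ContinuousMap.coe_mk]
      have e : ((1 - t : ℝ) • ((1 / 2, 0) : ℝ × ℝ) + (t : ℝ) • ((1, 0) : ℝ × ℝ)).1 =
        2⁻¹ * (1 - t) + t := by simp; ring
      rw [e, Path.extend_apply _ h, Path.trans_apply]
      split_ifs with h'
      -- The second half of the interval meets the first branch of `trans` only at the midpoint,
      -- that is at `t = 0`.
      · have : (t : ℝ) = 0 := by simp only at h'; linarith [t.2.1]
        have h0 : t = 0 := Subtype.ext this
        subst h0
        simp
      · congr 1
        ext
        simp
        ring
    · have h : (2⁻¹ * t : ℝ) ∈ I := ⟨by linarith [t.2.1, t.2.2], by linarith [t.2.1, t.2.2]⟩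
      simp only [K, ContinuousMap.coe_mk]
      have e : ((1 - t : ℝ) • (0 : ℝ × ℝ) + (t : ℝ) • ((1 / 2, 0) : ℝ × ℝ)).1 = 2⁻¹ * t := by
        simp; ring
      rw [e, Path.extend_apply _ h, Path.trans_apply, dif_pos (by simp only; linarith [t.2.2])]
      congr 1
      ext
      simp
  val_congr {x y} p q h := by
    obtain ⟨F⟩ := h
    -- The homotopy is extended to the plane by clamping both coordinates; the first coordinate is
    -- the homotopy parameter.
    let K : C(ℝ × ℝ, S) :=
      ⟨fun u => F (Set.projIcc 0 1 zero_le_one u.1, Set.projIcc 0 1 zero_le_one u.2), by fun_prop⟩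
    have hb : simplexClass (segmentSimplex K 0 (1, 0)) = 0 := by
      rw [← simplexClass_const x]
      congr 1
      ext u
      simp [segmentSimplex, K]
    have ht : simplexClass (segmentSimplex K (0, 1) (1, 1)) = 0 := by
      rw [← simplexClass_const y]
      congr 1
      ext u
      have e := stdSimplex.add_eq_one u
      simp [segmentSimplex, K, e]
    -- The diagonal of the square is computed through both triangles; the two sides along which the
    -- endpoints of the paths stay fixed contribute nothing.
    have h1 := simplexClass_segment_add K 0 (1, 0) (1, 1)
    rw [simplexClass_segment_add K 0 (0, 1) (1, 1), hb, ht, zero_add, add_zero] at h1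
    rw [pathClass_eq_segment p K 0 (0, 1) (fun t => by simp [K]),
      pathClass_eq_segment q K (1, 0) (1, 1) (fun t => by simp [K]), h1]

lemma stdSimplex_map_δ_zero_dim_apply (i : Fin 2) (x : stdSimplex ℝ (Fin 1)) (m : Fin 2) :
    (stdSimplex.map (SimplexCategory.δ (n := 0) i) x) m =
      if i.succAbove 0 = m then 1 else 0 := by
  rw [stdSimplex.map_coe, FunOnFinite.linearMap_apply_apply, Finset.sum_filter,
    Fin.sum_univ_one]
  have h : x 0 = 1 := by simp
  rw [h]
  rfl

/-- The path underlying a singular 1-simplex. -/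
def pathOfSimplex (k : C(stdSimplex ℝ (Fin 2), S)) :
    Path (k (stdSimplex.map (SimplexCategory.δ (n := 0) 1) default))
      (k (stdSimplex.map (SimplexCategory.δ (n := 0) 0) default)) where
  toFun t := k ⟨![1 - t, t], by
    refine ⟨fun i => ?_, by simp⟩
    fin_cases i
    · simpa using t.2.2
    · simpa using t.2.1⟩
  continuous_toFun := by
    refine k.continuous.comp (Continuous.subtype_mk (continuous_pi fun i => ?_) _)
    fin_cases i
    · exact continuous_const.sub continuous_subtype_val
    · exact continuous_subtype_val
  source' := by
    congr 1
    ext m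
    rw [stdSimplex_map_δ_zero_dim_apply]
    fin_cases m <;> simp [Fin.succAbove] <;> rfl
  target' := by
    congr 1
    ext m
    rw [stdSimplex_map_δ_zero_dim_apply]
    fin_cases m <;> simp [Fin.succAbove] <;> rfl

lemma pathOfSimplex_simplexCoord (k : C(stdSimplex ℝ (Fin 2), S)) :
    ((pathOfSimplex k : C(I, S)).comp simplexCoord) = k := by
  ext u
  change k _ = k u
  congr 1
  ext m
  have e := stdSimplex.add_eq_one u
  fin_cases m
  · change 1 - u 1 = u 0
    linarith
  · rfl

lemma pathClass_pathOfSimplex (k : C(stdSimplex ℝ (Fin 2), S)) :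
    pathClass (pathOfSimplex k) = simplexClass k := by
  unfold pathClass
  rw [pathOfSimplex_simplexCoord]

lemma pathClass_map {T : Type} [TopologicalSpace T] (f : C(S, T)) {x y : S} (p : Path x y) :
    pathClass (p.map f.continuous) = simplexClass (f.comp ((p : C(I, S)).comp simplexCoord)) := by
  unfold pathClass
  congr 1

/-- A self-map of a simplicial set acts trivially on first homology if it changes the classes of
1-simplices modulo boundaries by a coboundary. -/
theorem SSet.homologyMap_one_eq_id {C : Type*} [Category* C] [Limits.HasCoproducts.{0} C]
    [Preadditive C] [CategoryWithHomology C] (X : SSet.{0}) (R : C) (f : X ⟶ X)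
    (h : X _⦋0⦌ → (R ⟶ (X.chainComplex R).opcycles 1))
    (hf : ∀ x : X _⦋1⦌,
      CategoryStruct.comp (X.ιChainComplex (f.app _ x)) ((X.chainComplex R).pOpcycles 1) -
        CategoryStruct.comp (X.ιChainComplex x) ((X.chainComplex R).pOpcycles 1) =
      h (X.δ 0 x) - h (X.δ 1 x)) :
    SSet.homologyMap f R 1 = 𝟙 _ := by
  let φ := SSet.chainComplexMap f R
  change HomologicalComplex.homologyMap φ 1 = 𝟙 _
  -- The function `h` on vertices extends linearly to 0-chains.
  let g : (X.chainComplex R).X 0 ⟶ (X.chainComplex R).opcycles 1 :=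
    Limits.Sigma.desc h
  have hg : ∀ x : X _⦋0⦌, CategoryStruct.comp (X.ιChainComplex x) g = h x := fun x =>
    Limits.Sigma.ι_desc _ _
  have key : HomologicalComplex.opcyclesMap φ 1 - 𝟙 _ =
      CategoryStruct.comp ((X.chainComplex R).fromOpcycles 1 0) g := by
    rw [← cancel_epi ((X.chainComplex R).pOpcycles 1), HomologicalComplex.p_fromOpcycles_assoc,
      Preadditive.comp_sub, HomologicalComplex.p_opcyclesMap, Category.comp_id]
    refine SSet.chainComplex_hom_ext fun x => ?_
    rw [SSet.ιChainComplex_d_assoc, Fin.sum_univ_two, Preadditive.comp_sub,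
      SSet.ι_chainComplexMap_f_assoc, Preadditive.add_comp, hf]
    simp only [Fin.val_zero, pow_zero, one_smul, Fin.val_one, pow_one, neg_smul,
      Preadditive.neg_comp, hg, sub_eq_add_neg]
  -- Homology sits in the 1-chains modulo boundaries as the part killed by the differential, and the
  -- difference of the two maps factors through the differential.
  have h0 := congrArg (CategoryStruct.comp ((X.chainComplex R).homologyι 1)) key
  rw [HomologicalComplex.homologyι_comp_fromOpcycles_assoc, Limits.zero_comp, Preadditive.comp_sub,
    Category.comp_id, ← HomologicalComplex.homologyι_naturality, sub_eq_zero] at h0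
  rw [← cancel_mono ((X.chainComplex R).homologyι 1), h0, Category.id_comp]

/-- If the functional of a map `f` differs from that of the identity by a coboundary, then `f` acts
trivially on first homology. -/
theorem H1_map_eq_id (f : C(S, S)) (h : S → ChainsModBoundaries S)
    (hf : ∀ {x y : S} (p : Path x y), pathClass (p.map f.continuous) - pathClass p = h y - h x) :
    H1.map (TopCat.ofHom f) = 𝟙 _ := by
  have key : SSet.homologyMap (TopCat.toSSet.map (TopCat.ofHom f)) (ModuleCat.of ℤ ℤ) 1 = 𝟙 _ := by
    refine SSet.homologyMap_one_eq_id (TopCat.toSSet.obj (TopCat.of S)) (ModuleCat.of ℤ ℤ)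
      (TopCat.toSSet.map (TopCat.ofHom f))
      (fun x => h (TopCat.toSSetObjEquiv (TopCat.of S) (Opposite.op ⦋0⦌) x default)) fun x => ?_
    obtain ⟨k, rfl⟩ := singularSimplex_surjective x
    have e := hf (pathOfSimplex k)
    rw [pathClass_map, pathClass_pathOfSimplex, pathOfSimplex_simplexCoord] at e
    exact e
  exact key

end SingularHomology

/-! ## Diffeomorphisms supported in embedded discs -/

/-- The smooth self-diffeomorphisms of a surface. -/
abbrev Diffeo (M : Type) [TopologicalSpace M] [ChartedSpace Plane M] : Type :=
  Diffeomorph (𝓡 2) (𝓡 2) M M ∞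

/-- A perturbation of the identity by a contraction is a diffeomorphism of the plane. -/
def perturbDiffeo (k : Plane → Plane) (hk : ContDiff ℝ ∞ k) (c : NNReal) (hc : c < 1)
    (hl : LipschitzWith c k) : Diffeo Plane := by
  have ha : ApproximatesLinearOn (fun x => x + k x)
      ((ContinuousLinearEquiv.refl ℝ Plane : Plane ≃L[ℝ] Plane) : Plane →L[ℝ] Plane)
      Set.univ c := by
    intro x _ y _
    have := hl.dist_le_mul x y
    rw [dist_eq_norm, dist_eq_norm] at this
    have e : x + k x - (y + k y) - (x - y) = k x - k y := by abel
    exact (congrArg norm e).trans_le this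
  have hc' : c < ‖((ContinuousLinearEquiv.refl ℝ Plane).symm : Plane →L[ℝ] Plane)‖₊⁻¹ := by
    rw [ContinuousLinearEquiv.refl_symm, ContinuousLinearEquiv.coe_refl]
    simpa using hc
  let h : Plane ≃ₜ Plane := ha.toHomeomorph _ (Or.inr hc')
  have hh : ∀ x, h x = x + k x := fun x => rfl
  have hs : ContDiff ℝ ∞ h := contDiff_id.add hk
  have hd : ∀ a, ∃ f' : Plane ≃L[ℝ] Plane, HasFDerivAt h (f' : Plane →L[ℝ] Plane) a := by
    intro a
    have h1 : HasFDerivAt h (ContinuousLinearMap.id ℝ Plane + fderiv ℝ k a) a :=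
      (hasFDerivAt_id a).add ((hk.differentiable (by simp)) a).hasFDerivAt
    have hn : ‖fderiv ℝ k a‖ ≤ c := norm_fderiv_le_of_lipschitz ℝ hl
    -- A kernel vector satisfies `v = -Dk v`, which contradicts `‖Dk‖ ≤ c < 1` unless `v = 0`.
    have hinj : Function.Injective
        ((ContinuousLinearMap.id ℝ Plane + fderiv ℝ k a : Plane →L[ℝ] Plane) :
          Plane →ₗ[ℝ] Plane) := by
      rw [← LinearMap.ker_eq_bot, LinearMap.ker_eq_bot']
      intro v hv
      have hv' : v = -fderiv ℝ k a v := eq_neg_of_add_eq_zero_left hv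
      have h2 : ‖v‖ ≤ c * ‖v‖ := by
        conv_lhs => rw [hv', norm_neg]
        exact (ContinuousLinearMap.le_opNorm _ _).trans
          (mul_le_mul_of_nonneg_right hn (norm_nonneg _))
      have h3 : (c : ℝ) < 1 := hc
      have h4 := norm_nonneg v
      exact norm_eq_zero.1 (by nlinarith)
    refine ⟨(LinearEquiv.ofInjectiveEndo _ hinj).toContinuousLinearEquiv, ?_⟩
    convert h1 using 1
    ext v
    rfl
  choose f' hf' using hd
  exact
    { toEquiv := h.toEquiv
      contMDiff_toFun := hs.contMDiff
      contMDiff_invFun := (h.contDiff_symm hf' hs).contMDiff }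

namespace SmoothDisc

variable {M : Type} [TopologicalSpace M] [ChartedSpace Plane M] (E : SmoothDisc M)

lemma contMDiff : ContMDiff (𝓡 2) (𝓡 2) ∞ E.toFun := E.isLocalDiffeomorph.contMDiff

lemma continuous : Continuous E.toFun := E.contMDiff.continuous

lemma isOpenEmbedding : Topology.IsOpenEmbedding E.toFun :=
  .of_continuous_injective_isOpenMap E.continuous E.injective E.isLocalDiffeomorph.isOpenMap

/-- The inverse of the parametrization. -/
def inv : M → Plane := Function.invFun E.toFun

@[simp] lemma inv_apply (x : Plane) : E.inv (E.toFun x) = x :=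
  Function.leftInverse_invFun E.injective x

lemma apply_inv {y : M} (hy : y ∈ Set.range E.toFun) : E.toFun (E.inv y) = y := by
  obtain ⟨x, rfl⟩ := hy
  rw [inv_apply]

lemma contMDiffAt_inv {y : M} (hy : y ∈ Set.range E.toFun) :
    ContMDiffAt (𝓡 2) (𝓡 2) ∞ E.inv y := by
  obtain ⟨x, rfl⟩ := hy
  have h := E.isLocalDiffeomorph x
  refine h.localInverse_contMDiffAt.congr_of_eventuallyEq ?_
  filter_upwards [h.localInverse_eventuallyEq_right] with y' hy'
  have : E.toFun (h.localInverse y') = y' := hy'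
  conv_lhs => rw [← this]
  exact E.inv_apply _

lemma continuousOn_inv : ContinuousOn E.inv (Set.range E.toFun) := fun _ hy =>
  (E.contMDiffAt_inv hy).continuousAt.continuousWithinAt

/-- The extension of a self-map of the plane by the identity. -/
def extend (k : Plane → Plane) (y : M) : M :=
  open Classical in if y ∈ Set.range E.toFun then E.toFun (k (E.inv y)) else y

@[simp] lemma extend_apply (k : Plane → Plane) (x : Plane) :
    E.extend k (E.toFun x) = E.toFun (k x) := by
  simp [extend]

lemma extend_of_notMem (k : Plane → Plane) {y : M} (hy : y ∉ Set.range E.toFun) :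
    E.extend k y = y := if_neg hy

lemma extend_eq_self (k : Plane → Plane) {y : M} (hy : ∀ x, y = E.toFun x → k x = x) :
    E.extend k y = y := by
  by_cases h : y ∈ Set.range E.toFun
  · obtain ⟨x, rfl⟩ := h
    rw [extend_apply, hy x rfl]
  · exact E.extend_of_notMem k h

lemma extend_comp (k l : Plane → Plane) (y : M) :
    E.extend k (E.extend l y) = E.extend (k ∘ l) y := by
  by_cases h : y ∈ Set.range E.toFun
  · obtain ⟨x, rfl⟩ := h
    simp
  · rw [E.extend_of_notMem _ h, E.extend_of_notMem _ h, E.extend_of_notMem _ h]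

lemma isClosed_image_closedBall [T2Space M] (R : ℝ) :
    IsClosed (E.toFun '' Metric.closedBall 0 R) :=
  ((isCompact_closedBall 0 R).image E.continuous).isClosed

/-- Smoothness is checked on two open sets: in the coordinates of the disc, and off the compact
image of the ball of radius `R`, where the map is the projection to `M`. The parameter space is any
normed space, so that the families may depend on a displacement vector as well as on time. -/
lemma contMDiff_extend_family [T2Space M] {P : Type*} [NormedAddCommGroup P] [NormedSpace ℝ P]
    (k : P × Plane → Plane) (hk : ContDiff ℝ ∞ k) (R : ℝ) (hR : ∀ p x, R < ‖x‖ → k (p, x) = x) :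
    ContMDiff (𝓘(ℝ, P).prod (𝓡 2)) (𝓡 2) ∞
      (fun q : P × M => E.extend (fun x => k (q.1, x)) q.2) := by
  rintro ⟨p, y⟩
  by_cases hy : y ∈ Set.range E.toFun
  · have h1 : ContMDiffAt (𝓘(ℝ, P).prod (𝓡 2)) 𝓘(ℝ, P × Plane) ∞
        (fun q : P × M => (q.1, E.inv q.2)) (p, y) :=
      contMDiffAt_fst.prodMk_space
        ((E.contMDiffAt_inv hy).comp (p, y) contMDiffAt_snd)
    have h2 := (E.contMDiff.contMDiffAt (x := k (p, E.inv y))).comp (p, y)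
      (hk.contMDiff.contMDiffAt.comp (p, y) h1)
    refine h2.congr_of_eventuallyEq ?_
    have ho : IsOpen (Prod.snd ⁻¹' Set.range E.toFun : Set (P × M)) :=
      E.isOpenEmbedding.isOpen_range.preimage continuous_snd
    filter_upwards [ho.mem_nhds hy] with q hq
    exact if_pos hq
  · have ho : IsOpen (Prod.snd ⁻¹' (E.toFun '' Metric.closedBall 0 R)ᶜ : Set (P × M)) :=
      (E.isClosed_image_closedBall R).isOpen_compl.preimage continuous_snd
    have h1 : ContMDiffAt (𝓘(ℝ, P).prod (𝓡 2)) (𝓡 2) ∞ (Prod.snd : P × M → M) (p, y) :=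
      contMDiffAt_snd
    refine h1.congr_of_eventuallyEq ?_
    filter_upwards [ho.mem_nhds fun h => hy (Set.image_subset_range _ _ h)] with q hq
    refine E.extend_eq_self _ fun x hx => hR _ _ ?_
    by_contra h
    exact hq ⟨x, by simpa using h, hx.symm⟩

/-- The extension by the identity of a diffeomorphism of the plane with bounded support. -/
def extendDiffeo [T2Space M] (h : Diffeo Plane) (R : ℝ) (hR : ∀ x, R < ‖x‖ → h x = x) :
    Diffeo M where
  toFun := E.extend h
  invFun := E.extend h.symm
  left_inv y := by
    rw [extend_comp]
    exact E.extend_eq_self _ fun x _ => by simp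
  right_inv y := by
    rw [extend_comp]
    exact E.extend_eq_self _ fun x _ => by simp
  contMDiff_toFun := by
    have h1 := E.contMDiff_extend_family (P := ℝ) (fun q => h q.2)
      (h.contMDiff.contDiff.comp contDiff_snd) R (fun _ x hx => hR x hx)
    exact h1.comp (f := fun y : M => ((0 : ℝ), y)) (contMDiff_const.prodMk contMDiff_id)
  contMDiff_invFun := by
    have h1 := E.contMDiff_extend_family (P := ℝ) (fun q => h.symm q.2)
      (h.symm.contMDiff.contDiff.comp contDiff_snd) R (fun _ x hx => by
        exact (h.toEquiv.symm_apply_eq).2 (hR x hx).symm)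
    exact h1.comp (f := fun y : M => ((0 : ℝ), y)) (contMDiff_const.prodMk contMDiff_id)

lemma extendDiffeo_apply [T2Space M] (h : Diffeo Plane) (R : ℝ) (hR : ∀ x, R < ‖x‖ → h x = x)
    (y : M) : E.extendDiffeo h R hR y = E.extend h y := rfl

/-- Every point of a smooth surface is the centre of small smoothly embedded discs. -/
lemma exists_center_subset [IsManifold (𝓡 2) ∞ M] {U : Set M} (hU : IsOpen U) {x : M}
    (hx : x ∈ U) : ∃ E : SmoothDisc M, E.toFun 0 = x ∧ Set.range E.toFun ⊆ U := by
  let c := chartAt Plane x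
  obtain ⟨r, hr, hb⟩ := Metric.isOpen_iff.1 (c.symm.isOpen_inter_preimage hU) (c x)
    ⟨c.map_source (mem_chart_source _ x), by
      change c.symm (c x) ∈ U
      rwa [c.left_inv (mem_chart_source _ x)]⟩
  let u : OpenPartialHomeomorph Plane Plane := OpenPartialHomeomorph.univBall (c x) r
  have hut : u.target = Metric.ball (c x) r := OpenPartialHomeomorph.univBall_target _ hr
  have hus : u.source = Set.univ := OpenPartialHomeomorph.univBall_source _ _
  let Φ₁ : PartialDiffeomorph (𝓡 2) (𝓡 2) Plane Plane ∞ :=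
    { toPartialEquiv := u.toPartialEquiv
      open_source := u.open_source
      open_target := u.open_target
      contMDiffOn_toFun := OpenPartialHomeomorph.contDiff_univBall.contMDiff.contMDiffOn
      contMDiffOn_invFun := by
        have h := (OpenPartialHomeomorph.contDiffOn_univBall_symm (n := ⊤) (c := c x) (r := r))
        rw [← hut] at h
        exact h.contMDiffOn }
  let Φ₂ : PartialDiffeomorph (𝓡 2) (𝓡 2) Plane M ∞ :=
    { toPartialEquiv := c.symm.toPartialEquiv
      open_source := c.open_target
      open_target := c.open_source
      contMDiffOn_toFun := contMDiffOn_chart_symm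
      contMDiffOn_invFun := contMDiffOn_chart }
  have hmem' : ∀ y, u y ∈ c.target ∩ c.symm ⁻¹' U := fun y =>
    hb (hut ▸ u.map_source (hus ▸ Set.mem_univ y))
  have hmem : ∀ y, u y ∈ c.target := fun y => (hmem' y).1
  refine ⟨⟨fun y => c.symm (u y), fun y z h => ?_, fun y => ?_⟩, ?_, ?_⟩
  · have h1 := c.symm.injOn (hmem y) (hmem z) h
    exact u.injOn (hus ▸ Set.mem_univ y) (hus ▸ Set.mem_univ z) h1
  · exact ⟨Φ₁.trans Φ₂, ⟨show y ∈ u.source from hus ▸ Set.mem_univ y, hmem y⟩, fun z _ => rfl⟩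
  · change c.symm (u 0) = x
    rw [OpenPartialHomeomorph.univBall_apply_zero]
    exact c.left_inv (mem_chart_source _ x)
  · rintro _ ⟨y, rfl⟩
    exact (hmem' y).2

/-- Every point of a smooth surface is the centre of a smoothly embedded disc. -/
lemma exists_center [IsManifold (𝓡 2) ∞ M] (x : M) : ∃ E : SmoothDisc M, E.toFun 0 = x := by
  obtain ⟨E, h, -⟩ := exists_center_subset isOpen_univ (Set.mem_univ x)
  exact ⟨E, h⟩

end SmoothDisc

/-- A smooth plateau function on the plane with a small Lipschitz constant. -/
lemma exists_plateau : ∃ C : NNReal, ∀ ρ : ℝ, 0 < ρ → ∃ χ : Plane → ℝ, ContDiff ℝ ∞ χ ∧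
    (∀ x, ‖x‖ ≤ ρ → χ x = 1) ∧ (∀ x, 2 * ρ ≤ ‖x‖ → χ x = 0) ∧ (∀ x, χ x ∈ Set.Icc (0 : ℝ) 1) ∧
    ∀ x, ‖fderiv ℝ χ x‖ ≤ C / ρ := by
  -- Rescaling one fixed bump by `ρ` divides its Lipschitz constant by `ρ`, so `C` is independent of
  -- `ρ`.
  let b : ContDiffBump (0 : Plane) := ⟨1, 2, one_pos, one_lt_two⟩
  obtain ⟨C, hC⟩ := (b.contDiff (n := ⊤)).lipschitzWith_of_hasCompactSupport (𝕂 := ℝ)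
    b.hasCompactSupport (by simp)
  refine ⟨C, fun ρ hρ => ⟨fun x => b (ρ⁻¹ • x), (b.contDiff (n := ⊤)).comp (contDiff_const_smul _),
    fun x hx => ?_, fun x hx => ?_, fun x => ⟨b.nonneg, b.le_one⟩, fun x => ?_⟩⟩
  · refine b.one_of_mem_closedBall ?_
    rw [mem_closedBall_zero_iff, norm_smul, norm_inv, Real.norm_of_nonneg hρ.le]
    change ρ⁻¹ * ‖x‖ ≤ 1
    rw [inv_mul_le_iff₀ hρ]
    linarith
  · refine b.zero_of_le_dist ?_
    rw [dist_zero_right, norm_smul, norm_inv, Real.norm_of_nonneg hρ.le]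
    change 2 ≤ ρ⁻¹ * ‖x‖
    rw [le_inv_mul_iff₀ hρ]
    linarith
  · have h : LipschitzWith (C * ‖ρ⁻¹‖₊) (fun x => b (ρ⁻¹ • x)) :=
      hC.comp (lipschitzWith_smul ρ⁻¹)
    refine (norm_fderiv_le_of_lipschitz ℝ h).trans_eq ?_
    simp [div_eq_mul_inv, abs_of_pos hρ]

/-! ## Generation of the plane linear maps of positive determinant -/

open Matrix in
-- An explicit form of the fact that a neighbourhood of the identity generates the connected group
-- of matrices of positive determinant: transvections and positive scalars have `n`-th roots
-- arbitrarily close to the identity, and together they generate.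
theorem Matrix.mem_of_det_pos (S : Submonoid (Matrix (Fin 2) (Fin 2) ℝ)) {ε : ℝ} (hε : 0 < ε)
    (hS : ∀ A : Matrix (Fin 2) (Fin 2) ℝ, (∀ i j, |A i j - (1 : Matrix _ _ ℝ) i j| < ε) → A ∈ S)
    (A : Matrix (Fin 2) (Fin 2) ℝ) (hA : 0 < A.det) : A ∈ S := by
  have hU : ∀ c : ℝ, !![1, c; 0, 1] ∈ S := by
    intro c
    obtain ⟨n, hn⟩ := exists_nat_gt (|c| / ε)
    have hn0 : 0 < (n : ℝ) := (div_nonneg (abs_nonneg c) hε.le).trans_lt hn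
    have hp : ∀ m : ℕ, (!![1, c / n; 0, 1] : Matrix (Fin 2) (Fin 2) ℝ) ^ m =
        !![1, m * (c / n); 0, 1] := by
      intro m
      induction m with
      | zero => simp [Matrix.one_fin_two]
      | succ m ih =>
        rw [pow_succ, ih, Matrix.mul_fin_two]
        push_cast
        congr 1
        simp
        ring
    have h := hp n
    rw [mul_div_cancel₀ _ hn0.ne'] at h
    rw [← h]
    refine S.pow_mem (hS _ fun i j => ?_) n
    rw [div_lt_iff₀ hε] at hn
    fin_cases i <;> fin_cases j <;> simp [hε]
    rw [abs_div, Nat.abs_cast, div_lt_iff₀ hn0]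
    linarith
  have hL : ∀ c : ℝ, !![1, 0; c, 1] ∈ S := by
    intro c
    obtain ⟨n, hn⟩ := exists_nat_gt (|c| / ε)
    have hn0 : 0 < (n : ℝ) := (div_nonneg (abs_nonneg c) hε.le).trans_lt hn
    have hp : ∀ m : ℕ, (!![1, 0; c / n, 1] : Matrix (Fin 2) (Fin 2) ℝ) ^ m =
        !![1, 0; m * (c / n), 1] := by
      intro m
      induction m with
      | zero => simp [Matrix.one_fin_two]
      | succ m ih =>
        rw [pow_succ, ih, Matrix.mul_fin_two]
        push_cast
        congr 1
        simp
        ring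
    have h := hp n
    rw [mul_div_cancel₀ _ hn0.ne'] at h
    rw [← h]
    refine S.pow_mem (hS _ fun i j => ?_) n
    rw [div_lt_iff₀ hε] at hn
    fin_cases i <;> fin_cases j <;> simp [hε]
    rw [abs_div, Nat.abs_cast, div_lt_iff₀ hn0]
    linarith
  have hs : ∀ s : ℝ, 0 < s → !![s, 0; 0, s] ∈ S := by
    intro s hs
    -- The scalar `s` is the `n`-th power of `s ^ (1/n)`, and these roots tend to 1.
    have hlim : Filter.Tendsto (fun n : ℕ => s ^ ((n : ℝ)⁻¹)) Filter.atTop (nhds 1) := by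
      have h := (Real.continuousAt_const_rpow (b := 0) hs.ne').tendsto.comp
        tendsto_inv_atTop_nhds_zero_nat
      simpa [Function.comp_def] using h
    obtain ⟨n, hn, hn1⟩ := ((Metric.tendsto_nhds.1 hlim ε hε).and
      (Filter.eventually_ge_atTop 1)).exists
    set r := s ^ ((n : ℝ)⁻¹)
    have hp : ∀ m : ℕ, (!![r, 0; 0, r] : Matrix (Fin 2) (Fin 2) ℝ) ^ m = !![r ^ m, 0; 0, r ^ m] := by
      intro m
      induction m with
      | zero => simp [Matrix.one_fin_two]
      | succ m ih =>
        rw [pow_succ, ih, Matrix.mul_fin_two]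
        simp [pow_succ]
    have h := hp n
    rw [show r ^ n = s from Real.rpow_inv_natCast_pow hs.le (by omega)] at h
    rw [← h]
    refine S.pow_mem (hS _ fun i j => ?_) n
    rw [Real.dist_eq] at hn
    fin_cases i <;> fin_cases j <;> simp [hε, hn]
  -- With determinant 1 and a nonzero lower left entry, the matrix is a product upper, lower, upper
  -- of transvections.
  have h1 : ∀ a b c d : ℝ, a * d - b * c = 1 → c ≠ 0 → !![a, b; c, d] ∈ S := by
    intro a b c d h hc
    have e : !![a, b; c, d] = !![1, (a - 1) / c; 0, 1] * !![1, 0; c, 1] * !![1, (d - 1) / c; 0, 1] := by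
      rw [Matrix.mul_fin_two, Matrix.mul_fin_two]
      ext i j
      fin_cases i <;> fin_cases j <;> simp <;> field_simp <;> linarith
    rw [e]
    exact S.mul_mem (S.mul_mem (hU _) (hL _)) (hU _)
  have h2 : ∀ a b c d : ℝ, a * d - b * c = 1 → !![a, b; c, d] ∈ S := by
    intro a b c d h
    by_cases hc : c = 0
    · have ha : a ≠ 0 := by
        rintro rfl
        simp [hc] at h
      -- If the lower left entry is zero then `a ≠ 0`, and adding the first row to the second makes
      -- that entry nonzero.
      have e : !![a, b; c, d] = !![1, 0; -1, 1] * !![a, b; a + c, b + d] := by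
        rw [Matrix.mul_fin_two]
        ext i j
        fin_cases i <;> fin_cases j <;> simp
      rw [e]
      exact S.mul_mem (hL _) (h1 _ _ _ _ (by linarith) (by simpa [hc] using ha))
    · exact h1 _ _ _ _ h hc
  have hA' := hA
  rw [Matrix.det_fin_two] at hA'
  set s := Real.sqrt A.det
  have hspos : 0 < s := Real.sqrt_pos.2 hA
  have hss : s * s = A 0 0 * A 1 1 - A 0 1 * A 1 0 := by
    rw [← Matrix.det_fin_two]
    exact Real.mul_self_sqrt hA.le
  have e : A = !![s, 0; 0, s] * !![A 0 0 / s, A 0 1 / s; A 1 0 / s, A 1 1 / s] := by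
    rw [Matrix.mul_fin_two]
    ext i j
    fin_cases i <;> fin_cases j <;> simp <;> field_simp
  rw [e]
  refine S.mul_mem (hs _ hspos) (h2 _ _ _ _ ?_)
  field_simp
  linarith

/-! ## Smooth isotopies -/

section Isotopy

variable {M : Type} [TopologicalSpace M] [ChartedSpace Plane M]

/-- `φ` is a smooth family of diffeomorphisms that starts at the identity. -/
def IsSmoothIsotopy (φ : ℝ → Diffeo M) : Prop :=
  ContMDiff (𝓘(ℝ, ℝ).prod (𝓡 2)) (𝓡 2) ∞ (fun q : ℝ × M => φ q.1 q.2) ∧ ∀ x, φ 0 x = x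

namespace IsSmoothIsotopy

variable {φ ψ : ℝ → Diffeo M}

lemma refl : IsSmoothIsotopy (fun _ => Diffeomorph.refl (𝓡 2) M ∞) :=
  ⟨contMDiff_snd, fun _ => rfl⟩

lemma trans (hφ : IsSmoothIsotopy φ) (hψ : IsSmoothIsotopy ψ) :
    IsSmoothIsotopy (fun t => (φ t).trans (ψ t)) := by
  refine ⟨?_, fun x => ?_⟩
  · exact hψ.1.comp (contMDiff_fst.prodMk hφ.1)
  · change ψ 0 (φ 0 x) = x
    rw [hφ.2, hψ.2]

/-- The end of this isotopy is `φ₁⁻¹`. Only the single inverse `φ₁⁻¹` occurs, so joint smoothness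
follows from that of `φ`. -/
lemma reverse (hφ : IsSmoothIsotopy φ) :
    IsSmoothIsotopy (fun t => (φ 1).symm.trans (φ (1 - t))) := by
  refine ⟨?_, fun x => ?_⟩
  · have h : ContMDiff 𝓘(ℝ, ℝ) 𝓘(ℝ, ℝ) ∞ (fun t : ℝ => 1 - t) :=
      (contDiff_const.sub contDiff_id).contMDiff
    exact hφ.1.comp ((h.comp contMDiff_fst).prodMk ((φ 1).symm.contMDiff.comp contMDiff_snd))
  · change φ (1 - 0) ((φ 1).symm x) = x
    rw [sub_zero]
    exact (φ 1).apply_symm_apply x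

lemma conj (hφ : IsSmoothIsotopy φ) (g : Diffeo M) :
    IsSmoothIsotopy (fun t => (g.trans (φ t)).trans g.symm) := by
  refine ⟨?_, fun x => ?_⟩
  · exact g.symm.contMDiff.comp
      (hφ.1.comp (contMDiff_fst.prodMk (g.contMDiff.comp contMDiff_snd)))
  · change g.symm (φ 0 (g x)) = x
    rw [hφ.2]
    exact g.symm_apply_apply x

lemma continuous (hφ : IsSmoothIsotopy φ) : Continuous (fun q : ℝ × M => φ q.1 q.2) :=
  hφ.1.continuous

/-- The path traced by a point. -/
def trace (hφ : IsSmoothIsotopy φ) {x y : M} (hy : φ 1 x = y) : Path x y where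
  toFun t := φ t x
  continuous_toFun := hφ.continuous.comp (by fun_prop : Continuous fun t : I => ((t : ℝ), x))
  source' := hφ.2 x
  target' := hy

/-- In the two-parameter family `ψ_t (φ_s x)` the composite isotopy traces the diagonal of the
square and the concatenation traces two of its sides; both are images of paths in the simply
connected plane. -/
lemma trace_trans (hφ : IsSmoothIsotopy φ) (hψ : IsSmoothIsotopy ψ) {x y z : M} (hy : φ 1 x = y)
    (hz : ψ 1 y = z) :
    ((hφ.trans hψ).trace (show ψ 1 (φ 1 x) = z by rw [hy, hz])).Homotopic
      ((hφ.trace hy).trans (hψ.trace hz)) := by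
  let K : C(ℝ × ℝ, M) := ⟨fun q => ψ q.2 (φ q.1 x), by
    have h1 : Continuous fun q : ℝ × ℝ => φ q.1 x :=
      hφ.continuous.comp (by fun_prop : Continuous fun q : ℝ × ℝ => (q.1, x))
    exact hψ.continuous.comp (continuous_snd.prodMk h1)⟩
  let d : Path ((0, 0) : ℝ × ℝ) (1, 1) :=
    ⟨⟨fun t => ((t : ℝ), (t : ℝ)), by fun_prop⟩, by simp, by simp⟩
  let a : Path ((0, 0) : ℝ × ℝ) (1, 0) := ⟨⟨fun t => ((t : ℝ), 0), by fun_prop⟩, by simp, by simp⟩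
  let b : Path ((1, 0) : ℝ × ℝ) (1, 1) := ⟨⟨fun t => (1, (t : ℝ)), by fun_prop⟩, by simp, by simp⟩
  have h := (SimplyConnectedSpace.paths_homotopic d (a.trans b)).map K
  rw [Path.map_trans] at h
  have e0 : x = K (0, 0) := by simp [K, hφ.2, hψ.2]
  have e1 : y = K (1, 0) := by simp [K, hψ.2, hy]
  have e2 : z = K (1, 1) := by simp [K, hy, hz]
  subst e1
  subst e2
  have h' := h.pathCast e0 rfl
  convert h' using 1
  · ext t
    rfl
  · ext t
    simp only [Path.cast_coe, Path.trans_apply]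
    split_ifs with ht
    · change φ _ x = K _
      simp [K, a, hψ.2]
    · change ψ _ (K (1, 0)) = K _
      simp [K, b, hψ.2]

/-- The path of images under the final diffeomorphism is homotopic to the original path, if the
isotopy fixes the endpoints. -/
lemma map_homotopic (hφ : IsSmoothIsotopy φ) {x y : M} (p : Path x y) (hx : ∀ t, φ t x = x)
    (hy : ∀ t, φ t y = y) :
    ((p.map (φ 1).continuous).cast (hx 1).symm (hy 1).symm).Homotopic p := by
  refine Path.Homotopic.symm ⟨⟨⟨⟨fun q => φ q.1 (p q.2), ?_⟩, fun t => ?_, fun t => ?_⟩, ?_⟩⟩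
  · exact hφ.continuous.comp
      (by fun_prop : Continuous fun q : I × I => ((q.1 : ℝ), p q.2))
  · exact hφ.2 _
  · rfl
  · rintro t s (rfl | rfl)
    · simp [hx]
    · simp [hy]

end IsSmoothIsotopy

/-- A perturbation of the identity with small derivative and bounded support in a disc is the end
of a smooth isotopy along straight lines. -/
theorem SmoothDisc.exists_isotopy_of_perturbation [T2Space M] (E : SmoothDisc M) (k : Plane → Plane)
    (hk : ContDiff ℝ ∞ k) (hd : ∀ x, ‖fderiv ℝ k x‖ ≤ 1 / 2) (R : ℝ)
    (hR : ∀ x, R < ‖x‖ → k x = 0) :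
    ∃ φ : ℝ → Diffeo M, IsSmoothIsotopy φ ∧
      (∀ t x, φ t (E.toFun x) = E.toFun (x + Real.smoothTransition t • k x)) ∧
      ∀ t y, (∀ x, y = E.toFun x → R < ‖x‖) → φ t y = y := by
  have hl : LipschitzWith (1 / 2) k :=
    lipschitzWith_of_nnnorm_fderiv_le (hk.differentiable (by simp)) fun x => by
      rw [← NNReal.coe_le_coe]
      simpa using hd x
  -- The smooth transition takes values in `[0, 1]` at every real time, so each member of the family
  -- remains a perturbation by a contraction.
  have hlt : ∀ t : ℝ, LipschitzWith (1 / 2) fun x => Real.smoothTransition t • k x := by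
    intro t
    refine LipschitzWith.of_dist_le_mul fun x y => ?_
    rw [dist_smul₀]
    refine le_trans ?_ (hl.dist_le_mul x y)
    have h1 := Real.smoothTransition.nonneg t
    have h2 := Real.smoothTransition.le_one t
    rw [Real.norm_of_nonneg h1]
    exact mul_le_of_le_one_left dist_nonneg h2
  have hc : (1 / 2 : NNReal) < 1 := by
    rw [← NNReal.coe_lt_coe]
    norm_num
  have hkt : ∀ t : ℝ, ContDiff ℝ ∞ fun x => Real.smoothTransition t • k x := fun t =>
    hk.const_smul _
  let h : ℝ → Diffeo Plane := fun t => perturbDiffeo _ (hkt t) _ hc (hlt t)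
  have hR' : ∀ t x, R < ‖x‖ → h t x = x := fun t x hx => by
    change x + Real.smoothTransition t • k x = x
    rw [hR x hx, smul_zero, add_zero]
  refine ⟨fun t => E.extendDiffeo (h t) R (hR' t), ⟨?_, fun y => ?_⟩, fun t x => ?_,
    fun t y hy => ?_⟩
  · refine E.contMDiff_extend_family (fun q : ℝ × Plane => q.2 + Real.smoothTransition q.1 • k q.2)
      ?_ R hR'
    exact contDiff_snd.add
      ((Real.smoothTransition.contDiff.comp contDiff_fst).smul (hk.comp contDiff_snd))
  · refine E.extend_eq_self _ fun x _ => ?_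
    change x + Real.smoothTransition 0 • k x = x
    simp
  · rw [E.extendDiffeo_apply, E.extend_apply]
    rfl
  · exact E.extend_eq_self _ fun x hx => hR' t x (hy x hx)

/-- A plateau function that is wide enough for translations by vectors of norm at most 2. -/
lemma exists_wide_plateau : ∃ (χ : Plane → ℝ) (R : ℝ), ContDiff ℝ ∞ χ ∧
    (∀ x, ‖x‖ ≤ 1 → χ x = 1) ∧ (∀ x, R < ‖x‖ → χ x = 0) ∧ ∀ x, ‖fderiv ℝ χ x‖ ≤ 1 / 4 := by
  obtain ⟨C, hC⟩ := exists_plateau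
  -- The radius `ρ = 4C + 1` gives `C / ρ ≤ 1/4` and is at least 1.
  obtain ⟨χ, h1, h2, h3, -, h5⟩ := hC (4 * C + 1) (by positivity)
  refine ⟨χ, 2 * (4 * C + 1), h1, fun x hx => h2 x (hx.trans ?_), fun x hx => h3 x hx.le,
    fun x => (h5 x).trans ?_⟩
  · linarith [C.2]
  · have := C.2
    rw [div_le_div_iff₀ (by positivity) (by positivity)]
    linarith

lemma fderiv_smul_const_le {χ : Plane → ℝ} (h : ContDiff ℝ ∞ χ) {a : ℝ}
    (ha : ∀ x, ‖fderiv ℝ χ x‖ ≤ a) (w : Plane) (x : Plane) :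
    ‖fderiv ℝ (fun x => χ x • w) x‖ ≤ a * ‖w‖ := by
  rw [fderiv_smul_const ((h.differentiable (by simp)) x), ContinuousLinearMap.norm_smulRight_apply]
  exact mul_le_mul_of_nonneg_right (ha x) (norm_nonneg _)

/-- A point of the unit disc is moved along a straight line to any other. -/
theorem SmoothDisc.exists_translation [T2Space M] (E : SmoothDisc M) {u v : Plane}
    (hu : ‖u‖ ≤ 1) (hv : ‖v‖ ≤ 1) :
    ∃ φ : ℝ → Diffeo M, IsSmoothIsotopy φ ∧
      (∀ t, φ t (E.toFun u) = E.toFun (u + Real.smoothTransition t • (v - u))) ∧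
      ∀ t, ∀ y ∉ Set.range E.toFun, φ t y = y := by
  obtain ⟨χ, R, h1, h2, h3, h4⟩ := exists_wide_plateau
  have hn := norm_sub_le v u
  -- The displacement has norm at most 2 and the plateau has slope at most `1/4`, which gives the
  -- required bound `1/2`.
  obtain ⟨φ, hφ, ha, hb⟩ := E.exists_isotopy_of_perturbation (fun x => χ x • (v - u))
    (h1.smul contDiff_const)
    (fun x => (fderiv_smul_const_le h1 h4 _ x).trans (by linarith)) R
    (fun x hx => by simp [h3 x hx])
  refine ⟨φ, hφ, fun t => ?_, fun t y hy => hb t y fun x hx => (hy ⟨x, hx.symm⟩).elim⟩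
  rw [ha, h2 u hu, one_smul]

/-- Every path is homotopic to the trace of its starting point under a smooth isotopy. -/
theorem exists_isotopy_trace_homotopic [T2Space M] [IsManifold (𝓡 2) ∞ M] {x y : M}
    (p : Path x y) :
    ∃ (φ : ℝ → Diffeo M) (hφ : IsSmoothIsotopy φ) (hy : φ 1 x = y), (hφ.trace hy).Homotopic p := by
  choose E hE using SmoothDisc.exists_center (M := M)
  refine Path.induction_openCover (U := fun z => (E z).toFun '' Metric.ball 0 1)
    (fun z => (E z).isOpenEmbedding.isOpenMap _ Metric.isOpen_ball)
    (fun z => ⟨z, 0, by simp, hE z⟩)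
    (fun {x y} p => ∃ (φ : ℝ → Diffeo M) (hφ : IsSmoothIsotopy φ) (hy : φ 1 x = y),
      (hφ.trace hy).Homotopic p) ?_ ?_ ?_ p
  · rintro x y z p q ⟨φ, hφ, hy, h⟩ ⟨ψ, hψ, hz, h'⟩
    exact ⟨_, hφ.trans hψ, _, (hφ.trace_trans hψ hy hz).trans (h.hcomp h')⟩
  · rintro x y p q hpq ⟨φ, hφ, hy, h⟩
    exact ⟨φ, hφ, hy, h.trans hpq⟩
  · intro z x y p hp
    have hr : ∀ t, p t ∈ Set.range (E z).toFun := fun t => Set.image_subset_range _ _ (hp t)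
    have hb : ∀ t, ‖(E z).inv (p t)‖ ≤ 1 := by
      intro t
      obtain ⟨a, ha, e⟩ := hp t
      rw [← e, SmoothDisc.inv_apply]
      exact (mem_ball_zero_iff.1 ha).le
    have hx : x = (E z).toFun ((E z).inv (p 0)) := by
      rw [(E z).apply_inv (hr 0), p.source]
    have hy : y = (E z).toFun ((E z).inv (p 1)) := by
      rw [(E z).apply_inv (hr 1), p.target]
    let q : Path ((E z).inv (p 0)) ((E z).inv (p 1)) :=
      ⟨⟨fun t => (E z).inv (p t), (E z).continuousOn_inv.comp_continuous p.continuous hr⟩, rfl, rfl⟩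
    obtain ⟨φ, hφ, h, -⟩ := (E z).exists_translation (hb 0) (hb 1)
    have h1 : φ 1 x = y := by
      have e := h 1
      rw [Real.smoothTransition.one, one_smul, add_sub_cancel, ← hx, ← hy] at e
      exact e
    -- The isotopy moves the point along the straight path `l`, which is homotopic to `p` read in
    -- the coordinates of the disc because the plane is simply connected.
    let l : Path ((E z).inv (p 0)) ((E z).inv (p 1)) :=
      ⟨⟨fun t => (E z).inv (p 0) + Real.smoothTransition t • ((E z).inv (p 1) - (E z).inv (p 0)), by
        have := Real.smoothTransition.continuous
        fun_prop⟩, by simp, by simp⟩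
    refine ⟨φ, hφ, h1, ?_⟩
    have e := ((SimplyConnectedSpace.paths_homotopic l q).map
      ⟨(E z).toFun, (E z).continuous⟩).pathCast hx hy
    convert e using 1
    · ext t
      change φ t x = (E z).toFun (l t)
      have e := h t
      rw [← hx] at e
      exact e
    · ext t
      exact ((E z).apply_inv (hr t)).symm

end Isotopy

/-! ## Changing the germ of an isotopy at a fixed point -/

/-- A map that vanishes at `0` and has small derivative near `0` can be cut off to a small
perturbation. -/
lemma exists_cutoff : ∃ ε : ℝ, 0 < ε ∧ ∀ (g : Plane → Plane) (r ρ : ℝ), 0 < ρ → 2 * ρ < r →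
    ContDiffOn ℝ ∞ g (Metric.ball 0 r) → g 0 = 0 →
    (∀ x ∈ Metric.ball (0 : Plane) r, ‖fderiv ℝ g x‖ ≤ ε) →
    ∃ k : Plane → Plane, ContDiff ℝ ∞ k ∧ (∀ x, ‖fderiv ℝ k x‖ ≤ 1 / 2) ∧
      (∀ x, ‖x‖ ≤ ρ → k x = g x) ∧ ∀ x, 2 * ρ < ‖x‖ → k x = 0 := by
  obtain ⟨C, hC⟩ := exists_plateau
  have hC0 : (0 : ℝ) ≤ C := C.2
  -- The derivative of `χ • g` is bounded by `ε` from the term with `Dg`, plus `(C / ρ) · 2ρε` from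
  -- the term with `Dχ`, since `‖g‖ ≤ 2ρε` on the ball of radius `2ρ`. The choice makes `ε (1 + 2C)
  -- = 1/2`.
  refine ⟨1 / (2 * (1 + 2 * C)), by positivity, fun g r ρ hρ hr hg hg0 hd => ?_⟩
  set ε : ℝ := 1 / (2 * (1 + 2 * C)) with hε
  have hε0 : 0 < ε := by positivity
  obtain ⟨χ, h1, h2, h3, h4, h5⟩ := hC ρ hρ
  have hzero : ∀ x : Plane, 2 * ρ < ‖x‖ → (fun x => χ x • g x) =ᶠ[nhds x] fun _ => 0 := by
    intro x hx
    filter_upwards [(isOpen_lt continuous_const continuous_norm).mem_nhds hx] with y hy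
    rw [h3 y (le_of_lt hy), zero_smul]
  have hin : ∀ x : Plane, ‖x‖ ≤ 2 * ρ → x ∈ Metric.ball (0 : Plane) r := fun x hx =>
    mem_ball_zero_iff.2 (hx.trans_lt hr)
  have hga : ∀ x : Plane, ‖x‖ ≤ 2 * ρ → ContDiffAt ℝ ∞ g x := fun x hx =>
    hg.contDiffAt (Metric.isOpen_ball.mem_nhds (hin x hx))
  refine ⟨fun x => χ x • g x, contDiff_iff_contDiffAt.2 fun x => ?_, fun x => ?_, fun x hx => ?_,
    fun x hx => ?_⟩
  · by_cases hx : ‖x‖ ≤ 2 * ρ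
    · exact h1.contDiffAt.smul (hga x hx)
    · exact contDiffAt_const.congr_of_eventuallyEq (hzero x (not_le.1 hx))
  · by_cases hx : ‖x‖ ≤ 2 * ρ
    · have hgx : ‖g x‖ ≤ ε * ‖x‖ := by
        have h := (convex_ball (0 : Plane) r).norm_image_sub_le_of_norm_fderiv_le
          (f := g) (C := ε) (x := 0) (y := x)
          (fun y hy => (hg.contDiffAt (Metric.isOpen_ball.mem_nhds hy)).differentiableAt (by simp))
          hd (Metric.mem_ball_self (by linarith)) (hin x hx)
        simpa [hg0] using h
      rw [fderiv_fun_smul (h1.differentiable (by simp) x) ((hga x hx).differentiableAt (by simp))]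
      have e1 : ‖χ x • fderiv ℝ g x‖ ≤ ε := by
        rw [norm_smul, Real.norm_of_nonneg (h4 x).1]
        exact (mul_le_of_le_one_left (norm_nonneg _) (h4 x).2).trans (hd x (hin x hx))
      have e2 : ‖(fderiv ℝ χ x).smulRight (g x)‖ ≤ 2 * C * ε := by
        rw [ContinuousLinearMap.norm_smulRight_apply]
        have : ‖g x‖ ≤ ε * (2 * ρ) := hgx.trans (mul_le_mul_of_nonneg_left hx hε0.le)
        calc ‖fderiv ℝ χ x‖ * ‖g x‖ ≤ (C / ρ) * (ε * (2 * ρ)) := by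
              gcongr
              exact h5 x
          _ = 2 * C * ε := by field_simp
      refine (norm_add_le _ _).trans ((add_le_add e1 e2).trans ?_)
      have : ε + 2 * C * ε = ε * (1 + 2 * C) := by ring
      rw [this, hε]
      field_simp
      exact le_rfl
    · rw [(hzero x (not_le.1 hx)).fderiv_eq]
      simp
  · change χ x • g x = g x
    rw [h2 x hx, one_smul]
  · change χ x • g x = 0
    rw [h3 x hx.le, zero_smul]

section Germ

variable {M : Type} [TopologicalSpace M] [ChartedSpace Plane M]

/-- `A` is the germ at the centre of a disc of the end of an isotopy that fixes the centre. -/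
def SmoothDisc.IsGerm (E : SmoothDisc M) (A : Plane → Plane) : Prop :=
  ∃ φ : ℝ → Diffeo M, IsSmoothIsotopy φ ∧ (∀ t, φ t (E.toFun 0) = E.toFun 0) ∧
    ∀ᶠ x in nhds (0 : Plane), φ 1 (E.toFun x) = E.toFun (A x)

namespace SmoothDisc

variable (E : SmoothDisc M)

lemma IsGerm.comp {E : SmoothDisc M} {A B : Plane → Plane} (hB : E.IsGerm B) (hA : E.IsGerm A)
    (hc : ContinuousAt A 0) (h0 : A 0 = 0) : E.IsGerm (B ∘ A) := by
  obtain ⟨φ, hφ, hf, h⟩ := hA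
  obtain ⟨ψ, hψ, hg, h'⟩ := hB
  refine ⟨_, hφ.trans hψ, fun t => ?_, ?_⟩
  · change ψ t (φ t _) = _
    rw [hf, hg]
  · have hc' : Filter.Tendsto A (nhds 0) (nhds 0) := by simpa [ContinuousAt, h0] using hc
    filter_upwards [h, hc'.eventually h'] with x hx hx'
    change ψ 1 (φ 1 _) = _
    rw [hx, hx']
    rfl

/-- A perturbation of the identity with small derivative is a germ. -/
lemma exists_isGerm_of_near_id : ∃ ε : ℝ, 0 < ε ∧
    ∀ {M : Type} [TopologicalSpace M] [ChartedSpace Plane M] [T2Space M] (E : SmoothDisc M)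
      (g : Plane → Plane) (r ρ : ℝ), 0 < ρ → 2 * ρ < r →
    ContDiffOn ℝ ∞ g (Metric.ball 0 r) → g 0 = 0 →
    (∀ x ∈ Metric.ball (0 : Plane) r, ‖fderiv ℝ g x‖ ≤ ε) →
    ∃ φ : ℝ → Diffeo M, IsSmoothIsotopy φ ∧ (∀ t, φ t (E.toFun 0) = E.toFun 0) ∧
      ∀ x, ‖x‖ ≤ ρ → φ 1 (E.toFun x) = E.toFun (x + g x) := by
  obtain ⟨ε, hε, h⟩ := exists_cutoff
  refine ⟨ε, hε, fun E g r ρ hρ hr hg hg0 hd => ?_⟩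
  obtain ⟨k, h1, h2, h3, h4⟩ := h g r ρ hρ hr hg hg0 hd
  obtain ⟨φ, hφ, ha, -⟩ := E.exists_isotopy_of_perturbation k h1 h2 _ h4
  refine ⟨φ, hφ, fun t => ?_, fun x hx => ?_⟩
  · rw [ha, h3 0 (by simpa using hρ.le), hg0, smul_zero, add_zero]
  · rw [ha, h3 x hx, Real.smoothTransition.one, one_smul]

/-- Linear maps of positive determinant are germs. -/
theorem isGerm_linear [T2Space M] (A : Plane →ₗ[ℝ] Plane) (hA : 0 < LinearMap.det A) : E.IsGerm A := by
  let b := (EuclideanSpace.basisFun (Fin 2) ℝ).toBasis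
  -- Germs are closed under composition, so it is enough to realize the matrices near the identity.
  let S : Submonoid (Matrix (Fin 2) (Fin 2) ℝ) :=
    { carrier := {B | E.IsGerm (Matrix.toLin b b B)}
      one_mem' := by
        refine ⟨_, IsSmoothIsotopy.refl, fun _ => rfl, Filter.Eventually.of_forall fun x => ?_⟩
        rw [Matrix.toLin_one]
        rfl
      mul_mem' := by
        intro B C hB hC
        change E.IsGerm (Matrix.toLin b b (B * C))
        rw [Matrix.toLin_mul b b b, LinearMap.coe_comp]
        exact hB.comp hC (LinearMap.continuous_of_finiteDimensional _).continuousAt (map_zero _) }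
  obtain ⟨ε, hε, hn⟩ := exists_isGerm_of_near_id
  let L : (Fin 2 → Fin 2 → ℝ) →ₗ[ℝ] (Plane →L[ℝ] Plane) :=
    (LinearMap.toContinuousLinearMap (𝕜 := ℝ) (E := Plane) (F' := Plane)).toLinearMap ∘ₗ
      (Matrix.toLin b b).toLinearMap
  have hL : Continuous L := LinearMap.continuous_of_finiteDimensional L
  obtain ⟨η, hη, hball⟩ := Metric.continuousAt_iff.1 (hL.continuousAt
    (x := fun i j => (1 : Matrix (Fin 2) (Fin 2) ℝ) i j)) ε hε
  have key := Matrix.mem_of_det_pos S hη (fun B hB => ?_) (LinearMap.toMatrix b b A)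
    (by rwa [LinearMap.det_toMatrix])
  · change E.IsGerm (Matrix.toLin b b _) at key
    rwa [Matrix.toLin_toMatrix] at key
  · have h1 : dist (α := Fin 2 → Fin 2 → ℝ) B (fun i j => (1 : Matrix (Fin 2) (Fin 2) ℝ) i j) < η :=
      (dist_pi_lt_iff hη).2 fun i => (dist_pi_lt_iff hη).2 fun j => hB i j
    have h2 := hball h1
    have h3 : L (fun i j => (1 : Matrix (Fin 2) (Fin 2) ℝ) i j) = ContinuousLinearMap.id ℝ Plane := by
      ext1 x
      change Matrix.toLin b b 1 x = x
      rw [Matrix.toLin_one]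
      rfl
    rw [h3, dist_eq_norm] at h2
    let G : Plane →L[ℝ] Plane := L B - ContinuousLinearMap.id ℝ Plane
    -- The linear perturbation is small everywhere, so any radii with `2ρ < r` would do.
    obtain ⟨φ, hφ, hf, h⟩ := hn E G 3 1 one_pos (by norm_num) G.contDiff.contDiffOn (map_zero _)
      (fun x _ => by rw [ContinuousLinearMap.fderiv]; exact h2.le)
    refine ⟨φ, hφ, hf, ?_⟩
    filter_upwards [Metric.closedBall_mem_nhds (0 : Plane) one_pos] with x hx
    rw [h x (by simpa using hx)]
    congr 1
    change x + (Matrix.toLin b b B x - x) = _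
    abel

/-- The germ at a fixed point of a diffeomorphism, in the coordinates of a disc. -/
lemma exists_germ (d : Diffeo M) (hd : d (E.toFun 0) = E.toFun 0) :
    ∃ r : ℝ, 0 < r ∧ ContDiffOn ℝ ∞ (fun x => E.inv (d (E.toFun x))) (Metric.ball 0 r) ∧
      ∀ x ∈ Metric.ball (0 : Plane) r, E.toFun (E.inv (d (E.toFun x))) = d (E.toFun x) := by
  have ho : IsOpen ((fun x => d (E.toFun x)) ⁻¹' Set.range E.toFun) :=
    E.isOpenEmbedding.isOpen_range.preimage (d.continuous.comp E.continuous)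
  obtain ⟨r, hr, hb⟩ := Metric.isOpen_iff.1 ho 0 ⟨0, hd.symm⟩
  refine ⟨r, hr, fun x hx => ?_, fun x hx => E.apply_inv (hb hx)⟩
  have h := (E.contMDiffAt_inv (hb hx)).comp x
    ((d.contMDiff.comp E.contMDiff).contMDiffAt)
  exact (contMDiffAt_iff_contDiffAt.1 h).contDiffWithinAt

/-- An isotopy that returns the centre of a disc with orientation-preserving germ can be corrected
to be the identity near the centre. -/
theorem exists_correction [T2Space M] (d : Diffeo M) (hd : d (E.toFun 0) = E.toFun 0)
    (hdet : 0 < (fderiv ℝ (fun x => E.inv (d (E.toFun x))) 0).det) :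
    ∃ ψ : ℝ → Diffeo M, IsSmoothIsotopy ψ ∧ (∀ t, ψ t (E.toFun 0) = E.toFun 0) ∧
      ∀ᶠ x in nhds (0 : Plane), ψ 1 (d (E.toFun x)) = E.toFun x := by
  obtain ⟨r, hr, hs, he⟩ := E.exists_germ d hd
  set f : Plane → Plane := fun x => E.inv (d (E.toFun x)) with hf
  have hf0 : f 0 = 0 := by simp [hf, hd]
  set A := fderiv ℝ f 0 with hA
  have hne : A.det ≠ 0 := hdet.ne'
  let Ae : Plane ≃L[ℝ] Plane := A.toContinuousLinearEquivOfDetNeZero hne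
  have hAe : (Ae : Plane →L[ℝ] Plane) = A := A.coe_toContinuousLinearEquivOfDetNeZero hne
  let B : Plane →L[ℝ] Plane := Ae.symm
  have hBA : B.comp A = ContinuousLinearMap.id ℝ Plane := by
    rw [← hAe]
    ext1 x
    exact Ae.symm_apply_apply x
  have hBdet : 0 < LinearMap.det (B : Plane →ₗ[ℝ] Plane) := by
    have h1 : LinearMap.det ((B : Plane →ₗ[ℝ] Plane) ∘ₗ (A : Plane →ₗ[ℝ] Plane)) = 1 := by
      have e : (B : Plane →ₗ[ℝ] Plane) ∘ₗ (A : Plane →ₗ[ℝ] Plane) = LinearMap.id :=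
        congrArg (fun T : Plane →L[ℝ] Plane => (T : Plane →ₗ[ℝ] Plane)) hBA
      rw [e, LinearMap.det_id]
    rw [LinearMap.det_comp] at h1
    have h2 : 0 < LinearMap.det (A : Plane →ₗ[ℝ] Plane) := hdet
    exact pos_of_mul_pos_left (h1 ▸ one_pos) h2.le
  obtain ⟨β, hβ, hβ0, hβ1⟩ := E.isGerm_linear (B : Plane →ₗ[ℝ] Plane) hBdet
  obtain ⟨ε, hε, hn⟩ := exists_isGerm_of_near_id
  -- After composition with the inverse `B` of the derivative, the germ is tangent to the identity,
  -- so on a small enough ball `g` is a small perturbation.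
  let g : Plane → Plane := fun x => B (f x) - x
  have hg : ContDiffOn ℝ ∞ g (Metric.ball 0 r) :=
    (B.contDiff.comp_contDiffOn hs).sub contDiffOn_id
  have hgd : fderiv ℝ g 0 = 0 := by
    have h1 : HasFDerivAt f A 0 :=
      ((hs.contDiffAt (Metric.isOpen_ball.mem_nhds (Metric.mem_ball_self hr))).differentiableAt
        (by simp)).hasFDerivAt
    have h2 := (B.hasFDerivAt.comp (0 : Plane) h1).sub (hasFDerivAt_id (0 : Plane))
    rw [hBA, sub_self] at h2
    exact h2.fderiv
  have hgc : ContinuousAt (fderiv ℝ g) 0 :=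
    ((hg.continuousOn_fderiv_of_isOpen Metric.isOpen_ball (by simp)).continuousAt
      (Metric.isOpen_ball.mem_nhds (Metric.mem_ball_self hr)))
  obtain ⟨r', hr', hb⟩ := Metric.continuousAt_iff.1 hgc ε hε
  set s := min r r' with hs'
  have hs0 : 0 < s := lt_min hr hr'
  obtain ⟨φ, hφ, hφ0, hφ1⟩ := hn E g s (s / 4) (by positivity) (by linarith)
    (hg.mono (Metric.ball_subset_ball (min_le_left _ _))) (by simp [g, hf0])
    (fun x hx => by
      have h := hb (Metric.ball_subset_ball (min_le_right r r') hx)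
      rw [hgd, dist_zero_right] at h
      exact h.le)
  -- Near the centre `β₁` acts as `B` and `φ₁` acts as `B ∘ f`, so `φ₁⁻¹ ∘ β₁ ∘ d` is the identity
  -- there.
  refine ⟨_, hβ.trans hφ.reverse, fun t => ?_, ?_⟩
  · change φ (1 - t) ((φ 1).symm (β t (E.toFun 0))) = _
    rw [hβ0]
    conv_lhs => rw [← hφ0 1]
    rw [Diffeomorph.symm_apply_apply, hφ0]
  · have hfc : Filter.Tendsto f (nhds 0) (nhds 0) := by
      have := (hs.continuousOn.continuousAt (Metric.isOpen_ball.mem_nhds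
        (Metric.mem_ball_self hr)))
      rwa [ContinuousAt, hf0] at this
    filter_upwards [Metric.ball_mem_nhds (0 : Plane) hr, hfc.eventually hβ1,
      Metric.closedBall_mem_nhds (0 : Plane) (by positivity : 0 < s / 4)] with x hx h1 h2
    change φ (1 - 1) ((φ 1).symm (β 1 (d (E.toFun x)))) = _
    rw [sub_self, hφ.2, ← he x hx, h1]
    have h3 := hφ1 x (by simpa using h2)
    have h4 : x + g x = B (f x) := by simp [g]
    rw [h4] at h3
    exact (φ 1).toEquiv.symm_apply_eq.2 h3.symm

end SmoothDisc

end Germ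

/-! ## Existence of isotopies that push a disc along a given loop -/

section Existence

variable {M : Type} [TopologicalSpace M] [ChartedSpace Plane M] [IsManifold (𝓡 2) ∞ M]

/-- The Jacobian at the centre of a disc of a diffeomorphism, in the coordinates of the disc and in
the chart at `p`. -/
def chartJacobian (E : SmoothDisc M) (d : Diffeo M) (p : M) : ℝ :=
  (fderiv ℝ (fun z => chartAt Plane p (d (E.toFun z))) 0).det

lemma contMDiffAt_chart {p y : M} (hy : y ∈ (chartAt Plane p).source) :
    ContMDiffAt (𝓡 2) (𝓡 2) ∞ (chartAt Plane p) y :=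
  contMDiffOn_chart.contMDiffAt ((chartAt Plane p).open_source.mem_nhds hy)

lemma contMDiffAt_chart_symm {p : M} {y : Plane} (hy : y ∈ (chartAt Plane p).target) :
    ContMDiffAt (𝓡 2) (𝓡 2) ∞ (chartAt Plane p).symm y :=
  contMDiffOn_chart_symm.contMDiffAt ((chartAt Plane p).open_target.mem_nhds hy)

lemma contDiffAt_chart_comp (E : SmoothDisc M) (d : Diffeo M) {p : M}
    (hp : d (E.toFun 0) ∈ (chartAt Plane p).source) :
    ContDiffAt ℝ ∞ (fun z => chartAt Plane p (d (E.toFun z))) 0 :=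
  contMDiffAt_iff_contDiffAt.1 ((contMDiffAt_chart hp).comp (0 : Plane)
    (d.contMDiff.comp E.contMDiff).contMDiffAt)

lemma eventually_mem_chart (E : SmoothDisc M) (d : Diffeo M) {p : M}
    (hp : d (E.toFun 0) ∈ (chartAt Plane p).source) :
    ∀ᶠ z in nhds (0 : Plane), d (E.toFun z) ∈ (chartAt Plane p).source :=
  (d.continuous.comp E.continuous).continuousAt.eventually
    ((chartAt Plane p).open_source.mem_nhds hp)

lemma ContinuousLinearMap.det_comp' (A B : Plane →L[ℝ] Plane) :
    (A.comp B).det = A.det * B.det :=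
  LinearMap.det_comp (A : Plane →ₗ[ℝ] Plane) (B : Plane →ₗ[ℝ] Plane)

/-- The coordinate expression has a differentiable left inverse, namely the inverse chart followed
by `d⁻¹` and the inverse of the disc; the chain rule gives the claim. -/
lemma chartJacobian_ne_zero (E : SmoothDisc M) (d : Diffeo M) {p : M}
    (hp : d (E.toFun 0) ∈ (chartAt Plane p).source) : chartJacobian E d p ≠ 0 := by
  set c := chartAt Plane p
  have h1 := (contDiffAt_chart_comp E d hp).differentiableAt (by simp)
  have h2 : ContDiffAt ℝ ∞ (fun w => E.inv (d.symm (c.symm w))) (c (d (E.toFun 0))) := by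
    refine contMDiffAt_iff_contDiffAt.1 ?_
    have e : c.symm (c (d (E.toFun 0))) = d (E.toFun 0) := c.left_inv hp
    have i1 : ContMDiffAt (𝓡 2) (𝓡 2) ∞ E.inv (d.symm (c.symm (c (d (E.toFun 0))))) := by
      rw [e, Diffeomorph.symm_apply_apply]
      exact E.contMDiffAt_inv ⟨0, rfl⟩
    have i2 : ContMDiffAt (𝓡 2) (𝓡 2) ∞ (fun w => d.symm (c.symm w)) (c (d (E.toFun 0))) :=
      (d.symm.contMDiff.contMDiffAt (x := c.symm (c (d (E.toFun 0))))).comp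
        (c (d (E.toFun 0))) (contMDiffAt_chart_symm (c.map_source hp))
    exact ContMDiffAt.comp (c (d (E.toFun 0))) i1 i2
  have h3 := (h2.differentiableAt (by simp)).hasFDerivAt.comp (0 : Plane) h1.hasFDerivAt
  have h4 : (fun w => E.inv (d.symm (c.symm w))) ∘ (fun z => c (d (E.toFun z))) =ᶠ[nhds 0] id := by
    filter_upwards [eventually_mem_chart E d hp] with z hz
    change E.inv (d.symm (c.symm (c (d (E.toFun z))))) = z
    rw [c.left_inv hz, Diffeomorph.symm_apply_apply, E.inv_apply]
  have h5 := (hasFDerivAt_id (0 : Plane)).unique (h3.congr_of_eventuallyEq h4.symm)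
  intro h0
  have h6 := congrArg ContinuousLinearMap.det h5
  rw [ContinuousLinearMap.det_comp'] at h6
  have h7 : (fderiv ℝ (fun z => c (d (E.toFun z))) 0).det = 0 := h0
  rw [h7, mul_zero] at h6
  have h8 : (ContinuousLinearMap.id ℝ Plane).det = 1 := LinearMap.det_id
  rw [h8] at h6
  exact one_ne_zero h6

/-- A change of chart multiplies the Jacobian by the determinant of a coordinate change, which the
oriented atlas makes positive. -/
lemma chartJacobian_change (hor : OrientedAtlas M) (E : SmoothDisc M) (d : Diffeo M) {p q : M}
    (hp : d (E.toFun 0) ∈ (chartAt Plane p).source)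
    (hq : d (E.toFun 0) ∈ (chartAt Plane q).source) :
    0 < chartJacobian E d p ↔ 0 < chartJacobian E d q := by
  set c := chartAt Plane p
  set c' := chartAt Plane q
  have hx : c (d (E.toFun 0)) ∈ (c.symm.trans c').source := by
    refine ⟨c.map_source hp, ?_⟩
    change c.symm (c (d (E.toFun 0))) ∈ c'.source
    rwa [c.left_inv hp]
  have hpos := hor c (chart_mem_atlas _ _) c' (chart_mem_atlas _ _) _ hx
  have h1 := (contDiffAt_chart_comp E d hp).differentiableAt (by simp)
  have h2 : ContDiffAt ℝ ∞ (c.symm.trans c') (c (d (E.toFun 0))) := by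
    refine contMDiffAt_iff_contDiffAt.1 ?_
    have i1 : ContMDiffAt (𝓡 2) (𝓡 2) ∞ c' (c.symm (c (d (E.toFun 0)))) := contMDiffAt_chart hx.2
    exact i1.comp _ (contMDiffAt_chart_symm (c.map_source hp))
  have h3 := (h2.differentiableAt (by simp)).hasFDerivAt.comp (0 : Plane) h1.hasFDerivAt
  have h4 : (fun z => c' (d (E.toFun z))) =ᶠ[nhds 0]
      (c.symm.trans c') ∘ (fun z => c (d (E.toFun z))) := by
    filter_upwards [eventually_mem_chart E d hp] with z hz
    change c' (d (E.toFun z)) = c' (c.symm (c (d (E.toFun z))))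
    rw [c.left_inv hz]
  have h5 : chartJacobian E d q =
      (fderiv ℝ (c.symm.trans c') (c (d (E.toFun 0)))).det * chartJacobian E d p := by
    rw [chartJacobian, (h3.congr_of_eventuallyEq h4).fderiv, ContinuousLinearMap.det_comp']
    rfl
  rw [h5]
  exact (mul_pos_iff_of_pos_left hpos).symm

/-- The Jacobian is the determinant of a partial derivative of a map that is smooth jointly in time
and position, and such a derivative is continuous in time. -/
lemma continuousAt_chartJacobian (E : SmoothDisc M) {φ : ℝ → Diffeo M} (hφ : IsSmoothIsotopy φ)
    {p : M} {t : ℝ} (hp : φ t (E.toFun 0) ∈ (chartAt Plane p).source) :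
    ContinuousAt (fun s => chartJacobian E (φ s) p) t := by
  set c := chartAt Plane p
  let F : ℝ × Plane → Plane := fun q => c (φ q.1 (E.toFun q.2))
  have hF : ContDiffAt ℝ ∞ F (t, 0) := by
    have h1 : ContMDiffAt 𝓘(ℝ, ℝ × Plane) (𝓘(ℝ, ℝ).prod (𝓡 2)) ∞
        (fun q : ℝ × Plane => (q.1, E.toFun q.2)) (t, 0) :=
      (contDiff_fst.contMDiff.contMDiffAt).prodMk
        (E.contMDiff.contMDiffAt.comp _ contDiff_snd.contMDiff.contMDiffAt)
    have h2 : ContMDiffAt 𝓘(ℝ, ℝ × Plane) (𝓡 2) ∞ F (t, 0) :=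
      (contMDiffAt_chart hp).comp (t, (0 : Plane))
        ((hφ.1 (t, E.toFun 0)).comp (t, (0 : Plane)) h1)
    exact contMDiffAt_iff_contDiffAt.1 h2
  have hev : ∀ᶠ q in nhds (t, (0 : Plane)), ContDiffAt ℝ 1 F q :=
    (hF.of_le (by simp : (1 : ℕ∞ω) ≤ ∞)).eventually (by simp)
  have hcont : ContinuousAt (fderiv ℝ F) (t, 0) :=
    (hF.fderiv_right (m := 0) (by simp)).continuousAt
  have hι : ContinuousAt (fun s : ℝ => (s, (0 : Plane))) t := by fun_prop
  have hdet : Continuous (fun A : ℝ × Plane →L[ℝ] Plane =>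
      (A.comp (ContinuousLinearMap.inr ℝ ℝ Plane)).det) :=
    ContinuousLinearMap.continuous_det.comp (by fun_prop)
  have h3 : ContinuousAt (fun s : ℝ =>
      ((fderiv ℝ F (s, 0)).comp (ContinuousLinearMap.inr ℝ ℝ Plane)).det) t :=
    hdet.continuousAt.comp (ContinuousAt.comp (f := fun s : ℝ => (s, (0 : Plane))) hcont hι)
  refine h3.congr ?_
  filter_upwards [hι.eventually hev] with s hs
  have h4 : HasFDerivAt (fun z : Plane => (s, z)) (ContinuousLinearMap.inr ℝ ℝ Plane) 0 :=
    hasFDerivAt_prodMk_right s 0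
  have h5 := (hs.differentiableAt (by simp)).hasFDerivAt.comp (0 : Plane) h4
  exact congrArg ContinuousLinearMap.det h5.fderiv.symm

/-- An isotopy that returns the centre of a disc preserves the orientation there. -/
theorem det_germ_pos (hor : OrientedAtlas M) (E : SmoothDisc M) {φ : ℝ → Diffeo M}
    (hφ : IsSmoothIsotopy φ) (h1 : φ 1 (E.toFun 0) = E.toFun 0) :
    0 < (fderiv ℝ (fun x => E.inv (φ 1 (E.toFun x))) 0).det := by
  -- The sign of the Jacobian, each time in a chart at the current position of the centre, is
  -- locally constant in time, hence the same at the times 0 and 1.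
  let P : Set ℝ := {t | 0 < chartJacobian E (φ t) (φ t (E.toFun 0))}
  have hmem : ∀ t, φ t (E.toFun 0) ∈ (chartAt Plane (φ t (E.toFun 0))).source := fun t =>
    mem_chart_source _ _
  have hloc : ∀ t, ∀ᶠ s in nhds t, (s ∈ P ↔ t ∈ P) := by
    intro t
    have hx : Continuous fun s => φ s (E.toFun 0) :=
      hφ.continuous.comp (by fun_prop : Continuous fun s : ℝ => (s, E.toFun 0))
    have e1 : ∀ᶠ s in nhds t, φ s (E.toFun 0) ∈ (chartAt Plane (φ t (E.toFun 0))).source :=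
      hx.continuousAt.eventually ((chartAt Plane _).open_source.mem_nhds (hmem t))
    have hc := continuousAt_chartJacobian E hφ (hmem t)
    have e2 : ∀ᶠ s in nhds t, (0 < chartJacobian E (φ s) (φ t (E.toFun 0)) ↔ t ∈ P) := by
      rcases lt_or_gt_of_ne (chartJacobian_ne_zero E (φ t) (hmem t)) with h | h
      · filter_upwards [hc.eventually (gt_mem_nhds h)] with s hs
        exact ⟨fun h' => absurd h' hs.not_gt, fun h' => absurd h' h.not_gt⟩
      · filter_upwards [hc.eventually (lt_mem_nhds h)] with s hs
        exact ⟨fun _ => h, fun _ => hs⟩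
    filter_upwards [e1, e2] with s h1 h2
    rw [← h2]
    exact chartJacobian_change hor E (φ s) (hmem s) h1
  have hclopen : IsClopen P := by
    refine ⟨⟨isOpen_iff_mem_nhds.2 fun t ht => ?_⟩, isOpen_iff_mem_nhds.2 fun t ht => ?_⟩
    · filter_upwards [hloc t] with s hs h
      exact ht (hs.1 h)
    · filter_upwards [hloc t] with s hs
      exact hs.2 ht
  have h01 : (0 : ℝ) ∈ P ↔ (1 : ℝ) ∈ P := by
    rcases isClopen_iff.1 hclopen with h | h <;> simp [h]
  have e0 : φ 0 (E.toFun 0) = E.toFun 0 := hφ.2 _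
  change 0 < chartJacobian E (φ 0) (φ 0 (E.toFun 0)) ↔
    0 < chartJacobian E (φ 1) (φ 1 (E.toFun 0)) at h01
  rw [e0, h1] at h01
  set c := chartAt Plane (E.toFun 0)
  obtain ⟨r, hr, hs, he⟩ := E.exists_germ (φ 1) h1
  set f : Plane → Plane := fun x => E.inv (φ 1 (E.toFun x)) with hf
  have hf0 : f 0 = 0 := by simp [hf, h1]
  have h2 : DifferentiableAt ℝ (fun z => c (φ 0 (E.toFun z))) (f 0) := by
    rw [hf0]
    exact (contDiffAt_chart_comp E (φ 0) (by rw [e0]; exact mem_chart_source _ _)).differentiableAt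
      (by simp)
  have h3 : DifferentiableAt ℝ f 0 :=
    (hs.contDiffAt (Metric.isOpen_ball.mem_nhds (Metric.mem_ball_self hr))).differentiableAt
      (by simp)
  have h4 := h2.hasFDerivAt.comp (0 : Plane) h3.hasFDerivAt
  have h5 : (fun z => c (φ 1 (E.toFun z))) =ᶠ[nhds 0] (fun z => c (φ 0 (E.toFun z))) ∘ f := by
    filter_upwards [Metric.ball_mem_nhds (0 : Plane) hr] with z hz
    change c (φ 1 (E.toFun z)) = c (φ 0 (E.toFun (f z)))
    rw [hφ.2, he z hz]
  -- In the chart at the centre, `φ₁` is `φ₀` composed with the germ, so the determinant of the germ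
  -- is the quotient of two numbers of the same sign.
  have h6 : chartJacobian E (φ 1) (E.toFun 0) =
      chartJacobian E (φ 0) (E.toFun 0) * (fderiv ℝ f 0).det := by
    rw [chartJacobian, (h4.congr_of_eventuallyEq h5).fderiv, ContinuousLinearMap.det_comp', hf0]
    rfl
  have hne := chartJacobian_ne_zero E (φ 1) (p := E.toFun 0) (by rw [h1]; exact mem_chart_source _ _)
  have hne0 := chartJacobian_ne_zero E (φ 0) (p := E.toFun 0) (by rw [e0]; exact mem_chart_source _ _)
  rcases lt_or_gt_of_ne hne0 with h | h
  · have h7 : chartJacobian E (φ 1) (E.toFun 0) < 0 :=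
      lt_of_le_of_ne (not_lt.1 fun h' => h.not_gt (h01.2 h')) hne
    rw [h6] at h7
    exact pos_of_mul_neg_right h7 h.le
  · have h7 := h01.1 h
    rw [h6] at h7
    exact pos_of_mul_pos_right h7 h.le

/-- There are isotopies that contract a disc towards its centre. -/
lemma SmoothDisc.exists_contraction [T2Space M] (E : SmoothDisc M) {r : ℝ} (hr : 0 < r) :
    ∃ φ : ℝ → Diffeo M, IsSmoothIsotopy φ ∧ (∀ t, φ t (E.toFun 0) = E.toFun 0) ∧
      ∀ x : Plane, ‖x‖ ≤ 2 → ∃ y : Plane, ‖y‖ < r ∧ φ 1 (E.toFun x) = E.toFun y := by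
  obtain ⟨ε, hε, hn⟩ := SmoothDisc.exists_isGerm_of_near_id
  -- Multiplication by `a` is a perturbation of the identity of size `1 - a ≤ ε`, and its powers
  -- contract the disc as far as needed.
  set a := max (1 - ε) (1 / 2) with ha
  have ha0 : 0 < a := lt_max_of_lt_right (by norm_num)
  have ha1 : a < 1 := max_lt (by linarith) (by norm_num)
  have haε : 1 - a ≤ ε := by linarith [le_max_left (1 - ε) (1 / 2 : ℝ)]
  let g : Plane →L[ℝ] Plane := (a - 1) • ContinuousLinearMap.id ℝ Plane
  obtain ⟨φ, hφ, hφ0, hφ1⟩ := hn E g 5 2 two_pos (by norm_num) g.contDiff.contDiffOn (map_zero _)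
    (fun x _ => by
      rw [ContinuousLinearMap.fderiv, norm_smul, ContinuousLinearMap.norm_id, mul_one,
        Real.norm_eq_abs, abs_of_neg (by linarith)]
      linarith)
  have key : ∀ n : ℕ, ∃ ψ : ℝ → Diffeo M, IsSmoothIsotopy ψ ∧
      (∀ t, ψ t (E.toFun 0) = E.toFun 0) ∧
      ∀ x : Plane, ‖x‖ ≤ 2 → ψ 1 (E.toFun x) = E.toFun (a ^ n • x) := by
    intro n
    induction n with
    | zero => exact ⟨_, IsSmoothIsotopy.refl, fun _ => rfl, fun x _ => by simp⟩
    | succ n ih =>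
      obtain ⟨ψ, hψ, hψ0, hψ1⟩ := ih
      refine ⟨_, hψ.trans hφ, fun t => ?_, fun x hx => ?_⟩
      · change φ t (ψ t _) = _
        rw [hψ0, hφ0]
      · change φ 1 (ψ 1 _) = _
        rw [hψ1 x hx, hφ1]
        · congr 1
          simp only [g, _root_.smul_apply, ContinuousLinearMap.id_apply]
          module
        · rw [norm_smul, Real.norm_of_nonneg (by positivity)]
          exact (mul_le_of_le_one_left (norm_nonneg _) (pow_le_one₀ ha0.le ha1.le)).trans hx
  obtain ⟨n, hn'⟩ := exists_pow_lt_of_lt_one (by positivity : 0 < r / 2) ha1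
  obtain ⟨ψ, hψ, hψ0, hψ1⟩ := key n
  refine ⟨ψ, hψ, hψ0, fun x hx => ⟨_, ?_, hψ1 x hx⟩⟩
  rw [norm_smul, Real.norm_of_nonneg (by positivity)]
  have : 0 ≤ a ^ n := by positivity
  nlinarith

/-- Every loop at the centre of a disc is homotopic to the trace of the centre under an isotopy that
ends with the identity on a neighbourhood of the disc. -/
theorem exists_isotopy_of_loop [T2Space M] (hor : OrientedAtlas M) (E : SmoothDisc M)
    (p : Path (E.toFun 0) (E.toFun 0)) :
    ∃ (φ : ℝ → Diffeo M) (hφ : IsSmoothIsotopy φ) (h1 : φ 1 (E.toFun 0) = E.toFun 0),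
      (hφ.trace h1).Homotopic p ∧ ∀ x, ‖x‖ ≤ 2 → φ 1 (E.toFun x) = E.toFun x := by
  obtain ⟨φ, hφ, h1, hp⟩ := exists_isotopy_trace_homotopic p
  obtain ⟨ψ, hψ, hψ0, hψ1⟩ := E.exists_correction (φ 1) h1 (det_germ_pos hor E hφ h1)
  obtain ⟨r, hr, hb⟩ := Metric.eventually_nhds_iff_ball.1 hψ1
  obtain ⟨s, hs, hs0, hs1⟩ := E.exists_contraction hr
  -- The contraction `s₁` takes the ball of radius 2 into the ball on which `ψ₁ ∘ φ₁` is the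
  -- identity, so the conjugate by `s₁` is the identity on the whole ball of radius 2.
  have ht := (hφ.trans hψ).conj (s 1)
  have hg0 : (s 1).symm (E.toFun 0) = E.toFun 0 := (s 1).toEquiv.symm_apply_eq.2 (hs0 1).symm
  have hend : ((s 1).trans ((φ 1).trans (ψ 1))).trans (s 1).symm (E.toFun 0) = E.toFun 0 := by
    change (s 1).symm (ψ 1 (φ 1 (s 1 (E.toFun 0)))) = _
    rw [hs0, h1, hψ0, hg0]
  refine ⟨_, ht, hend, ?_, fun x hx => ?_⟩
  · have e1 := hφ.trace_trans hψ h1 (hψ0 1)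
    have e2 : hψ.trace (hψ0 1) = Path.refl (E.toFun 0) := by
      ext t
      exact hψ0 t
    rw [e2] at e1
    have e3 := (e1.trans (Path.Homotopic.trans_refl _)).trans hp
    have hr0 : ∀ t, (s 1).symm.trans (s (1 - t)) (E.toFun 0) = E.toFun 0 := fun t => by
      change s (1 - t) ((s 1).symm (E.toFun 0)) = _
      rw [hg0, hs0]
    -- The new trace is the image of the old one under `s₁⁻¹`, the end of an isotopy that fixes the
    -- centre; such an image is homotopic to the original.
    refine Path.Homotopic.trans ?_
      ((hs.reverse.map_homotopic ((hφ.trans hψ).trace _) hr0 hr0).trans e3)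
    convert Path.Homotopic.refl _ using 1
    ext t
    change s (1 - 1) ((s 1).symm (ψ t (φ t (E.toFun 0)))) =
      (s 1).symm (ψ t (φ t (s 1 (E.toFun 0))))
    rw [hs0, sub_self, hs.2]
  · change (s 1).symm (ψ 1 (φ 1 (s 1 (E.toFun x)))) = _
    obtain ⟨y, hy, e⟩ := hs1 x hx
    rw [e, hb y (by simpa using hy), ← e, Diffeomorph.symm_apply_apply]

end Existence

/-! ## Tame families of diffeomorphisms -/

section Tame

variable {M : Type} [TopologicalSpace M] [ChartedSpace Plane M]

/-- A family of diffeomorphisms that is obtained from a smooth family by a continuous change of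
parameters. -/
def IsTame (G : ℝ → Diffeo M) : Prop :=
  ∃ (V : Type) (_ : NormedAddCommGroup V) (_ : NormedSpace ℝ V) (Ψ : V × M → M) (p : ℝ → V),
    ContMDiff (𝓘(ℝ, V).prod (𝓡 2)) (𝓡 2) ∞ Ψ ∧ Continuous p ∧ ∀ t x, G t x = Ψ (p t, x)

lemma IsSmoothIsotopy.isTame {φ : ℝ → Diffeo M} (hφ : IsSmoothIsotopy φ) : IsTame φ :=
  ⟨ℝ, _, _, _, id, hφ.1, continuous_id, fun _ _ => rfl⟩

lemma IsTame.trans {G H : ℝ → Diffeo M} (hG : IsTame G) (hH : IsTame H) :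
    IsTame (fun t => (G t).trans (H t)) := by
  obtain ⟨V, _, _, Ψ, p, h1, h2, h3⟩ := hG
  obtain ⟨W, _, _, Φ, q, k1, k2, k3⟩ := hH
  refine ⟨V × W, inferInstance, inferInstance, fun z => Φ (z.1.2, Ψ (z.1.1, z.2)),
    fun t => (p t, q t), ?_, h2.prodMk k2, fun t x => ?_⟩
  · have e1 : ContMDiff 𝓘(ℝ, V × W) 𝓘(ℝ, V) ∞ (Prod.fst : V × W → V) := contDiff_fst.contMDiff
    have e2 : ContMDiff 𝓘(ℝ, V × W) 𝓘(ℝ, W) ∞ (Prod.snd : V × W → W) := contDiff_snd.contMDiff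
    exact k1.comp ((e2.comp contMDiff_fst).prodMk
      (h1.comp ((e1.comp contMDiff_fst).prodMk contMDiff_snd)))
  · change H t (G t x) = _
    rw [h3, k3]

/-- The curve `a` is carried to the curve `b` by a tame family that is the identity at the times
`0` and `1`. -/
def TamelyMoved (a b : ℝ → M) : Prop :=
  ∃ G : ℝ → Diffeo M, IsTame G ∧ (∀ t, G t (a t) = b t) ∧ (∀ x, G 0 x = x) ∧ ∀ x, G 1 x = x

lemma TamelyMoved.refl (a : ℝ → M) : TamelyMoved a a :=
  ⟨_, IsSmoothIsotopy.refl.isTame, fun _ => rfl, fun _ => rfl, fun _ => rfl⟩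

lemma TamelyMoved.trans {a b c : ℝ → M} (h : TamelyMoved a b) (h' : TamelyMoved b c) :
    TamelyMoved a c := by
  obtain ⟨G, g1, g2, g3, g4⟩ := h
  obtain ⟨H, h1, h2, h3, h4⟩ := h'
  refine ⟨_, g1.trans h1, fun t => ?_, fun x => ?_, fun x => ?_⟩
  · change H t (G t (a t)) = _
    rw [g2, h2]
  · change H 0 (G 0 x) = x
    rw [g3, h3]
  · change H 1 (G 1 x) = x
    rw [g4, h4]

/-- Two curves that differ only for a time in which both run in a disc. -/
lemma SmoothDisc.tamelyMoved [T2Space M] (E : SmoothDisc M) {a b : ℝ → M} (ha : Continuous a)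
    (hb : Continuous b) {c d : ℝ} (hcd : c ≤ d) (hab : ∀ t, t ∉ Set.Ioo c d → a t = b t)
    (ha' : ∀ t ∈ Set.Icc c d, a t ∈ E.toFun '' Metric.ball 0 1)
    (hb' : ∀ t ∈ Set.Icc c d, b t ∈ E.toFun '' Metric.ball 0 1)
    (h0 : a 0 = b 0) (h1 : a 1 = b 1) : TamelyMoved a b := by
  obtain ⟨χ, R, x1, x2, x3, x4⟩ := exists_wide_plateau
  -- Clamping time to `[c, d]` makes the displacement `v` defined and continuous at all times.
  -- Outside the open interval the clamped time is an endpoint, where the two curves agree, so `v`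
  -- vanishes.
  let ret : ℝ → ℝ := fun t => max c (min t d)
  have hr : ∀ t, ret t ∈ Set.Icc c d := fun t =>
    ⟨le_max_left _ _, max_le hcd (min_le_right _ _)⟩
  have hrc : Continuous ret := by fun_prop
  let v : ℝ → Plane := fun t => E.inv (b (ret t)) - E.inv (a (ret t))
  have hball : ∀ y ∈ E.toFun '' Metric.ball 0 1, ‖E.inv y‖ ≤ 1 := by
    rintro y ⟨x, hx, rfl⟩
    rw [E.inv_apply]
    exact (mem_ball_zero_iff.1 hx).le
  have hv : ∀ t, ‖v t‖ ≤ 2 := fun t => (norm_sub_le _ _).trans (by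
    linarith [hball _ (ha' _ (hr t)), hball _ (hb' _ (hr t))])
  have hvc : Continuous v :=
    (E.continuousOn_inv.comp_continuous (hb.comp hrc) fun t =>
      Set.image_subset_range _ _ (hb' _ (hr t))).sub
    (E.continuousOn_inv.comp_continuous (ha.comp hrc) fun t =>
      Set.image_subset_range _ _ (ha' _ (hr t)))
  have hv0 : ∀ t, a t = b t → v t = 0 := by
    intro t ht
    have e : a (ret t) = b (ret t) := by
      by_cases h : t ∈ Set.Ioo c d
      · have : ret t = t := by
          simp only [ret]
          rw [min_eq_left h.2.le, max_eq_right h.1.le]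
        rw [this, ht]
      · apply hab
        intro hh
        simp only [ret, Set.mem_Ioo, lt_max_iff, max_lt_iff, lt_min_iff, min_lt_iff, lt_irrefl,
          false_or, or_false] at hh
        exact h ⟨hh.1.1, hh.2.2⟩
    simp only [v, e, sub_self]
  have hc : (1 / 2 : NNReal) < 1 := by
    rw [← NNReal.coe_lt_coe]
    norm_num
  have hk : ∀ w : Plane, ContDiff ℝ ∞ fun x => χ x • w := fun w => x1.smul contDiff_const
  have hl : ∀ t, LipschitzWith (1 / 2) fun x => χ x • v t := fun t =>
    lipschitzWith_of_nnnorm_fderiv_le ((hk _).differentiable (by simp)) fun x => by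
      rw [← NNReal.coe_le_coe]
      have h := (fderiv_smul_const_le x1 x4 (v t) x).trans
        (mul_le_mul_of_nonneg_left (hv t) (by norm_num))
      norm_num at h ⊢
      exact h
  let h : ℝ → Diffeo Plane := fun t => perturbDiffeo _ (hk (v t)) _ hc (hl t)
  have hR : ∀ (w : Plane) x, R < ‖x‖ → x + χ x • w = x := fun w x hx => by
    rw [x3 x hx, zero_smul, add_zero]
  have hG : ∀ t y, E.extendDiffeo (h t) R (hR (v t)) y = E.extend (fun x => x + χ x • v t) y :=
    fun _ _ => rfl
  have hid : ∀ t, v t = 0 → ∀ y, E.extendDiffeo (h t) R (hR (v t)) y = y := by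
    intro t ht y
    rw [hG]
    exact E.extend_eq_self _ fun x _ => by rw [ht, smul_zero, add_zero]
  -- Tameness: the family is smooth in the displacement vector, and the displacement `v t` depends
  -- only continuously on time.
  refine ⟨fun t => E.extendDiffeo (h t) R (hR (v t)), ⟨Plane, _, _, _, v,
    E.contMDiff_extend_family (fun q : Plane × Plane => q.2 + χ q.2 • q.1) ?_ R hR, hvc, hG⟩,
    fun t => ?_, hid 0 (hv0 0 h0), hid 1 (hv0 1 h1)⟩
  · exact contDiff_snd.add ((x1.comp contDiff_snd).smul contDiff_fst)
  · by_cases ht : t ∈ Set.Ioo c d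
    · have e : ret t = t := by
        simp only [ret]
        rw [min_eq_left ht.2.le, max_eq_right ht.1.le]
      have i1 := ha' t (Set.Ioo_subset_Icc_self ht)
      have i2 := hb' t (Set.Ioo_subset_Icc_self ht)
      have e1 := E.apply_inv (Set.image_subset_range _ _ i1)
      have e2 := E.apply_inv (Set.image_subset_range _ _ i2)
      rw [hG]
      conv_lhs => rw [← e1]
      rw [E.extend_apply, x2 _ (hball _ i1), one_smul, ← e2]
      simp only [v, e, add_sub_cancel, e2]
    · change E.extendDiffeo (h t) R (hR (v t)) (a t) = b t
      rw [hid t (hv0 t (hab t ht)), hab t ht]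

/-- A null-homotopic loop is carried to its base point by a tame family. -/
theorem tamelyMoved_of_homotopic_refl [T2Space M] [IsManifold (𝓡 2) ∞ M] {x : M} (p : Path x x)
    (h : p.Homotopic (Path.refl x)) :
    TamelyMoved (fun t => p (Set.projIcc 0 1 zero_le_one t)) (fun _ => x) := by
  obtain ⟨Γ⟩ := h
  let pr : ℝ → I := Set.projIcc 0 1 zero_le_one
  have hpr : Continuous pr := continuous_projIcc
  let K : ℝ × ℝ → M := fun q => Γ (pr q.1, pr q.2)
  have hK : Continuous K := by fun_prop
  choose E hE using SmoothDisc.exists_center (M := M)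
  obtain ⟨ε, hε, hL⟩ := lebesgue_number_lemma_of_metric
    (isCompact_Icc (a := ((0, 0) : ℝ × ℝ)) (b := (1, 1)))
    (c := fun z : M => K ⁻¹' ((E z).toFun '' Metric.ball 0 1))
    (fun z => ((E z).isOpenEmbedding.isOpenMap _ Metric.isOpen_ball).preimage hK)
    (fun q _ => Set.mem_iUnion.2 ⟨K q, 0, by simp, hE _⟩)
  obtain ⟨n, hn⟩ := exists_nat_gt (2 / ε)
  have hn0 : (0 : ℝ) < n := (by positivity : (0 : ℝ) < 2 / ε).trans hn
  have hn2 : 2 / n < ε := by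
    rw [div_lt_iff₀ hε] at hn
    rw [div_lt_iff₀ hn0]
    linarith
  let cl : ℝ → ℝ := fun r => max 0 (min r 1)
  have hcl : ∀ r, 0 ≤ cl r ∧ cl r ≤ 1 := fun r =>
    ⟨le_max_left _ _, max_le zero_le_one (min_le_right _ _)⟩
  -- The profile `prof i j` has height `(i + 1) / n` up to time `(j - 1) / n`, then descends to `i /
  -- n` at time `j / n`. Passing from `j` to `j + 1` alters the curve only between the times `(j -
  -- 1) / n` and `(j + 1) / n`, where both curves stay in one disc.
  let prof : ℕ → ℕ → ℝ → ℝ := fun i j t => (i + cl (j - n * t)) / n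
  have hprof : ∀ i j, Continuous (prof i j) := fun i j => by fun_prop
  have hend0 : ∀ s, K (s, 0) = x := fun s => by
    have e : pr 0 = 0 := Set.projIcc_left _
    simp [K, e]
  have hend1 : ∀ s, K (s, 1) = x := fun s => by
    have e : pr 1 = 1 := Set.projIcc_right _
    simp [K, e]
  have step : ∀ i j : ℕ, i < n → j ≤ n →
      TamelyMoved (fun t => K (prof i j t, t)) (fun t => K (prof i (j + 1) t, t)) := by
    intro i j hi hj
    have hi' : (i : ℝ) + 1 ≤ n := by exact_mod_cast hi
    have hj' : (j : ℝ) ≤ n := by exact_mod_cast hj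
    obtain ⟨z, hz⟩ := hL (i / n, j / n) ⟨⟨by positivity, by positivity⟩,
      ⟨by rw [div_le_one hn0]; linarith, by rw [div_le_one hn0]; exact hj'⟩⟩
    have hmem : ∀ j' : ℕ, ∀ t ∈ Set.Icc (((j : ℝ) - 1) / n) ((j + 1) / n),
        K (prof i j' t, t) ∈ (E z).toFun '' Metric.ball 0 1 := by
      intro j' t ht
      refine hz ?_
      rw [Metric.mem_ball, Prod.dist_eq, Real.dist_eq, Real.dist_eq]
      have hb : 1 / (n : ℝ) < 2 / n := by
        rw [div_lt_div_iff_of_pos_right hn0]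
        norm_num
      refine max_lt ?_ ?_
      · have e : prof i j' t - i / n = cl (j' - n * t) / n := by
          simp only [prof]
          ring
        change |prof i j' t - i / n| < ε
        rw [e, abs_of_nonneg (div_nonneg (hcl _).1 hn0.le)]
        have := (div_le_div_iff_of_pos_right hn0).2 (hcl (j' - n * t)).2
        linarith
      · have e1 := ht.1
        have e2 := ht.2
        rw [sub_div] at e1
        rw [add_div] at e2
        change |t - j / n| < ε
        rw [abs_lt]
        constructor <;> linarith
    refine (E z).tamelyMoved (c := ((j : ℝ) - 1) / n) (d := (j + 1) / n)
      (hK.comp ((hprof _ _).prodMk continuous_id)) (hK.comp ((hprof _ _).prodMk continuous_id))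
      ((div_le_div_iff_of_pos_right hn0).2 (by linarith)) ?_ (hmem j) (hmem (j + 1)) ?_ ?_
    · intro t ht
      have e : cl (j - n * t) = cl ((j + 1 : ℕ) - n * t) := by
        rw [Set.mem_Ioo, not_and_or, not_lt, not_lt] at ht
        push_cast
        rcases ht with ht | ht
        · rw [le_div_iff₀ hn0] at ht
          simp only [cl]
          rw [min_eq_right (by linarith), min_eq_right (by linarith)]
        · rw [div_le_iff₀ hn0] at ht
          simp only [cl]
          rw [max_eq_left (min_le_of_left_le (by linarith)),
            max_eq_left (min_le_of_left_le (by linarith))]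
      simp only [prof, e]
    · simp only [hend0]
    · simp only [hend1]
  have row : ∀ i : ℕ, i < n → ∀ j : ℕ, j ≤ n + 1 →
      TamelyMoved (fun t => K (prof i 0 t, t)) (fun t => K (prof i j t, t)) := by
    intro i hi j
    induction j with
    | zero => exact fun _ => TamelyMoved.refl _
    | succ j ih => exact fun hj => (ih (by omega)).trans (step i j hi (by omega))
  have hKcl : ∀ s t, K (s, t) = K (s, max 0 (min t 1)) := by
    intro s t
    simp only [K]
    congr 2
    apply Subtype.ext
    simp only [pr, Set.coe_projIcc]
    rcases le_total t 1 with h | h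
    · rw [min_eq_left h, min_eq_right h, min_eq_right (max_le zero_le_one h), max_eq_right (le_max_left _ _)]
    · simp [h]
  -- On `[0, 1]` the profile with `j = 0` is constantly `i / n`, and it takes `j = n + 1` to reach
  -- `(i + 1) / n` throughout. At other times the profiles differ from these constants, but `K`
  -- equals `x` there.
  have hrow : ∀ i : ℕ, i < n →
      TamelyMoved (fun t => K ((i : ℝ) / n, t)) (fun t => K (((i + 1 : ℕ) : ℝ) / n, t)) := by
    intro i hi
    have h := row i hi (n + 1) le_rfl
    convert h using 2 with t t
    · rw [hKcl, hKcl (prof i 0 t)]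
      by_cases ht : 0 ≤ t
      · have e : cl ((0 : ℕ) - n * t) = 0 :=
          max_eq_left (min_le_of_left_le (by push_cast; nlinarith))
        simp only [prof, e, add_zero]
      · have e : max 0 (min t 1) = 0 := max_eq_left (min_le_of_left_le (by linarith))
        rw [e, hend0, hend0]
    · rw [hKcl, hKcl (prof i (n + 1) t)]
      by_cases ht : t ≤ 1
      · have e : cl ((n + 1 : ℕ) - n * t) = 1 := by
          simp only [cl]
          rw [min_eq_right (by push_cast; nlinarith), max_eq_right zero_le_one]
        simp only [prof]
        rw [e, Nat.cast_add, Nat.cast_one]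
      · have e : max 0 (min t 1) = 1 := by
          rw [min_eq_right (by linarith), max_eq_right zero_le_one]
        rw [e, hend1, hend1]
  have all : ∀ i : ℕ, i ≤ n →
      TamelyMoved (fun t => K (((0 : ℕ) : ℝ) / n, t)) (fun t => K ((i : ℝ) / n, t)) := by
    intro i
    induction i with
    | zero => exact fun _ => TamelyMoved.refl _
    | succ i ih => exact fun hi => (ih (by omega)).trans (hrow i (by omega))
  have h := all n le_rfl
  convert h using 2 with t t
  · have e : pr (((0 : ℕ) : ℝ) / n) = 0 := by
      rw [Nat.cast_zero, zero_div]
      exact Set.projIcc_left _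
    simp only [K, e]
    simp [pr]
  · have e : pr ((n : ℝ) / n) = 1 := by
      rw [div_self hn0.ne']
      exact Set.projIcc_right _
    simp [K, e]

end Tame

/-! ## Radial maps of the plane -/

section Radial

/-- The radial map of the plane that contracts the unit disc to the disc of radius `s`. -/
def radialIn (s : ℝ) (v : Plane) : Plane :=
  (min (s + (2 - s) * (max 1 ‖v‖ - 1)) (max 1 ‖v‖) / max 1 ‖v‖) • v

/-- The radial map of the plane that expands the disc of radius `s` to the unit disc. -/
def radialOut (s : ℝ) (v : Plane) : Plane :=
  (max (1 + (‖v‖ - s) / (2 - s)) ‖v‖ / ‖v‖) • v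

lemma continuous_radialIn : Continuous fun q : ℝ × Plane => radialIn q.1 q.2 := by
  unfold radialIn
  have h1 : Continuous fun q : ℝ × Plane => max 1 ‖q.2‖ := by fun_prop
  have h2 : Continuous fun q : ℝ × Plane =>
      min (q.1 + (2 - q.1) * (max 1 ‖q.2‖ - 1)) (max 1 ‖q.2‖) := by fun_prop
  exact (h2.div h1 fun q => (lt_of_lt_of_le one_pos (le_max_left _ _)).ne').smul continuous_snd

lemma continuousAt_radialOut {s : ℝ} (hs : s ≠ 2) {v : Plane} (hv : v ≠ 0) :
    ContinuousAt (fun q : ℝ × Plane => radialOut q.1 q.2) (s, v) := by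
  unfold radialOut
  have h1 : ContinuousAt (fun q : ℝ × Plane => (‖q.2‖ - q.1) / (2 - q.1)) (s, v) :=
    ContinuousAt.div (by fun_prop) (by fun_prop) (sub_ne_zero.2 hs.symm)
  have h2 : ContinuousAt (fun q : ℝ × Plane => ‖q.2‖) (s, v) := by fun_prop
  exact (((continuousAt_const.add h1).max h2).div h2 (norm_ne_zero_iff.2 hv)).smul continuousAt_snd

variable {s : ℝ} {v : Plane}

lemma radialIn_of_le (hv : ‖v‖ ≤ 1) (hs : s ≤ 1) : radialIn s v = s • v := by
  simp only [radialIn, max_eq_left hv]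
  rw [sub_self, mul_zero, add_zero, min_eq_left hs, div_one]

lemma radialIn_one : radialIn 1 v = v := by
  have h : 0 < max 1 ‖v‖ := lt_of_lt_of_le one_pos (le_max_left _ _)
  simp only [radialIn]
  rw [show (1 : ℝ) + (2 - 1) * (max 1 ‖v‖ - 1) = max 1 ‖v‖ by ring, min_self, div_self h.ne',
    one_smul]

lemma radialIn_of_two_le (hv : 2 ≤ ‖v‖) (hs : s ≤ 1) : radialIn s v = v := by
  have h : max 1 ‖v‖ = ‖v‖ := max_eq_right (by linarith)
  simp only [radialIn, h]
  rw [min_eq_right (by nlinarith), div_self (by linarith), one_smul]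

lemma radialOut_of_two_le (hv : 2 ≤ ‖v‖) (hs : s ≤ 1) : radialOut s v = v := by
  simp only [radialOut]
  rw [max_eq_right, div_self (by linarith), one_smul]
  have : (‖v‖ - s) / (2 - s) ≤ ‖v‖ - 1 := by
    rw [div_le_iff₀ (by linarith)]
    nlinarith
  linarith

/-- For `1 ≤ ‖v‖ ≤ 2` the radius is stretched affinely from `[1, 2]` onto `[s, 2]`; the minimum
switches to the identity beyond 2. -/
lemma norm_radialIn (hv : 1 ≤ ‖v‖) (hs0 : 0 ≤ s) (hs : s ≤ 1) :
    ‖radialIn s v‖ = min (s + (2 - s) * (‖v‖ - 1)) ‖v‖ := by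
  simp only [radialIn, max_eq_right hv]
  rw [norm_smul, Real.norm_of_nonneg, div_mul_cancel₀ _ (by linarith)]
  refine div_nonneg (le_min ?_ (by linarith)) (by linarith)
  nlinarith

lemma norm_radialOut (hv : v ≠ 0) : ‖radialOut s v‖ = max (1 + (‖v‖ - s) / (2 - s)) ‖v‖ := by
  have h := norm_pos_iff.2 hv
  simp only [radialOut]
  rw [norm_smul, Real.norm_of_nonneg (div_nonneg ((norm_nonneg _).trans (le_max_right _ _)) h.le),
    div_mul_cancel₀ _ h.ne']

/-- The radii are transformed by inverse affine maps up to 2 and by the identity beyond. For `s = 0`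
the unit circle collapses to the origin and its directions are lost, which `h0` excludes. -/
lemma radialOut_radialIn (hv : 1 ≤ ‖v‖) (hs0 : 0 ≤ s) (hs : s ≤ 1) (h0 : 0 < s ∨ 1 < ‖v‖) :
    radialOut s (radialIn s v) = v := by
  have hn := norm_radialIn hv hs0 hs
  have hp : 0 < min (s + (2 - s) * (‖v‖ - 1)) ‖v‖ := by
    refine lt_min ?_ (by linarith)
    rcases h0 with h | h <;> nlinarith
  simp only [radialOut]
  rw [hn]
  simp only [radialIn, max_eq_right hv]
  rw [smul_smul, div_mul_div_cancel₀ hp.ne']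
  have e : max (1 + (min (s + (2 - s) * (‖v‖ - 1)) ‖v‖ - s) / (2 - s))
      (min (s + (2 - s) * (‖v‖ - 1)) ‖v‖) = ‖v‖ := by
    rcases le_total ‖v‖ 2 with h | h
    · rw [min_eq_left (by nlinarith)]
      have : 1 + (s + (2 - s) * (‖v‖ - 1) - s) / (2 - s) = ‖v‖ := by
        rw [add_sub_cancel_left, mul_div_cancel_left₀ _ (by linarith)]
        ring
      rw [this, max_eq_left (by nlinarith)]
    · rw [min_eq_right (by nlinarith), max_eq_right]
      have : (‖v‖ - s) / (2 - s) ≤ ‖v‖ - 1 := by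
        rw [div_le_iff₀ (by linarith)]
        nlinarith
      linarith
  rw [e, div_self (by linarith), one_smul]

lemma one_le_norm_radialOut (hv : v ≠ 0) (hsv : s ≤ ‖v‖) (hs : s ≤ 1) : 1 ≤ ‖radialOut s v‖ := by
  rw [norm_radialOut hv]
  refine le_max_of_le_left ?_
  have : 0 ≤ (‖v‖ - s) / (2 - s) := div_nonneg (by linarith) (by linarith)
  linarith

lemma one_lt_norm_radialOut (hv : v ≠ 0) (hsv : s < ‖v‖) (hs : s ≤ 1) : 1 < ‖radialOut s v‖ := by
  rw [norm_radialOut hv]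
  refine lt_max_of_lt_left ?_
  have : 0 < (‖v‖ - s) / (2 - s) := div_pos (by linarith) (by linarith)
  linarith

lemma radialIn_radialOut (hv : v ≠ 0) (hsv : s ≤ ‖v‖) (hs : s ≤ 1) :
    radialIn s (radialOut s v) = v := by
  have h1 := one_le_norm_radialOut hv hsv hs
  have hp := norm_pos_iff.2 hv
  simp only [radialIn, max_eq_right h1]
  rw [norm_radialOut hv] at h1 ⊢
  simp only [radialOut]
  rw [smul_smul, div_mul_div_cancel₀ (by linarith)]
  have e : min (s + (2 - s) * (max (1 + (‖v‖ - s) / (2 - s)) ‖v‖ - 1))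
      (max (1 + (‖v‖ - s) / (2 - s)) ‖v‖) = ‖v‖ := by
    have h2 : (2 - s) * ((‖v‖ - s) / (2 - s)) = ‖v‖ - s := mul_div_cancel₀ _ (by linarith)
    rcases le_total ‖v‖ 2 with h | h
    · have h3 : ‖v‖ - 1 ≤ (‖v‖ - s) / (2 - s) := by
        rw [le_div_iff₀ (by linarith)]
        nlinarith
      rw [max_eq_left (by linarith), min_eq_left] <;> nlinarith
    · have h3 : (‖v‖ - s) / (2 - s) ≤ ‖v‖ - 1 := by
        rw [div_le_iff₀ (by linarith)]
        nlinarith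
      rw [max_eq_right (by linarith), min_eq_right]
      nlinarith
  rw [e, div_self hp.ne', one_smul]

end Radial

/-! ## Collapsing and opening a disc of a surface -/

namespace SmoothDisc

variable {M : Type} [TopologicalSpace M] [ChartedSpace Plane M] (E : SmoothDisc M)

/-- The topological counterpart of `contMDiff_extend_family`. It is stated at a single point because
expanding the centre is not continuous at the centre. -/
lemma continuousAt_extend_family [T2Space M] {P : Type*} [TopologicalSpace P]
    {k : P × Plane → Plane} {R : ℝ} {p : P} {y : M}
    (hR : ∀ᶠ q in nhds p, ∀ x, R < ‖x‖ → k (q, x) = x)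
    (hk : ∀ x, y = E.toFun x → ContinuousAt k (p, x)) :
    ContinuousAt (fun q : P × M => E.extend (fun x => k (q.1, x)) q.2) (p, y) := by
  by_cases hy : y ∈ Set.range E.toFun
  · obtain ⟨x, rfl⟩ := hy
    have h1 : ContinuousAt (fun q : P × M => E.toFun (k (q.1, E.inv q.2))) (p, E.toFun x) := by
      have i1 : ContinuousAt E.inv (E.toFun x) := (E.contMDiffAt_inv ⟨x, rfl⟩).continuousAt
      have i2 : ContinuousAt (fun q : P × M => (q.1, E.inv q.2)) (p, E.toFun x) :=
        continuousAt_fst.prodMk (ContinuousAt.comp (f := Prod.snd) (x := (p, E.toFun x)) i1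
          continuousAt_snd)
      have i3 : ContinuousAt k (p, E.inv (E.toFun x)) := by
        rw [E.inv_apply]
        exact hk x rfl
      exact E.continuous.continuousAt.comp
        (ContinuousAt.comp (f := fun q : P × M => (q.1, E.inv q.2)) (x := (p, E.toFun x)) i3 i2)
    refine h1.congr ?_
    have : ∀ᶠ q in nhds (p, E.toFun x), q.2 ∈ Set.range E.toFun :=
      continuousAt_snd.eventually (E.isOpenEmbedding.isOpen_range.mem_nhds ⟨x, rfl⟩)
    filter_upwards [this] with q hq
    obtain ⟨z, hz⟩ := hq
    rw [← hz, E.inv_apply, E.extend_apply]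
  · have hy' : y ∉ E.toFun '' Metric.closedBall 0 R := fun h => hy (Set.image_subset_range _ _ h)
    have h1 : ∀ᶠ q in nhds (p, y), q.2 ∈ (E.toFun '' Metric.closedBall 0 R)ᶜ :=
      continuousAt_snd.eventually ((E.isClosed_image_closedBall R).isOpen_compl.mem_nhds hy')
    refine continuousAt_snd.congr ?_
    filter_upwards [h1, continuousAt_fst.eventually hR] with q hq hq'
    refine (E.extend_eq_self _ fun x hx => hq' x ?_).symm
    by_contra hxR
    exact hq ⟨x, by simpa using hxR, hx.symm⟩

/-- The map of `M` that contracts the disc to the disc of radius `s`. -/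
def shrink (s : ℝ) : M → M := E.extend (radialIn s)

/-- The inverse of `shrink` outside of the disc of radius `s`. -/
def expand (s : ℝ) : M → M := E.extend (radialOut s)

variable {s : ℝ}

lemma continuous_shrink [T2Space M] :
    Continuous fun q : I × M => E.shrink q.1 q.2 := by
  rw [continuous_iff_continuousAt]
  rintro ⟨s, y⟩
  have hc : Continuous fun q : I × Plane => radialIn (q.1 : ℝ) q.2 :=
    continuous_radialIn.comp ((continuous_subtype_val.comp continuous_fst).prodMk continuous_snd)
  exact E.continuousAt_extend_family (P := I) (k := fun q => radialIn (q.1 : ℝ) q.2) (R := 2)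
    (Filter.Eventually.of_forall fun s x hx => radialIn_of_two_le hx.le s.2.2)
    fun x _ => hc.continuousAt

lemma continuousAt_expand [T2Space M] (s : I) {y : M} (hy : y ≠ E.toFun 0) :
    ContinuousAt (fun q : I × M => E.expand q.1 q.2) (s, y) := by
  refine E.continuousAt_extend_family (P := I) (k := fun q => radialOut (q.1 : ℝ) q.2) (R := 2)
    (Filter.Eventually.of_forall fun s x hx => radialOut_of_two_le hx.le s.2.2) fun x hx => ?_
  have h1 : x ≠ 0 := by
    rintro rfl
    exact hy hx
  have h2 : (s : ℝ) ≠ 2 := by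
    have := s.2.2
    intro h
    rw [h] at this
    norm_num at this
  exact ContinuousAt.comp (f := fun q : I × Plane => ((q.1 : ℝ), q.2)) (x := (s, x))
    (continuousAt_radialOut h2 h1) (by fun_prop)

lemma shrink_one (y : M) : E.shrink 1 y = y := E.extend_eq_self _ fun _ _ => radialIn_one

lemma shrink_apply (v : Plane) : E.shrink s (E.toFun v) = E.toFun (radialIn s v) :=
  E.extend_apply _ _

lemma expand_apply (v : Plane) : E.expand s (E.toFun v) = E.toFun (radialOut s v) :=
  E.extend_apply _ _

lemma mem_image_iff (A : Set Plane) (v : Plane) : E.toFun v ∈ E.toFun '' A ↔ v ∈ A :=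
  E.injective.mem_set_image

lemma expand_shrink (hs0 : 0 ≤ s) (hs : s ≤ 1) {y : M} (hy : y ∉ E.toFun '' Metric.ball 0 1)
    (h0 : 0 < s ∨ y ∉ E.toFun '' Metric.sphere 0 1) : E.expand s (E.shrink s y) = y := by
  rw [shrink, expand, extend_comp]
  refine E.extend_eq_self _ fun v hv => ?_
  subst hv
  rw [mem_image_iff, mem_ball_zero_iff, not_lt] at hy
  rw [mem_image_iff, mem_sphere_zero_iff_norm] at h0
  refine radialOut_radialIn hy hs0 hs (h0.imp_right fun h => lt_of_le_of_ne hy (Ne.symm h))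

lemma shrink_expand (hs : s ≤ 1) {y : M} (hy : y ∉ E.toFun '' Metric.ball 0 s)
    (h0 : y ≠ E.toFun 0) : E.shrink s (E.expand s y) = y := by
  rw [shrink, expand, extend_comp]
  refine E.extend_eq_self _ fun v hv => ?_
  subst hv
  rw [mem_image_iff, mem_ball_zero_iff, not_lt] at hy
  refine radialIn_radialOut ?_ hy hs
  rintro rfl
  exact h0 rfl

lemma expand_notMem_closedBall (hs : s ≤ 1) {y : M} (hy : y ∉ E.toFun '' Metric.closedBall 0 s)
    (h0 : y ≠ E.toFun 0) : E.expand s y ∉ E.toFun '' Metric.closedBall 0 1 := by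
  by_cases hr : y ∈ Set.range E.toFun
  · obtain ⟨v, rfl⟩ := hr
    rw [mem_image_iff, mem_closedBall_zero_iff, not_le] at hy
    rw [expand_apply, mem_image_iff, mem_closedBall_zero_iff, not_le]
    refine one_lt_norm_radialOut ?_ hy hs
    rintro rfl
    exact h0 rfl
  · rw [expand, E.extend_of_notMem _ hr]
    exact fun h => hr (Set.image_subset_range _ _ h)

lemma shrink_notMem_closedBall (hs0 : 0 ≤ s) (hs : s ≤ 1) {y : M}
    (hy : y ∉ E.toFun '' Metric.closedBall 0 1) : E.shrink s y ∉ E.toFun '' Metric.closedBall 0 s := by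
  by_cases hr : y ∈ Set.range E.toFun
  · obtain ⟨v, rfl⟩ := hr
    rw [mem_image_iff, mem_closedBall_zero_iff, not_le] at hy
    rw [shrink_apply, mem_image_iff, mem_closedBall_zero_iff, not_le, norm_radialIn hy.le hs0 hs]
    refine lt_min ?_ (by linarith)
    nlinarith
  · rw [shrink, E.extend_of_notMem _ hr]
    exact fun h => hr (Set.image_subset_range _ _ h)

end SmoothDisc

/-! ## Blowing up a fixed point of a family of diffeomorphisms -/

namespace SmoothDisc

variable {M : Type} [TopologicalSpace M] [ChartedSpace Plane M] (E : SmoothDisc M)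

/-- A diffeomorphism in the coordinates of the disc. -/
def germ (d : Diffeo M) (x : Plane) : Plane := E.inv (d (E.toFun x))

/-- The derivative at the centre of the disc. -/
def lin (d : Diffeo M) : Plane →L[ℝ] Plane := fderiv ℝ (E.germ d) 0

variable {E} {d : Diffeo M}

lemma germ_zero (hd : d (E.toFun 0) = E.toFun 0) : E.germ d 0 = 0 := by simp [germ, hd]

lemma symm_apply_center (hd : d (E.toFun 0) = E.toFun 0) : d.symm (E.toFun 0) = E.toFun 0 :=
  d.toEquiv.symm_apply_eq.2 hd.symm

lemma hasFDerivAt_germ (hd : d (E.toFun 0) = E.toFun 0) : HasFDerivAt (E.germ d) (E.lin d) 0 := by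
  obtain ⟨r, hr, hs, -⟩ := E.exists_germ d hd
  exact ((hs.contDiffAt (Metric.isOpen_ball.mem_nhds (Metric.mem_ball_self hr))).differentiableAt
    (by simp)).hasFDerivAt

/-- The chain rule at a common fixed point, where the germs of `d` and `d.symm` are locally inverse.
-/
lemma lin_comp_lin_symm (hd : d (E.toFun 0) = E.toFun 0) (v : Plane) :
    E.lin d.symm (E.lin d v) = v := by
  obtain ⟨r, hr, -, he⟩ := E.exists_germ d hd
  have h1 : HasFDerivAt (E.germ d.symm) (E.lin d.symm) (E.germ d 0) := by
    rw [germ_zero hd]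
    exact hasFDerivAt_germ (symm_apply_center hd)
  have h2 := h1.comp 0 (hasFDerivAt_germ hd)
  have h3 : E.germ d.symm ∘ E.germ d =ᶠ[nhds 0] id := by
    filter_upwards [Metric.ball_mem_nhds 0 hr] with x hx
    change E.inv (d.symm (E.toFun (E.inv (d (E.toFun x))))) = x
    rw [he x hx, Diffeomorph.symm_apply_apply, E.inv_apply]
  have h4 := (hasFDerivAt_id (0 : Plane)).unique (h2.congr_of_eventuallyEq h3.symm)
  exact (congrArg (fun T : Plane →L[ℝ] Plane => T v) h4).symm

lemma lin_ne_zero (hd : d (E.toFun 0) = E.toFun 0) {v : Plane} (hv : v ≠ 0) : E.lin d v ≠ 0 := by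
  intro h
  have := lin_comp_lin_symm hd v
  rw [h, map_zero] at this
  exact hv this.symm

lemma lin_eq_id (hd : ∀ y ∈ E.toFun '' Metric.closedBall 0 1, d y = y) (v : Plane) :
    E.lin d v = v := by
  have h : E.germ d =ᶠ[nhds 0] id := by
    filter_upwards [Metric.closedBall_mem_nhds 0 one_pos] with x hx
    rw [germ, hd _ ⟨x, hx, rfl⟩, E.inv_apply]
    rfl
  rw [lin, h.fderiv_eq, fderiv_id]
  rfl

variable (E)

/-- The difference quotient of the germs of a family, extended by the derivative. -/
def quotientGerm (φ : ℝ → Diffeo M) (q : ℝ × ℝ × Plane) : Plane :=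
  if q.2.1 = 0 then E.lin (φ q.1) q.2.2 else q.2.1⁻¹ • E.germ (φ q.1) (q.2.1 • q.2.2)

/-- The limit is taken separately along `r = 0` and `r ≠ 0`. The first is continuity of the
derivative in the parameters; the second needs an estimate uniform in time, which strict
differentiability of the smooth family supplies. -/
lemma continuousAt_quotientGerm {φ : ℝ → Diffeo M} (hφ : IsTame φ)
    (h0 : ∀ t, φ t (E.toFun 0) = E.toFun 0) (t : ℝ) (w : Plane) :
    ContinuousAt (E.quotientGerm φ) (t, 0, w) := by
  obtain ⟨V, _, _, Ψ, p, h1, h2, h3⟩ := hφ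
  let f : V × Plane → Plane := fun q => E.inv (Ψ (q.1, E.toFun q.2))
  have hf0 : ∀ s, f (p s, 0) = 0 := fun s => by
    simp only [f]
    rw [← h3, h0, E.inv_apply]
  have hf : ∀ s, ContDiffAt ℝ ∞ f (p s, 0) := by
    intro s
    have i1 : ContMDiffAt (𝓡 2) (𝓡 2) ∞ E.inv (Ψ (p s, E.toFun 0)) := by
      rw [← h3, h0]
      exact E.contMDiffAt_inv ⟨0, rfl⟩
    have i2 : ContMDiff (𝓘(ℝ, V).prod (𝓡 2)) (𝓡 2) ∞
        (fun q : V × Plane => Ψ (q.1, E.toFun q.2)) :=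
      h1.comp (contMDiff_fst.prodMk (E.contMDiff.comp contMDiff_snd))
    have i3 : ContMDiffAt (𝓘(ℝ, V).prod (𝓡 2)) (𝓡 2) ∞ f (p s, (0 : Plane)) :=
      ContMDiffAt.comp (f := fun q : V × Plane => Ψ (q.1, E.toFun q.2)) (p s, (0 : Plane)) i1
        i2.contMDiffAt
    rw [← modelWithCornersSelf_prod, chartedSpaceSelf_prod] at i3
    exact i3.contDiffAt
  have hgerm : ∀ s x, E.germ (φ s) x = f (p s, x) := fun s x => by simp only [germ, f, h3]
  have hlin : ∀ s, E.lin (φ s) = (fderiv ℝ f (p s, 0)).comp (ContinuousLinearMap.inr ℝ V Plane) := by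
    intro s
    have i1 := ((hf s).differentiableAt (by simp)).hasFDerivAt
    have i2 : HasFDerivAt (fun x : Plane => (p s, x)) (ContinuousLinearMap.inr ℝ V Plane) 0 :=
      hasFDerivAt_prodMk_right _ _
    have i3 : HasFDerivAt (fun x => f (p s, x)) _ (0 : Plane) :=
      HasFDerivAt.comp (g := f) (f := fun x : Plane => (p s, x)) (0 : Plane) i1 i2
    rw [lin, show E.germ (φ s) = fun x => f (p s, x) from funext (hgerm s), i3.fderiv]
  have hB0 : E.quotientGerm φ (t, 0, w) = E.lin (φ t) w := if_pos rfl
  rw [ContinuousAt, hB0, ← nhdsWithin_univ,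
    ← Set.union_compl_self {q : ℝ × ℝ × Plane | q.2.1 = 0}, nhdsWithin_union]
  refine Filter.Tendsto.sup ?_ ?_
  · have i1 : ContinuousAt (fun s => E.lin (φ s)) t := by
      simp only [hlin]
      have j := ((hf t).fderiv_right (m := 0) (by simp)).continuousAt
      have k : ContinuousAt (fun s => fderiv ℝ f (p s, 0)) t :=
        ContinuousAt.comp (f := fun s => (p s, (0 : Plane))) (x := t) j (by fun_prop)
      exact k.clm_comp continuousAt_const
    have i2 : ContinuousAt (fun q : ℝ × ℝ × Plane => E.lin (φ q.1) q.2.2) (t, 0, w) := by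
      have k : ContinuousAt (fun q : ℝ × ℝ × Plane => E.lin (φ q.1)) (t, 0, w) :=
        ContinuousAt.comp (f := Prod.fst) (x := (t, (0 : ℝ), w)) i1 continuousAt_fst
      exact k.clm_apply (by fun_prop)
    refine (i2.tendsto.mono_left nhdsWithin_le_nhds).congr' ?_
    filter_upwards [self_mem_nhdsWithin] with q hq
    exact (if_pos hq).symm
  -- Strict differentiability compares `f (p, r • w)` with `f (p, 0) = 0` while the parameter `p`
  -- moves too, so the error divided by `r` tends to zero.
  · have hs := (hf t).hasStrictFDerivAt (by simp)
    have hl := hs.isLittleO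
    have htend : Filter.Tendsto (fun q : ℝ × ℝ × Plane => ((p q.1, q.2.1 • q.2.2), (p q.1, (0 : Plane))))
        (nhdsWithin (t, 0, w) {q | q.2.1 = 0}ᶜ) (nhds ((p t, 0), (p t, 0))) := by
      have : Continuous (fun q : ℝ × ℝ × Plane =>
        ((p q.1, q.2.1 • q.2.2), (p q.1, (0 : Plane)))) := by fun_prop
      have h := this.tendsto (t, 0, w)
      simp only [zero_smul] at h
      exact h.mono_left nhdsWithin_le_nhds
    have hl' := hl.comp_tendsto htend
    have hw : ContinuousAt (fun q : ℝ × ℝ × Plane => ‖q.2.2‖) (t, 0, w) := by fun_prop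
    have hbd : ∀ᶠ q in nhdsWithin (t, 0, w) {q : ℝ × ℝ × Plane | q.2.1 = 0}ᶜ, ‖q.2.2‖ < ‖w‖ + 1 :=
      nhdsWithin_le_nhds (hw.eventually_lt continuousAt_const (by simp))
    have hmain : Filter.Tendsto (fun q : ℝ × ℝ × Plane =>
        q.2.1⁻¹ • E.germ (φ q.1) (q.2.1 • q.2.2) - E.lin (φ t) q.2.2)
        (nhdsWithin (t, 0, w) {q | q.2.1 = 0}ᶜ) (nhds 0) := by
      rw [Metric.tendsto_nhds]
      intro ε hε
      have hε' : 0 < ε / (‖w‖ + 1) := by positivity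
      filter_upwards [hl'.def hε', hbd, self_mem_nhdsWithin] with q hq hq' hq0
      have hr : q.2.1 ≠ 0 := hq0
      simp only [Function.comp_apply, Prod.mk_sub_mk, sub_self, sub_zero, hf0] at hq
      rw [Prod.norm_mk, norm_zero, max_eq_right (norm_nonneg _)] at hq
      have e1 : fderiv ℝ f (p t, 0) (0, q.2.1 • q.2.2) = q.2.1 • E.lin (φ t) q.2.2 := by
        rw [hlin, ← map_smul]
        rfl
      rw [e1, ← hgerm] at hq
      have e2 : q.2.1⁻¹ • E.germ (φ q.1) (q.2.1 • q.2.2) - E.lin (φ t) q.2.2 =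
          q.2.1⁻¹ • (E.germ (φ q.1) (q.2.1 • q.2.2) - q.2.1 • E.lin (φ t) q.2.2) := by
        rw [smul_sub, inv_smul_smul₀ hr]
      rw [dist_zero_right, e2, norm_smul, norm_inv]
      have hn : 0 < ‖q.2.1‖ := norm_pos_iff.2 hr
      rw [norm_smul] at hq
      calc ‖q.2.1‖⁻¹ * _ ≤ ‖q.2.1‖⁻¹ * (ε / (‖w‖ + 1) * (‖q.2.1‖ * ‖q.2.2‖)) := by gcongr
        _ = ε / (‖w‖ + 1) * ‖q.2.2‖ := by field_simp
        _ < ε / (‖w‖ + 1) * (‖w‖ + 1) := by gcongr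
        _ = ε := by field_simp
    have hc : ContinuousAt (fun q : ℝ × ℝ × Plane => E.lin (φ t) q.2.2) (t, 0, w) := by fun_prop
    have h := hmain.add (hc.tendsto.mono_left nhdsWithin_le_nhds)
    simp only [sub_add_cancel, zero_add] at h
    refine h.congr' ?_
    filter_upwards [self_mem_nhdsWithin] with q hq
    exact (if_neg hq).symm

end SmoothDisc

lemma IsTame.continuous {M : Type} [TopologicalSpace M] [ChartedSpace Plane M] {φ : ℝ → Diffeo M}
    (hφ : IsTame φ) : Continuous fun q : ℝ × M => φ q.1 q.2 := by
  obtain ⟨V, _, _, Ψ, p, h1, h2, h3⟩ := hφ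
  simp only [h3]
  exact h1.continuous.comp ((h2.comp continuous_fst).prodMk continuous_snd)

namespace SmoothDisc

variable {M : Type} [TopologicalSpace M] [ChartedSpace Plane M] (E : SmoothDisc M)

open Classical in
/-- The map induced by a diffeomorphism fixing the centre of the disc on the blow-up of the centre,
realized outside of the open disc. -/
def blowUp (d : Diffeo M) (y : M) : M :=
  if y ∈ E.toFun '' Metric.sphere 0 1 then E.toFun (‖E.lin d (E.inv y)‖⁻¹ • E.lin d (E.inv y))
  else E.expand 0 (d (E.shrink 0 y))

variable {E} {d : Diffeo M}

lemma blowUp_sphere {v : Plane} (hv : ‖v‖ = 1) :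
    E.blowUp d (E.toFun v) = E.toFun (‖E.lin d v‖⁻¹ • E.lin d v) := by
  rw [blowUp, if_pos ⟨v, by simpa using hv, rfl⟩, E.inv_apply]

lemma blowUp_of_notMem {y : M} (hy : y ∉ E.toFun '' Metric.sphere 0 1) :
    E.blowUp d y = E.expand 0 (d (E.shrink 0 y)) := if_neg hy

lemma notMem_closedBall_iff {y : M} : y ∉ E.toFun '' Metric.closedBall 0 1 ↔
    y ∉ E.toFun '' Metric.ball 0 1 ∧ y ∉ E.toFun '' Metric.sphere 0 1 := by
  rw [← Metric.ball_union_sphere, Set.image_union, Set.mem_union, not_or]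

lemma ne_center_iff {y : M} : y ∉ E.toFun '' Metric.closedBall 0 0 ↔ y ≠ E.toFun 0 := by
  simp

lemma shrink_ne_center {y : M} (hy : y ∉ E.toFun '' Metric.closedBall 0 1) :
    E.shrink 0 y ≠ E.toFun 0 :=
  ne_center_iff.1 (E.shrink_notMem_closedBall le_rfl zero_le_one hy)

lemma expand_notMem_of_ne_center {y : M} (hy : y ≠ E.toFun 0) :
    E.expand 0 y ∉ E.toFun '' Metric.closedBall 0 1 :=
  E.expand_notMem_closedBall zero_le_one (ne_center_iff.2 hy) hy

lemma apply_ne_center (hd : d (E.toFun 0) = E.toFun 0) {y : M} (hy : y ≠ E.toFun 0) :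
    d y ≠ E.toFun 0 := fun h => hy (d.injective (h.trans hd.symm))

lemma blowUp_notMem_closedBall (hd : d (E.toFun 0) = E.toFun 0) {y : M}
    (hy : y ∉ E.toFun '' Metric.closedBall 0 1) :
    E.blowUp d y ∉ E.toFun '' Metric.closedBall 0 1 := by
  rw [blowUp_of_notMem (notMem_closedBall_iff.1 hy).2]
  exact expand_notMem_of_ne_center (apply_ne_center hd (shrink_ne_center hy))

lemma blowUp_mem_sphere (hd : d (E.toFun 0) = E.toFun 0) {y : M}
    (hy : y ∈ E.toFun '' Metric.sphere 0 1) : E.blowUp d y ∈ E.toFun '' Metric.sphere 0 1 := by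
  obtain ⟨v, hv, rfl⟩ := hy
  rw [mem_sphere_zero_iff_norm] at hv
  rw [blowUp_sphere hv, mem_image_iff, mem_sphere_zero_iff_norm, norm_smul, norm_inv, norm_norm,
    inv_mul_cancel₀]
  refine norm_ne_zero_iff.2 (lin_ne_zero hd ?_)
  rintro rfl
  simp at hv

lemma notMem_ball_cases {y : M} (hy : y ∉ E.toFun '' Metric.ball 0 1) :
    y ∉ E.toFun '' Metric.closedBall 0 1 ∨ y ∈ E.toFun '' Metric.sphere 0 1 := by
  rw [notMem_closedBall_iff]
  tauto

lemma notMem_ball_of_mem_sphere {y : M} (hy : y ∈ E.toFun '' Metric.sphere 0 1) :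
    y ∉ E.toFun '' Metric.ball 0 1 := by
  obtain ⟨v, hv, rfl⟩ := hy
  rw [mem_image_iff]
  simp only [mem_sphere_iff_norm, sub_zero] at hv
  simp [hv]

lemma blowUp_notMem_ball (hd : d (E.toFun 0) = E.toFun 0) {y : M}
    (hy : y ∉ E.toFun '' Metric.ball 0 1) : E.blowUp d y ∉ E.toFun '' Metric.ball 0 1 := by
  rcases notMem_ball_cases hy with h | h
  · exact (notMem_closedBall_iff.1 (blowUp_notMem_closedBall hd h)).1
  · exact notMem_ball_of_mem_sphere (blowUp_mem_sphere hd h)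

/-- Off the circle, collapsing and opening the disc are inverse to each other; on the circle, the
normalized derivatives are inverse because normalization ignores positive scalars. -/
lemma blowUp_symm_blowUp (hd : d (E.toFun 0) = E.toFun 0) {y : M}
    (hy : y ∉ E.toFun '' Metric.ball 0 1) : E.blowUp d.symm (E.blowUp d y) = y := by
  rcases notMem_ball_cases hy with h | h
  · have h1 := notMem_closedBall_iff.1 h
    have h2 := blowUp_notMem_closedBall hd h
    have h3 := apply_ne_center hd (shrink_ne_center h)
    rw [blowUp_of_notMem (notMem_closedBall_iff.1 h2).2, blowUp_of_notMem h1.2,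
      shrink_expand _ zero_le_one (by simp) h3, Diffeomorph.symm_apply_apply]
    exact E.expand_shrink le_rfl zero_le_one hy (Or.inr h1.2)
  · have h2 := blowUp_mem_sphere hd h
    obtain ⟨v, hv, rfl⟩ := h
    rw [mem_sphere_zero_iff_norm] at hv
    have hv0 : v ≠ 0 := by
      rintro rfl
      simp at hv
    rw [blowUp_sphere hv, mem_image_iff, mem_sphere_zero_iff_norm] at h2
    have hp : 0 < ‖E.lin d v‖ := norm_pos_iff.2 (lin_ne_zero hd hv0)
    rw [blowUp_sphere hv, blowUp_sphere h2, map_smul, lin_comp_lin_symm hd, norm_smul, hv, mul_one,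
      smul_smul, norm_inv, norm_norm, inv_inv, mul_inv_cancel₀ hp.ne', one_smul]

lemma blowUp_eq_self (hd : ∀ y, d y = y) {y : M} (hy : y ∉ E.toFun '' Metric.ball 0 1) :
    E.blowUp d y = y := by
  by_cases h : y ∈ E.toFun '' Metric.sphere 0 1
  · obtain ⟨v, hv, rfl⟩ := h
    rw [mem_sphere_zero_iff_norm] at hv
    rw [blowUp_sphere hv, lin_eq_id fun y _ => hd y, hv, inv_one, one_smul]
  · rw [blowUp_of_notMem h, hd, E.expand_shrink le_rfl zero_le_one hy (Or.inr h)]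

lemma blowUp_sphere_eq_self (hd : ∀ y ∈ E.toFun '' Metric.closedBall 0 1, d y = y) {y : M}
    (hy : y ∈ E.toFun '' Metric.sphere 0 1) : E.blowUp d y = y := by
  obtain ⟨v, hv, rfl⟩ := hy
  rw [mem_sphere_zero_iff_norm] at hv
  rw [blowUp_sphere hv, lin_eq_id hd, hv, inv_one, one_smul]

/-- The blow-up of a tame family is continuous. -/
theorem continuous_blowUp [T2Space M] {φ : ℝ → Diffeo M} (hφ : IsTame φ)
    (h0 : ∀ t, φ t (E.toFun 0) = E.toFun 0) :
    Continuous fun q : ℝ × E.Compl => E.blowUp (φ q.1) q.2 := by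
  have hsh : Continuous fun y : M => E.shrink 0 y :=
    E.continuous_shrink.comp (by fun_prop : Continuous fun y : M => ((0 : I), y))
  have hmid : Continuous fun q : ℝ × E.Compl => φ q.1 (E.shrink 0 q.2) :=
    hφ.continuous.comp (continuous_fst.prodMk
      (hsh.comp (continuous_subtype_val.comp continuous_snd)))
  rw [continuous_iff_continuousAt]
  rintro ⟨t, y⟩
  rcases notMem_ball_cases y.2 with hy | hy
  · have h1 := apply_ne_center (h0 t) (shrink_ne_center hy)
    have h2 : ContinuousAt (fun z : M => E.expand 0 z) (φ t (E.shrink 0 y)) :=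
      ContinuousAt.comp (f := fun z : M => ((0 : I), z)) (E.continuousAt_expand 0 h1)
        (by fun_prop)
    have h3 : ContinuousAt (fun q : ℝ × E.Compl => E.expand 0 (φ q.1 (E.shrink 0 q.2))) (t, y) :=
      ContinuousAt.comp (f := fun q : ℝ × E.Compl => φ q.1 (E.shrink 0 q.2)) (x := (t, y)) h2
        hmid.continuousAt
    refine h3.congr ?_
    have hc : IsClosed (E.toFun '' Metric.sphere 0 1) :=
      ((isCompact_sphere _ _).image E.continuous).isClosed
    have hv : Continuous fun q : ℝ × E.Compl => (q.2 : M) :=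
      continuous_subtype_val.comp continuous_snd
    filter_upwards [(hc.isOpen_compl.preimage hv).mem_nhds (x := (t, y))
      (notMem_closedBall_iff.1 hy).2] with q hq
    exact (blowUp_of_notMem hq).symm
  · obtain ⟨w, hw, hwy⟩ := hy
    rw [mem_sphere_zero_iff_norm] at hw
    have hw0 : w ≠ 0 := by
      rintro rfl
      simp at hw
    -- Polar coordinates near the boundary: collapsing takes `v` to radius `r = 2 (‖v‖ - 1)` in the
    -- direction of `v`, the diffeomorphism takes this to `r • B`, and opening the disc gives `g`.
    -- Dividing by `‖B‖` instead of `r‖B‖` makes the formula continuous across `r = 0`, since `B`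
    -- does not vanish there.
    let B : ℝ × Plane → Plane := fun q => E.quotientGerm φ (q.1, 2 * (‖q.2‖ - 1), ‖q.2‖⁻¹ • q.2)
    let g : ℝ × Plane → Plane := fun q =>
      (max (1 + 2 * (‖q.2‖ - 1) * ‖B q‖ / 2) (2 * (‖q.2‖ - 1) * ‖B q‖) / ‖B q‖) • B q
    have hB : ContinuousAt B (t, w) := by
      have e : ((t, w) : ℝ × Plane).2 ≠ 0 := hw0
      have i1 : ContinuousAt (fun q : ℝ × Plane => ‖q.2‖⁻¹) (t, w) :=
        ContinuousAt.inv₀ (by fun_prop) (norm_ne_zero_iff.2 e)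
      have i2 : ContinuousAt (fun q : ℝ × Plane => (q.1, 2 * (‖q.2‖ - 1), ‖q.2‖⁻¹ • q.2)) (t, w) := by
        fun_prop
      have i3 := E.continuousAt_quotientGerm hφ h0 t w
      have e3 : (t, 2 * (‖w‖ - 1), ‖w‖⁻¹ • w) = (t, (0 : ℝ), w) := by simp [hw]
      rw [← e3] at i3
      exact ContinuousAt.comp (f := fun q : ℝ × Plane => (q.1, 2 * (‖q.2‖ - 1), ‖q.2‖⁻¹ • q.2))
        (x := (t, w)) i3 i2
    have hB0 : B (t, w) ≠ 0 := by
      have e : B (t, w) = E.lin (φ t) w := by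
        simp [B, quotientGerm, hw]
      rw [e]
      exact lin_ne_zero (h0 t) hw0
    have hg : ContinuousAt g (t, w) := by
      have i1 : ContinuousAt (fun q => ‖B q‖) (t, w) := hB.norm
      have i2 : ContinuousAt (fun q : ℝ × Plane => 2 * (‖q.2‖ - 1)) (t, w) := by fun_prop
      have i3 := i2.mul i1
      exact (((continuousAt_const.add (i3.div_const 2)).max i3).div i1
        (norm_ne_zero_iff.2 hB0)).smul hB
    have hinv : ContinuousAt (fun q : ℝ × E.Compl => (q.1, E.inv q.2)) (t, y) := by
      refine continuousAt_fst.prodMk ?_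
      have i1 : ContinuousAt E.inv (y : M) := (E.contMDiffAt_inv ⟨w, hwy⟩).continuousAt
      exact ContinuousAt.comp (f := fun q : ℝ × E.Compl => (q.2 : M)) (x := (t, y)) i1
        (continuous_subtype_val.comp continuous_snd).continuousAt
    have hmain : ContinuousAt (fun q : ℝ × E.Compl => E.toFun (g (q.1, E.inv q.2))) (t, y) := by
      refine E.continuous.continuousAt.comp ?_
      have e : (t, E.inv y) = (t, w) := by rw [← hwy, E.inv_apply]
      rw [← e] at hg
      exact ContinuousAt.comp (g := g) (f := fun q : ℝ × E.Compl => (q.1, E.inv q.2)) (x := (t, y))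
        hg hinv
    refine hmain.congr ?_
    have hU : IsOpen (E.toFun '' Metric.ball 0 2) :=
      E.isOpenEmbedding.isOpenMap _ Metric.isOpen_ball
    have hv : Continuous fun q : ℝ × E.Compl => (q.2 : M) :=
      continuous_subtype_val.comp continuous_snd
    have e1 : ∀ᶠ q in nhds (t, y), (q.2 : M) ∈ E.toFun '' Metric.ball 0 2 := by
      refine (hU.preimage hv).mem_nhds (x := (t, y)) ⟨w, ?_, hwy⟩
      rw [mem_ball_zero_iff, hw]
      norm_num
    have e2 : ∀ᶠ q in nhds (t, y), φ q.1 (E.shrink 0 q.2) ∈ Set.range E.toFun := by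
      refine (E.isOpenEmbedding.isOpen_range.preimage hmid).mem_nhds (x := (t, y)) ?_
      change φ t (E.shrink 0 y) ∈ Set.range E.toFun
      rw [← hwy, shrink_apply, radialIn_of_le hw.le zero_le_one, zero_smul, h0]
      exact ⟨0, rfl⟩
    filter_upwards [e1, e2] with q hq1 hq2
    obtain ⟨v, hv2, hvq⟩ := hq1
    rw [mem_ball_zero_iff] at hv2
    have hv1 : 1 ≤ ‖v‖ := by
      have := q.2.2
      rw [← hvq, mem_image_iff, mem_ball_zero_iff, not_lt] at this
      exact this
    rw [← hvq] at hq2 ⊢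
    rw [E.inv_apply]
    rcases hv1.eq_or_lt with h | h
    · rw [blowUp_sphere h.symm]
      simp [g, B, quotientGerm, ← h]
    · have hs : E.toFun v ∉ E.toFun '' Metric.sphere 0 1 := by
        rw [mem_image_iff, mem_sphere_zero_iff_norm]
        exact h.ne'
      rw [blowUp_of_notMem hs, shrink_apply]
      rw [shrink_apply] at hq2
      set r := 2 * (‖v‖ - 1) with hr
      have hr0 : 0 < r := by
        rw [hr]
        linarith
      have e3 : radialIn 0 v = r • (‖v‖⁻¹ • v) := by
        simp only [radialIn, max_eq_right hv1]
        rw [min_eq_left (by linarith), smul_smul, div_eq_mul_inv]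
        congr 2
        rw [hr]
        ring
      have e4 : E.germ (φ q.1) (radialIn 0 v) = r • B (q.1, v) := by
        simp only [B, quotientGerm]
        rw [← hr, if_neg hr0.ne', smul_inv_smul₀ hr0.ne', e3]
      rw [← E.apply_inv hq2]
      change E.toFun (g (q.1, v)) = E.expand 0 (E.toFun (E.germ (φ q.1) (radialIn 0 v)))
      rw [expand_apply, e4]
      congr 1
      simp only [g, radialOut]
      rw [← hr, norm_smul, Real.norm_of_nonneg hr0.le, smul_smul, sub_zero, sub_zero]
      congr 1
      rw [mul_comm r ‖B (q.1, v)‖, ← div_div, div_mul_cancel₀ _ hr0.ne']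

end SmoothDisc

/-! ### Interpolation between the blow-up and the restriction to the complement of the disc -/

lemma isHomeomorph_of_inverse {X Y : Type*} [TopologicalSpace X] [TopologicalSpace Y] {f : X → Y}
    {g : Y → X} (hf : Continuous f) (hg : Continuous g) (h1 : Function.LeftInverse g f)
    (h2 : Function.RightInverse g f) : IsHomeomorph f :=
  (Homeomorph.mk ⟨f, g, h1, h2⟩ hf hg).isHomeomorph

namespace SmoothDisc

variable {M : Type} [TopologicalSpace M] [ChartedSpace Plane M] (E : SmoothDisc M)

open Classical in
/-- A family of maps of the complement of the disc that interpolates between the blow-up and the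
restriction of a diffeomorphism that is the identity on the disc. -/
def interpolate (d : Diffeo M) (s : ℝ) (y : M) : M :=
  if E.shrink s y ∈ E.toFun '' Metric.closedBall 0 1 then y else E.expand s (d (E.shrink s y))

variable {E} {d : Diffeo M}

lemma symm_eq_self {A : Set M} (hd : ∀ y ∈ A, d y = y) : ∀ y ∈ A, d.symm y = y := fun y hy =>
  d.toEquiv.symm_apply_eq.2 (hd y hy).symm

lemma apply_notMem {A : Set M} (hd : ∀ y ∈ A, d y = y) {y : M} (hy : y ∉ A) : d y ∉ A :=
  fun h => hy (by
    have e : d y = y := d.injective (hd _ h)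
    rwa [e] at h)

lemma center_mem (E : SmoothDisc M) : E.toFun 0 ∈ E.toFun '' Metric.closedBall 0 1 :=
  ⟨0, by simp, rfl⟩

lemma ne_center_of_notMem {y : M} (hy : y ∉ E.toFun '' Metric.closedBall 0 1) : y ≠ E.toFun 0 := by
  rintro rfl
  exact hy E.center_mem

lemma notMem_closedBall_of_le {s : ℝ} (hs : s ≤ 1) {y : M}
    (hy : y ∉ E.toFun '' Metric.closedBall 0 1) : y ∉ E.toFun '' Metric.closedBall 0 s := fun h =>
  hy (Set.image_mono (Metric.closedBall_subset_closedBall hs) h)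

lemma notMem_ball_of_le {s : ℝ} (hs : s ≤ 1) {y : M}
    (hy : y ∉ E.toFun '' Metric.ball 0 1) : y ∉ E.toFun '' Metric.ball 0 s := fun h =>
  hy (Set.image_mono (Metric.ball_subset_ball hs) h)

lemma shrink_sphere_mem {s : ℝ} (hs0 : 0 ≤ s) (hs : s ≤ 1) {y : M}
    (hy : y ∈ E.toFun '' Metric.sphere 0 1) :
    E.shrink s y ∈ E.toFun '' Metric.closedBall 0 1 := by
  obtain ⟨v, hv, rfl⟩ := hy
  rw [mem_sphere_zero_iff_norm] at hv
  rw [shrink_apply, mem_image_iff, radialIn_of_le hv.le hs, mem_closedBall_zero_iff, norm_smul, hv,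
    mul_one, Real.norm_of_nonneg hs0]
  exact hs

variable (hd : ∀ y ∈ E.toFun '' Metric.closedBall 0 1, d y = y) (s : I)

include hd

lemma interpolate_notMem_ball {y : M} (hy : y ∉ E.toFun '' Metric.ball 0 1) :
    E.interpolate d s y ∉ E.toFun '' Metric.ball 0 1 := by
  unfold interpolate
  split_ifs with h
  · exact hy
  · have h1 := apply_notMem hd h
    exact (notMem_closedBall_iff.1 (E.expand_notMem_closedBall s.2.2
      (notMem_closedBall_of_le s.2.2 h1) (ne_center_of_notMem h1))).1

lemma interpolate_symm_interpolate {y : M} (hy : y ∉ E.toFun '' Metric.ball 0 1) :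
    E.interpolate d.symm s (E.interpolate d s y) = y := by
  by_cases h : E.shrink s y ∈ E.toFun '' Metric.closedBall 0 1
  · have e : ∀ d : Diffeo M, E.interpolate d s y = y := fun d => if_pos h
    rw [e, e]
  · have h1 := apply_notMem hd h
    have e1 : E.interpolate d s y = E.expand s (d (E.shrink s y)) := if_neg h
    have e2 : E.shrink s (E.expand s (d (E.shrink s y))) = d (E.shrink s y) :=
      E.shrink_expand s.2.2 (notMem_ball_of_le s.2.2 (notMem_closedBall_iff.1 h1).1)
        (ne_center_of_notMem h1)
    rw [e1, interpolate, e2, if_neg h1, Diffeomorph.symm_apply_apply]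
    refine E.expand_shrink s.2.1 s.2.2 hy (Or.inr fun hs => h (shrink_sphere_mem s.2.1 s.2.2 hs))

omit hd in
lemma interpolate_sphere {y : M} (hy : y ∈ E.toFun '' Metric.sphere 0 1) :
    E.interpolate d s y = y := if_pos (shrink_sphere_mem s.2.1 s.2.2 hy)

lemma interpolate_one (y : M) :
    E.interpolate d (1 : I) y = d y := by
  unfold interpolate
  split_ifs with h
  · rw [Set.Icc.coe_one, shrink_one] at h
    exact (hd y h).symm
  · rw [Set.Icc.coe_one, shrink_one] at h ⊢
    have h1 := (notMem_closedBall_iff.1 (apply_notMem hd h)).1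
    conv_lhs => rw [← E.shrink_one (d y)]
    exact E.expand_shrink zero_le_one le_rfl h1 (Or.inl one_pos)

lemma interpolate_zero {y : M} (hy : y ∉ E.toFun '' Metric.ball 0 1) :
    E.interpolate d (0 : I) y = E.blowUp d y := by
  by_cases hs : y ∈ E.toFun '' Metric.sphere 0 1
  · rw [interpolate_sphere _ hs, blowUp_sphere_eq_self hd hs]
  · rw [blowUp_of_notMem hs]
    unfold interpolate
    split_ifs with h
    · rw [Set.Icc.coe_zero] at h
      rw [hd _ h]
      exact (E.expand_shrink le_rfl zero_le_one hy (Or.inr hs)).symm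
    · rw [Set.Icc.coe_zero]

/-- Two closed sets cover the domain: where the shrunk point lies in the closed disc, and where it
is not in the open disc. On the overlap `d` is the identity and expanding undoes shrinking, so the
formulas agree. On the second set the centre, where `expand` is discontinuous, is never met. -/
lemma continuous_interpolate [T2Space M] :
    Continuous fun q : I × E.Compl => E.interpolate d q.1 q.2 := by
  have hsh : Continuous fun q : I × E.Compl => E.shrink q.1 q.2 :=
    E.continuous_shrink.comp (continuous_fst.prodMk (continuous_subtype_val.comp continuous_snd))
  have hv : Continuous fun q : I × E.Compl => (q.2 : M) :=
    continuous_subtype_val.comp continuous_snd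
  let A : Set (I × E.Compl) := (fun q => E.shrink q.1 q.2) ⁻¹' (E.toFun '' Metric.closedBall 0 1)
  let B : Set (I × E.Compl) := (fun q => E.shrink q.1 q.2) ⁻¹' (E.toFun '' Metric.ball 0 1)ᶜ
  have hA : IsClosed A := (E.isClosed_image_closedBall 1).preimage hsh
  have hB : IsClosed B :=
    (E.isOpenEmbedding.isOpenMap _ Metric.isOpen_ball).isClosed_compl.preimage hsh
  have hAB : A ∪ B = Set.univ := by
    refine Set.eq_univ_of_forall fun q => ?_
    by_cases h : E.shrink q.1 q.2 ∈ E.toFun '' Metric.ball 0 1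
    · exact Or.inl (Set.image_mono Metric.ball_subset_closedBall h)
    · exact Or.inr h
  have hBv : ∀ q ∈ B, E.interpolate d q.1 q.2 = E.expand q.1 (d (E.shrink q.1 q.2)) := by
    intro q hq
    by_cases h : E.shrink q.1 q.2 ∈ E.toFun '' Metric.closedBall 0 1
    · rw [interpolate, if_pos h, hd _ h]
      by_cases hs : (q.2 : M) ∈ E.toFun '' Metric.sphere 0 1
      -- A boundary point shrinks to radius `s`; staying out of the open disc forces `s = 1`, so `s
      -- > 0`.
      · refine (E.expand_shrink q.1.2.1 q.1.2.2 q.2.2 (Or.inl ?_)).symm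
        obtain ⟨v, hv, hvq⟩ := hs
        rw [mem_sphere_zero_iff_norm] at hv
        have hq' : E.shrink q.1 q.2 ∉ E.toFun '' Metric.ball 0 1 := hq
        rw [← hvq, shrink_apply, mem_image_iff, radialIn_of_le hv.le q.1.2.2,
          mem_ball_zero_iff, norm_smul, hv, mul_one, Real.norm_of_nonneg q.1.2.1] at hq'
        linarith
      · exact (E.expand_shrink q.1.2.1 q.1.2.2 q.2.2 (Or.inr hs)).symm
    · rw [interpolate, if_neg h]
  rw [← continuousOn_univ, ← hAB]
  refine ContinuousOn.union_of_isClosed ?_ ?_ hA hB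
  · exact hv.continuousOn.congr fun q hq => if_pos hq
  · refine ContinuousOn.congr (fun q hq => ?_) hBv
    refine ContinuousAt.continuousWithinAt ?_
    have hne : d (E.shrink q.1 q.2) ≠ E.toFun 0 := by
      refine apply_ne_center (hd _ E.center_mem) ?_
      rintro e
      refine (show E.shrink q.1 q.2 ∉ E.toFun '' Metric.ball 0 1 from hq) ?_
      rw [e]
      exact ⟨0, by simp, rfl⟩
    exact ContinuousAt.comp (f := fun q : I × E.Compl => (q.1, d (E.shrink q.1 q.2)))
      (E.continuousAt_expand q.1 hne)
      (continuous_fst.prodMk (d.continuous.comp hsh)).continuousAt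

end SmoothDisc

lemma IsTame.comp {M : Type} [TopologicalSpace M] [ChartedSpace Plane M] {φ : ℝ → Diffeo M}
    (hφ : IsTame φ) {c : ℝ → ℝ} (hc : Continuous c) : IsTame fun t => φ (c t) := by
  obtain ⟨V, _, _, Ψ, p, h1, h2, h3⟩ := hφ
  exact ⟨V, _, _, Ψ, fun t => p (c t), h1, h2.comp hc, fun t => h3 (c t)⟩

lemma IsTame.const {M : Type} [TopologicalSpace M] [ChartedSpace Plane M] (d : Diffeo M) :
    IsTame fun _ => d :=
  ⟨ℝ, _, _, fun q => d q.2, id, d.contMDiff.comp contMDiff_snd, continuous_id, fun _ _ => rfl⟩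

open SmoothDisc in
/-- An isotopy that ends with the identity on a disc and moves the centre of the disc along a
null-homotopic loop can be replaced by an isotopy of the complement of the disc. -/
theorem SmoothDisc.exists_isotopy_compl {M : Type} [TopologicalSpace M] [ChartedSpace Plane M]
    [T2Space M] [IsManifold (𝓡 2) ∞ M] (E : SmoothDisc M) {φ : ℝ → Diffeo M}
    (hφ : IsSmoothIsotopy φ) (hd : ∀ y ∈ E.toFun '' Metric.closedBall 0 1, φ 1 y = y)
    (h1 : φ 1 (E.toFun 0) = E.toFun 0) (hnull : (hφ.trace h1).Homotopic (Path.refl _)) :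
    ∃ H : C(I × E.Compl, E.Compl), (∀ t, IsHomeomorph fun x => H (t, x)) ∧
      (∀ t, ∀ a ∈ E.boundary, H (t, a) ∈ E.boundary) ∧ (∀ x, H (0, x) = x) ∧
      ∀ x, (H (1, x) : M) = φ 1 x := by
  obtain ⟨G, g1, g2, g3, g4⟩ := tamelyMoved_of_homotopic_refl _ hnull
  let c : ℝ → ℝ := fun t => (Set.projIcc (0 : ℝ) 1 zero_le_one t : ℝ)
  have hc : Continuous c := continuous_subtype_val.comp continuous_projIcc
  have c0 : c 0 = 0 := congrArg Subtype.val (Set.projIcc_left (zero_le_one' ℝ))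
  have c1 : c 1 = 1 := congrArg Subtype.val (Set.projIcc_right (zero_le_one' ℝ))
  -- `G` carries the trace, with time clamped to `[0, 1]`, to the centre; clamping the time of `φ`
  -- in the same way makes every `χ t` fix the centre.
  let χ : ℝ → Diffeo M := fun t => (φ (c t)).trans (G t)
  have hχ : IsTame χ := (hφ.isTame.comp hc).trans g1
  have hχ0 : ∀ t, χ t (E.toFun 0) = E.toFun 0 := g2
  have hχid : ∀ y, χ 0 y = y := fun y => by
    change G 0 (φ (c 0) y) = y
    rw [g3, c0, hφ.2]
  have hχ1 : ∀ y, χ 1 y = φ 1 y := fun y => by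
    change G 1 (φ (c 1) y) = _
    rw [g4, c1]
  have hd' := symm_eq_self hd
  let u : C(I × E.Compl, E.Compl) :=
    ⟨fun q => ⟨E.blowUp (χ q.1) q.2, blowUp_notMem_ball (hχ0 _) q.2.2⟩,
      ((continuous_blowUp hχ hχ0).comp (by fun_prop : Continuous fun q : I × E.Compl =>
        ((q.1 : ℝ), q.2))).subtype_mk _⟩
  let w : C(I × E.Compl, E.Compl) :=
    ⟨fun q => ⟨E.interpolate (φ 1) q.1 q.2, interpolate_notMem_ball hd q.1 q.2.2⟩,
      (continuous_interpolate hd).subtype_mk _⟩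
  let w' : C(I × E.Compl, E.Compl) :=
    ⟨fun q => ⟨E.interpolate (φ 1).symm q.1 q.2, interpolate_notMem_ball hd' q.1 q.2.2⟩,
      (continuous_interpolate hd').subtype_mk _⟩
  have hw : ∀ s x, w' (s, w (s, x)) = x := fun s x =>
    Subtype.ext (interpolate_symm_interpolate hd s x.2)
  have hw' : ∀ s x, w (s, w' (s, x)) = x := fun s x =>
    Subtype.ext (interpolate_symm_interpolate hd' s x.2)
  have huh : ∀ t, IsHomeomorph fun x => u (t, x) := by
    intro t
    have hs := symm_apply_center (hχ0 t)
    refine isHomeomorph_of_inverse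
      (g := fun x : E.Compl => ⟨E.blowUp (χ t).symm x, blowUp_notMem_ball hs x.2⟩)
      (by fun_prop) ?_ (fun x => Subtype.ext (blowUp_symm_blowUp (hχ0 t) x.2))
      (fun x => Subtype.ext (blowUp_symm_blowUp hs x.2))
    exact ((continuous_blowUp (IsTame.const (χ t).symm) fun _ => hs).comp
      (by fun_prop : Continuous fun x : E.Compl => ((0 : ℝ), x))).subtype_mk _
  -- The isotopy is `w_t ∘ w_0⁻¹ ∘ u_t`. It starts at the identity because `u_0` is the identity. It
  -- ends at `w_1`, the restriction of `φ₁`, because `u_1` and `w_0` are both the blow-up of `φ₁`.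
  refine ⟨⟨fun q => w (q.1, w' (0, u q)), by fun_prop⟩, fun t => ?_, fun t a ha => ?_, fun x => ?_,
    fun x => ?_⟩
  · have i1 : IsHomeomorph fun x => w (t, x) :=
      isHomeomorph_of_inverse (g := fun x => w' (t, x)) (by fun_prop) (by fun_prop) (hw t) (hw' t)
    have i2 : IsHomeomorph fun x => w' (0, x) :=
      isHomeomorph_of_inverse (g := fun x => w (0, x)) (by fun_prop) (by fun_prop) (hw' 0) (hw 0)
    exact i1.comp (i2.comp (huh t))
  · change E.interpolate (φ 1) t (E.interpolate (φ 1).symm (0 : I) (E.blowUp (χ t) a)) ∈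
      E.toFun '' Metric.sphere 0 1
    have h := blowUp_mem_sphere (hχ0 t) ha
    rw [interpolate_sphere _ h, interpolate_sphere _ h]
    exact h
  · have e : u (0, x) = x := Subtype.ext (blowUp_eq_self hχid x.2)
    change w (0, w' (0, u (0, x))) = x
    rw [hw', e]
  · have e : u (1, x) = w (0, x) := by
      refine Subtype.ext ?_
      change E.blowUp (χ 1) x = E.interpolate (φ 1) (0 : I) x
      rw [interpolate_zero hd x.2, show χ 1 = φ 1 from DFunLike.ext _ _ hχ1]
    change (w (1, w' (0, u (1, x))) : M) = φ 1 x
    rw [e, hw]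
    exact interpolate_one hd x

/-! ## Injective self-maps of the circle -/

/-- A continuous function on a circle of the plane is not injective. -/
lemma not_injective_of_sphere (f : Metric.sphere (0 : Plane) 1 → ℝ) (hf : Continuous f) :
    ¬ Function.Injective f := by
  intro hi
  have hr : 1 < Module.rank ℝ Plane := by
    rw [← Module.finrank_eq_rank]
    simp
  have hc : IsPreconnected (Set.univ : Set (Metric.sphere (0 : Plane) 1)) :=
    isPreconnected_iff_preconnectedSpace.1 (isPreconnected_sphere hr 0 1) |>.isPreconnected_univ
  have hne : ∀ x : Metric.sphere (0 : Plane) 1, -x ≠ x := fun x => by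
    exact (ne_neg_of_mem_unit_sphere ℝ x).symm
  obtain ⟨x⟩ : Nonempty (Metric.sphere (0 : Plane) 1) := (NormedSpace.sphere_nonempty.2 zero_le_one).to_subtype
  -- The Borsuk–Ulam argument on the circle: this odd function has a zero, where `f` takes equal
  -- values at antipodal points.
  let g : Metric.sphere (0 : Plane) 1 → ℝ := fun y => f y - f (-y)
  have hg : Continuous g := hf.sub (hf.comp continuous_neg)
  have h0 : ∃ y, g y = 0 := by
    have hx : g (-x) = -g x := by simp [g]
    rcases le_total 0 (g x) with h | h
    · obtain ⟨y, -, hy⟩ := hc.intermediate_value (Set.mem_univ (-x)) (Set.mem_univ x)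
        hg.continuousOn ⟨by linarith, h⟩
      exact ⟨y, hy⟩
    · obtain ⟨y, -, hy⟩ := hc.intermediate_value (Set.mem_univ x) (Set.mem_univ (-x))
        hg.continuousOn ⟨h, by linarith⟩
      exact ⟨y, hy⟩
  obtain ⟨y, hy⟩ := h0
  exact hne y (hi (sub_eq_zero.1 hy)).symm

/-- A continuous injective self-map of the circle is surjective. -/
lemma surjective_of_injective_sphere (f : Metric.sphere (0 : Plane) 1 → Metric.sphere (0 : Plane) 1)
    (hf : Continuous f) (hi : Function.Injective f) : Function.Surjective f := by
  by_contra hs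
  obtain ⟨v, hv⟩ := not_forall.1 hs
  have hv' : ∀ x, f x ≠ v := fun x hx => hv ⟨x, hx⟩
  have : Fact (Module.finrank ℝ Plane = 1 + 1) := ⟨by simp⟩
  -- Stereographic projection from a missed point would turn `f` into an injective real function on
  -- the circle.
  obtain ⟨s, hs⟩ : ∃ s : OpenPartialHomeomorph (Metric.sphere (0 : Plane) 1)
      (EuclideanSpace ℝ (Fin 1)), s.source = {v}ᶜ :=
    ⟨stereographic' 1 v, stereographic'_source v⟩
  have hmem : ∀ x, f x ∈ s.source := fun x => by
    rw [hs]
    exact hv' x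
  refine not_injective_of_sphere (fun x => s (f x) 0) ?_ fun x y hxy => hi ?_
  · have : Continuous fun x => s (f x) := s.continuousOn.comp_continuous hf hmem
    exact (EuclideanSpace.proj (𝕜 := ℝ) (0 : Fin 1)).continuous.comp this
  · refine s.injOn (hmem x) (hmem y) ?_
    ext i
    rw [Subsingleton.elim i 0]
    exact hxy

/-! ## Juxtaposing isotopies that preserve the boundary -/

/-- A self-homeomorphism that preserves the boundary is onto on the boundary. -/
lemma SmoothDisc.symm_mem_boundary {M : Type} [TopologicalSpace M] [ChartedSpace Plane M]
    (E : SmoothDisc M) (F : E.Compl ≃ₜ E.Compl) (hF : ∀ a ∈ E.boundary, F a ∈ E.boundary)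
    {a : E.Compl} (ha : a ∈ E.boundary) : F.symm a ∈ E.boundary := by
  have hmem : ∀ v : Metric.sphere (0 : Plane) 1, E.toFun v ∉ E.toFun '' Metric.ball 0 1 := by
    rintro ⟨v, hv⟩
    rw [mem_image_iff]
    simp only [mem_sphere_iff_norm, sub_zero] at hv
    simp [hv]
  let i : Metric.sphere (0 : Plane) 1 → E.Compl := fun v => ⟨E.toFun v, hmem v⟩
  have hic : Continuous i := (E.continuous.comp continuous_subtype_val).subtype_mk _
  have hib : ∀ v, i v ∈ E.boundary := fun v => ⟨v, v.2, rfl⟩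
  let r : E.boundary → Metric.sphere (0 : Plane) 1 := fun a => ⟨E.inv (a : E.Compl), by
    obtain ⟨v, hv, e⟩ := a.2
    rw [← e, E.inv_apply]
    exact hv⟩
  have hir : ∀ a, i (r a) = a := by
    intro a
    obtain ⟨v, hv, e⟩ := a.2
    exact Subtype.ext (E.apply_inv ⟨v, e⟩)
  have hrc : Continuous r := by
    refine Continuous.subtype_mk ?_ _
    refine E.continuousOn_inv.comp_continuous
      (continuous_subtype_val.comp continuous_subtype_val) fun a => ?_
    obtain ⟨v, hv, e⟩ := a.2
    exact ⟨v, e⟩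
  -- In the parametrization of the boundary, `F` is an injective self-map of the circle, hence onto.
  have hsurj := surjective_of_injective_sphere (fun v => r ⟨F (i v), hF _ (hib v)⟩)
    (hrc.comp ((F.continuous.comp hic).subtype_mk _)) (by
      intro v w h
      have h1 := congrArg i h
      simp only [hir] at h1
      have h2 := F.injective h1
      exact Subtype.ext (E.injective (congrArg Subtype.val h2)))
  obtain ⟨v, hv⟩ := hsurj (r ⟨a, ha⟩)
  have h1 := congrArg i hv
  simp only [hir] at h1
  rw [← h1, F.symm_apply_apply]
  exact hib v

/-- Juxtaposition of an isotopy that preserves the boundary with its conjugate. -/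
theorem glueHomeo_conj_isotopicToId {X : Type} [TopologicalSpace X] {A : Set X} (F : X ≃ₜ X)
    (hF : ∀ a ∈ A, F a ∈ A) (hF' : ∀ a ∈ A, F.symm a ∈ A) (f : HomeoRel X A) (H : C(I × X, X))
    (h1 : ∀ t, IsHomeomorph fun x => H (t, x)) (h2 : ∀ t, ∀ a ∈ A, H (t, a) ∈ A)
    (h3 : ∀ x, H (0, x) = x) (h4 : ∀ x, H (1, x) = (f : X ≃ₜ X) x)
    (h5 : ∀ t, ∀ a ∈ A, ∃ b ∈ A, H (t, b) = a) :
    glueHomeo hF f (conjHomeo F hF f) ∈ isotopicToId (Glue A F) ∅ := by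
  let q : X ⊕ X → Glue A F := Quot.mk _
  have hq : Continuous q := continuous_quot_mk
  have hqA : ∀ a ∈ A, q (Sum.inr a) = q (Sum.inl (F a)) := fun a ha =>
    Quot.sound ⟨a, ha, rfl, rfl⟩
  have hFc := F.continuous
  have hFs := F.symm.continuous
  let L : C(X, C(I, Glue A F)) :=
    ContinuousMap.curry ⟨fun p => q (Sum.inl (H (p.2, p.1))), by fun_prop⟩
  let R : C(X, C(I, Glue A F)) :=
    ContinuousMap.curry ⟨fun p => q (Sum.inr (F.symm (H (p.2, F p.1)))), by fun_prop⟩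
  -- On the second half the isotopy is conjugated by `F`, so a boundary point `a` goes to `F⁻¹ (H_t
  -- (F a))`, still on the boundary, and this is glued to `H_t (F a)`. The points of the boundary
  -- need not be fixed.
  have hLR : ∀ p p' : X ⊕ X, (∃ a ∈ A, p = Sum.inr a ∧ p' = Sum.inl (F a)) →
      Sum.elim L R p = Sum.elim L R p' := by
    rintro _ _ ⟨a, ha, rfl, rfl⟩
    ext t
    change q (Sum.inr (F.symm (H (t, F a)))) = q (Sum.inl (H (t, F a)))
    rw [hqA _ (hF' _ (h2 t _ (hF a ha))), F.apply_symm_apply]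
  let G : C(Glue A F, C(I, Glue A F)) :=
    ⟨Quot.lift (Sum.elim L R) hLR, continuous_quot_lift _ (L.continuous.sumElim R.continuous)⟩
  refine ⟨⟨fun p => G p.2 p.1, by fun_prop⟩, fun t => ?_, fun _ _ h => h.elim, ?_, ?_⟩
  · let e := (h1 t).homeomorph
    have he : ∀ x, e x = H (t, x) := fun _ => rfl
    -- The inverse descends to the glued surface only if it also preserves the boundary, which is
    -- what `h5` provides.
    have hes : ∀ a ∈ A, e.symm a ∈ A := by
      intro a ha
      obtain ⟨b, hb, hba⟩ := h5 t a ha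
      rw [← hba, ← he, e.symm_apply_apply]
      exact hb
    have hec := e.symm.continuous
    have hI : ∀ p p' : X ⊕ X, (∃ a ∈ A, p = Sum.inr a ∧ p' = Sum.inl (F a)) →
        Sum.elim (fun x => q (Sum.inl (e.symm x))) (fun x => q (Sum.inr (F.symm (e.symm (F x))))) p =
        Sum.elim (fun x => q (Sum.inl (e.symm x))) (fun x => q (Sum.inr (F.symm (e.symm (F x))))) p' := by
      rintro _ _ ⟨a, ha, rfl, rfl⟩
      change q (Sum.inr (F.symm (e.symm (F a)))) = q (Sum.inl (e.symm (F a)))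
      rw [hqA _ (hF' _ (hes _ (hF a ha))), F.apply_symm_apply]
    refine isHomeomorph_of_inverse (g := Quot.lift _ hI) (by fun_prop)
      (continuous_quot_lift _ (Continuous.sumElim (by fun_prop) (by fun_prop))) ?_ ?_
    · rintro ⟨x | x⟩
      · exact congrArg (fun y => q (Sum.inl y)) (e.symm_apply_apply x)
      · change q (Sum.inr (F.symm (e.symm (F (F.symm (e (F x))))))) = q (Sum.inr x)
        rw [F.apply_symm_apply, e.symm_apply_apply, F.symm_apply_apply]
    · rintro ⟨x | x⟩
      · exact congrArg (fun y => q (Sum.inl y)) (e.apply_symm_apply x)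
      · change q (Sum.inr (F.symm (e (F (F.symm (e.symm (F x))))))) = q (Sum.inr x)
        rw [F.apply_symm_apply, e.apply_symm_apply, F.symm_apply_apply]
  · rintro ⟨x | x⟩
    · exact congrArg (fun y => q (Sum.inl y)) (h3 x)
    · change q (Sum.inr (F.symm (H (0, F x)))) = q (Sum.inr x)
      rw [h3, F.symm_apply_apply]
  · rintro ⟨x | x⟩
    · exact congrArg (fun y => q (Sum.inl y)) (h4 x)
    · change q (Sum.inr (F.symm (H (1, F x)))) = q (Sum.inr (F.symm ((f : X ≃ₜ X) (F x))))
      rw [h4]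

/-! ## Loops around a point of the surface -/

namespace PathFunctional

variable {Y : Type*} [TopologicalSpace Y] {H : Type*} [AddCommGroup H]

/-- A path functional pulled back to a simply connected space has a primitive. -/
lemma exists_primitive {Z : Type*} [TopologicalSpace Z] [SimplyConnectedSpace Z]
    (θ : PathFunctional Z H) :
    ∃ h : Z → H, ∀ {x y : Z} (p : Path x y), θ.val p = h y - h x := by
  obtain ⟨b⟩ : Nonempty Z := inferInstance
  obtain ⟨h, hh⟩ := θ.exists_eq_diff_of_loops (b := b) (A := Set.univ)
    (fun x _ => ⟨PathConnectedSpace.somePath b x, fun _ => Set.mem_univ _⟩)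
    (fun {x} p _ => by rw [θ.val_eq_of_simplyConnected p (Path.refl x), θ.val_refl])
  exact ⟨h, fun p => hh p fun _ => Set.mem_univ _⟩

/-- The straight path in the complex plane. -/
def segment (x y : ℂ) : Path x y where
  toFun t := x + t * (y - x)
  continuous_toFun := by fun_prop
  source' := by simp
  target' := by simp

/-- Loops that lift to a periodic map of the complex plane have value zero, if the period does. -/
theorem val_eq_zero_of_lift (θ : PathFunctional Y H) (F : C(ℂ, Y)) {a : ℂ}
    (hF : ∀ z, F (z + a) = F z) (h : ℂ → H)
    (hh : ∀ {x y : ℂ} (p : Path x y), (θ.pullback F).val p = h y - h x) (ha : h a = h 0)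
    (L : C(I, ℂ)) (n : ℤ) (hL : L 1 = L 0 + n * a) {x : Y} (c : Path x x)
    (hc : ∀ t, c t = F (L t)) : θ.val c = 0 := by
  -- A segment and its translate by `a` have the same image under `F`, so the increments of `h`
  -- along them agree.
  have hper : Function.Periodic h a := by
    intro z
    let p := segment 0 z
    let q : Path (0 + a) (z + a) := p.map (continuous_id.add continuous_const)
    have e := θ.val_eq_of_forall_eq (p.map F.continuous) (q.map F.continuous)
      fun t => (hF (p t)).symm
    have e1 := hh p
    have e2 : (θ.pullback F).val q = h (z + a) - h 0 :=
      (hh q).trans (by rw [zero_add, ha])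
    have e3 : h z - h 0 = h (z + a) - h 0 := by rw [← e1, ← e2]; exact e
    exact (sub_left_inj.1 e3).symm
  let l : Path (L 0) (L 1) := ⟨L, rfl, rfl⟩
  rw [θ.val_eq_of_forall_eq c (l.map F.continuous) hc]
  change (θ.pullback F).val l = 0
  rw [hh l, hL, hper.int_mul n, sub_self]

/-- The boundary word of the standard surface is a product of commutators. -/
lemma primitive_boundary_eq {g : ℕ} (hg : 0 < g) (θ : PathFunctional Y H) (F : C(ℂ, Y))
    (h : ℂ → H) (hh : ∀ {x y : ℂ} (p : Path x y), (θ.pullback F).val p = h y - h x)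
    (e : ℝ → ℂ) (he : Continuous e)
    (h1 : ∀ i < g, ∀ s ∈ Set.Icc (0 : ℝ) 1,
      F (e ((4 * i + s) / (4 * g))) = F (e ((4 * i + 3 - s) / (4 * g))))
    (h2 : ∀ i < g, ∀ s ∈ Set.Icc (0 : ℝ) 1,
      F (e ((4 * i + 1 + s) / (4 * g))) = F (e ((4 * i + 4 - s) / (4 * g)))) :
    h (e 1) = h (e 0) := by
  have key : ∀ u v : ℝ → ℝ, Continuous u → Continuous v →
      (∀ s ∈ Set.Icc (0 : ℝ) 1, F (e (u s)) = F (e (v s))) →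
      h (e (u 1)) - h (e (u 0)) = h (e (v 1)) - h (e (v 0)) := by
    intro u v hu hv huv
    let p : ∀ w : ℝ → ℝ, Continuous w → Path (e (w 0)) (e (w 1)) := fun w hw =>
      ⟨⟨fun t => e (w t), by fun_prop⟩, by simp, by simp⟩
    rw [← hh (p u hu), ← hh (p v hv)]
    exact θ.val_eq_of_forall_eq _ _ fun t => huv t t.2
  have hg' : (g : ℝ) ≠ 0 := by positivity
  -- The increments of `h` along the sides `a` and `a⁻¹` cancel, as do those along `b` and `b⁻¹`, so
  -- `h` returns to its value after each block of four sides.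
  have step : ∀ i < g, h (e ((i + 1 : ℕ) / g)) = h (e (i / g)) := by
    intro i hi
    have k1 := key _ _ (by fun_prop) (by fun_prop) (h1 i hi)
    have k2 := key _ _ (by fun_prop) (by fun_prop) (h2 i hi)
    have e0 : ((i : ℝ)) / g = (4 * i + 0) / (4 * g) := by
      field_simp
      ring
    have e4 : (((i + 1 : ℕ) : ℝ)) / g = (4 * i + 4 - 0) / (4 * g) := by
      push_cast
      field_simp
      ring
    rw [e0, e4]
    have e1 : (4 * (i : ℝ) + 1 + 0) = 4 * i + 1 := by ring
    have e2 : (4 * (i : ℝ) + 1 + 1) = 4 * i + 3 - 1 := by ring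
    have e3 : (4 * (i : ℝ) + 4 - 1) = 4 * i + 3 - 0 := by ring
    rw [e1, e2, e3] at k2
    rw [sub_eq_sub_iff_add_eq_add] at k1 k2
    have k3 : h (e ((4 * i + 4 - 0) / (4 * g))) + (h (e ((4 * i + 3 - 1) / (4 * g))) +
        h (e ((4 * i + 1) / (4 * g))) + h (e ((4 * i + 3 - 0) / (4 * g)))) =
        h (e ((4 * i + 0) / (4 * g))) + (h (e ((4 * i + 3 - 1) / (4 * g))) +
        h (e ((4 * i + 1) / (4 * g))) + h (e ((4 * i + 3 - 0) / (4 * g)))) := by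
      calc _ = (h (e ((4 * i + 3 - 1) / (4 * g))) + h (e ((4 * i + 4 - 0) / (4 * g)))) +
            (h (e ((4 * i + 1) / (4 * g))) + h (e ((4 * i + 3 - 0) / (4 * g)))) := by abel
        _ = _ := by
          rw [k2, k1]
          abel
    exact add_right_cancel k3
  have all : ∀ i ≤ g, h (e (i / g)) = h (e 0) := by
    intro i
    induction i with
    | zero => simp
    | succ i ih => exact fun hi => (step i (by omega)).trans (ih (by omega))
  have := all g le_rfl
  rwa [div_self hg'] at this

end PathFunctional

/-! ## The interior of the polygon -/

namespace StandardSurface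

variable {g : ℕ}

/-- The quotient map from the polygon. -/
def proj (g : ℕ) : Metric.closedBall (0 : ℂ) 1 → StandardSurface g := Quot.mk _

lemma isQuotientMap_proj : Topology.IsQuotientMap (proj g) := isQuotientMap_quot_mk

/-- The coordinate on the interior of the polygon. -/
def coord (g : ℕ) : StandardSurface g → ℂ :=
  -- The value 2 marks the boundary: its norm is not less than 1 and it differs from the coordinate
  -- 0 of the centre.
  Quot.lift (fun z => open Classical in if ‖(z : ℂ)‖ < 1 then (z : ℂ) else 2) (by
    have hb : ∀ t, ¬ ‖(discBoundaryPoint t : ℂ)‖ < 1 := fun t => by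
      have h := Complex.norm_exp_ofReal_mul_I (2 * Real.pi * t)
      push_cast at h
      simp [discBoundaryPoint, h]
    rintro p q ⟨i, -, s, -, ⟨rfl, rfl⟩ | ⟨rfl, rfl⟩⟩ <;> simp only [if_neg (hb _)])

lemma coord_proj {z : Metric.closedBall (0 : ℂ) 1} (hz : ‖(z : ℂ)‖ < 1) :
    coord g (proj g z) = z := if_pos hz

lemma coord_proj_of_le {z : Metric.closedBall (0 : ℂ) 1} (hz : 1 ≤ ‖(z : ℂ)‖) :
    coord g (proj g z) = 2 := if_neg (not_lt.2 hz : ¬ ‖(z : ℂ)‖ < 1)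

/-- The interior of the polygon. -/
def interior (g : ℕ) : Set (StandardSurface g) := {x | ‖coord g x‖ < 1}

lemma isOpen_inter_preimage {W : Set ℂ} (hW : IsOpen W) :
    IsOpen (interior g ∩ coord g ⁻¹' W) := by
  rw [← isQuotientMap_proj.isOpen_preimage]
  have e : proj g ⁻¹' (interior g ∩ coord g ⁻¹' W) =
      {z : Metric.closedBall (0 : ℂ) 1 | ‖(z : ℂ)‖ < 1} ∩ (fun z : Metric.closedBall (0 : ℂ) 1 => (z : ℂ)) ⁻¹' W := by
    ext z
    by_cases hz : ‖(z : ℂ)‖ < 1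
    · simp [interior, coord_proj hz]
    · have h2 : ¬ (2 : ℝ) < 1 := by norm_num
      simp [interior, coord_proj_of_le (not_lt.1 hz), hz, h2]
  rw [e]
  exact (isOpen_lt (by fun_prop) continuous_const).inter (hW.preimage continuous_subtype_val)

lemma isOpen_interior : IsOpen (interior g) := by
  simpa using isOpen_inter_preimage (g := g) isOpen_univ

lemma continuousOn_coord : ContinuousOn (coord g) (interior g) :=
  (continuousOn_open_iff isOpen_interior).2 fun _ hW => isOpen_inter_preimage hW

lemma proj_coord {x : StandardSurface g} (hx : x ∈ interior g) :
    ∃ h : coord g x ∈ Metric.closedBall (0 : ℂ) 1, proj g ⟨coord g x, h⟩ = x := by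
  refine ⟨by simpa using (show ‖coord g x‖ < 1 from hx).le, ?_⟩
  obtain ⟨z, rfl⟩ := isQuotientMap_proj.surjective x
  have hz : ‖(z : ℂ)‖ < 1 := by
    by_contra h
    have h1 : ‖coord g (proj g z)‖ < 1 := hx
    rw [coord_proj_of_le (not_lt.1 h)] at h1
    norm_num at h1
  exact congrArg (proj g) (Subtype.ext (coord_proj (g := g) hz))

/-- The centre of the polygon. -/
def center (g : ℕ) : StandardSurface g := proj g ⟨0, by simp⟩

lemma coord_center : coord g (center g) = 0 :=
  coord_proj (z := ⟨0, by simp⟩) (by simp)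

lemma proj_ne_center {z : Metric.closedBall (0 : ℂ) 1} (hz : (z : ℂ) ≠ 0) :
    proj g z ≠ center g := by
  intro h
  have h1 := congrArg (coord g) h
  rw [coord_center] at h1
  by_cases hz1 : ‖(z : ℂ)‖ < 1
  · rw [coord_proj hz1] at h1
    exact hz h1
  · rw [coord_proj_of_le (not_lt.1 hz1)] at h1
    norm_num at h1

lemma center_mem_interior : center g ∈ interior g := by
  change ‖coord g (center g)‖ < 1
  simp [coord_center]

/-- The exponential map onto the punctured polygon. -/
def expDisc (z : ℂ) : Metric.closedBall (0 : ℂ) 1 :=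
  -- Clamping the real part keeps the image in the closed disc while the domain is all of `ℂ`, which
  -- is simply connected.
  ⟨Complex.exp (min z.re 0 + z.im * Complex.I), by
    rw [mem_closedBall_zero_iff, Complex.norm_exp]
    simp⟩

lemma continuous_expDisc : Continuous expDisc := by
  unfold expDisc
  fun_prop

lemma expDisc_of_re_le {z : ℂ} (hz : z.re ≤ 0) : (expDisc z : ℂ) = Complex.exp z := by
  simp [expDisc, min_eq_left hz]

lemma expDisc_add_period (z : ℂ) : expDisc (z + 2 * Real.pi * Complex.I) = expDisc z := by
  refine Subtype.ext ?_
  simp only [expDisc]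
  have e1 : (z + 2 * Real.pi * Complex.I).re = z.re := by simp
  have e2 : (z + 2 * Real.pi * Complex.I).im = z.im + 2 * Real.pi := by simp
  rw [e1, e2]
  push_cast
  rw [add_mul, ← add_assoc, Complex.exp_periodic]

lemma expDisc_boundary (t : ℝ) : expDisc (2 * Real.pi * t * Complex.I) = discBoundaryPoint t := by
  refine Subtype.ext ?_
  rw [expDisc_of_re_le (by simp)]
  rfl

lemma proj_boundary₁ {i : ℕ} (hi : i < g) {s : ℝ} (hs : s ∈ Set.Icc (0 : ℝ) 1) :
    proj g (discBoundaryPoint ((4 * i + s) / (4 * g))) =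
      proj g (discBoundaryPoint ((4 * i + 3 - s) / (4 * g))) :=
  Quot.sound ⟨i, hi, s, hs, Or.inl ⟨rfl, rfl⟩⟩

lemma proj_boundary₂ {i : ℕ} (hi : i < g) {s : ℝ} (hs : s ∈ Set.Icc (0 : ℝ) 1) :
    proj g (discBoundaryPoint ((4 * i + 1 + s) / (4 * g))) =
      proj g (discBoundaryPoint ((4 * i + 4 - s) / (4 * g))) :=
  Quot.sound ⟨i, hi, s, hs, Or.inr ⟨rfl, rfl⟩⟩

end StandardSurface

open StandardSurface in
/-- A path functional on the complement of a point vanishes on the loops near the point. -/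
theorem SmoothDisc.val_eq_zero_of_punctured {g : ℕ} (hg : 0 < g) {M : Type} [TopologicalSpace M]
    [ChartedSpace Plane M] (E : SmoothDisc M) (k : M ≃ₜ StandardSurface g)
    (hk : k (E.toFun 0) = center g) {H : Type*} [AddCommGroup H]
    (θ : PathFunctional {y : M // y ≠ E.toFun 0} H) {x : {y : M // y ≠ E.toFun 0}} (c : Path x x)
    (hc : ∀ t, (c t : M) ∈ Set.range E.toFun) : θ.val c = 0 := by
  -- the punctured polygon
  have hQ : ∀ z : ℂ, k.symm (proj g (expDisc z)) ≠ E.toFun 0 := by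
    intro z h
    rw [Homeomorph.symm_apply_eq, hk] at h
    exact proj_ne_center (Complex.exp_ne_zero _) h
  let F : C(ℂ, {y : M // y ≠ E.toFun 0}) :=
    ⟨fun z => ⟨k.symm (proj g (expDisc z)), hQ z⟩, (k.symm.continuous.comp
      (isQuotientMap_proj.continuous.comp continuous_expDisc)).subtype_mk _⟩
  obtain ⟨h, hh⟩ := (θ.pullback F).exists_primitive
  -- The imaginary axis runs along the boundary of the polygon, so the commutator word gives `h`
  -- equal values at `0` and `2πi`.
  have hbd := θ.primitive_boundary_eq hg F h hh (fun t => 2 * Real.pi * t * Complex.I)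
    (by fun_prop)
    (fun i hi s hs => Subtype.ext (congrArg k.symm (by
      rw [expDisc_boundary, expDisc_boundary, proj_boundary₁ hi hs])))
    (fun i hi s hs => Subtype.ext (congrArg k.symm (by
      rw [expDisc_boundary, expDisc_boundary, proj_boundary₂ hi hs])))
  simp only [Complex.ofReal_one, mul_one, Complex.ofReal_zero, mul_zero, zero_mul] at hbd
  -- shrink the loop
  let v : C(I, Plane) := ⟨fun t => E.inv (c t),
    E.continuousOn_inv.comp_continuous (continuous_subtype_val.comp c.continuous) hc⟩
  have hv : ∀ t, E.toFun (v t) = c t := fun t => E.apply_inv (hc t)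
  have hv0 : ∀ t, v t ≠ 0 := fun t h0 => (c t).2 (by rw [← hv, h0])
  have hv1 : v 0 = v 1 := by
    change E.inv (c 0) = E.inv (c 1)
    rw [c.source, c.target]
  obtain ⟨ε, hε, hε1, hint⟩ : ∃ ε : ℝ, 0 < ε ∧ ε ≤ 1 ∧
      ∀ t, k (E.toFun (ε • v t)) ∈ interior g := by
    have ho : IsOpen ((fun x => k (E.toFun x)) ⁻¹' interior g) :=
      isOpen_interior.preimage (k.continuous.comp E.continuous)
    obtain ⟨r, hr, hb⟩ := Metric.isOpen_iff.1 ho 0 (by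
      change k (E.toFun 0) ∈ interior g
      rw [hk]
      exact center_mem_interior)
    obtain ⟨C, hC⟩ := (isCompact_range v.continuous).isBounded.exists_norm_le
    have hC' : ∀ t, ‖v t‖ ≤ max C 1 := fun t => (hC _ ⟨t, rfl⟩).trans (le_max_left _ _)
    have hC0 : 0 < max C 1 := lt_of_lt_of_le one_pos (le_max_right _ _)
    refine ⟨min 1 (r / (2 * max C 1)), by positivity, min_le_left _ _, fun t => hb ?_⟩
    rw [mem_ball_zero_iff, norm_smul, Real.norm_of_nonneg (by positivity)]
    calc _ ≤ r / (2 * max C 1) * max C 1 :=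
          mul_le_mul (min_le_right _ _) (hC' t) (norm_nonneg _) (by positivity)
      _ = r / 2 := by field_simp
      _ < r := by linarith
  have hne : ∀ a : ℝ, 0 < a → ∀ t, E.toFun (a • v t) ≠ E.toFun 0 := fun a ha t h0 =>
    smul_ne_zero ha.ne' (hv0 t) (E.injective h0)
  have hpos : ∀ s : I, 0 < 1 - s * (1 - ε) := fun s => by nlinarith [s.2.1, s.2.2]
  let K : C(I × I, {y : M // y ≠ E.toFun 0}) :=
    ⟨fun q => ⟨E.toFun ((1 - q.1 * (1 - ε) : ℝ) • v q.2), hne _ (hpos _) _⟩,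
      (E.continuous.comp (by fun_prop)).subtype_mk _⟩
  let c1 : Path (⟨E.toFun (ε • v 0), hne ε hε 0⟩ : {y : M // y ≠ E.toFun 0})
      ⟨E.toFun (ε • v 0), hne ε hε 0⟩ :=
    ⟨⟨fun t => ⟨E.toFun (ε • v t), hne ε hε t⟩, (E.continuous.comp (by fun_prop)).subtype_mk _⟩,
      rfl, by simp [hv1]⟩
  rw [θ.val_eq_of_freeHomotopy K (fun s => by simp [K, hv1]) c c1
    (fun t => Subtype.ext (by simp [K, hv])) (fun t => Subtype.ext (by simp [K, c1]))]
  -- lift it to the logarithm of the polygon coordinate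
  let w : I → ℂ := fun t => coord g (k (E.toFun (ε • v t)))
  have hwc : Continuous w := continuousOn_coord.comp_continuous
    (k.continuous.comp (E.continuous.comp (by fun_prop))) hint
  have hwp : ∀ t, ∃ h, proj g ⟨w t, h⟩ = k (E.toFun (ε • v t)) := fun t => proj_coord (hint t)
  have hw0 : ∀ t, w t ≠ 0 := by
    intro t h0
    obtain ⟨hm, e⟩ := hwp t
    refine hne ε hε t (k.injective ?_)
    rw [hk, ← e, center]
    exact congrArg (proj g) (Subtype.ext h0)
  let wc : C(I, {z : ℂ // z ≠ 0}) := ⟨fun t => ⟨w t, hw0 t⟩, hwc.subtype_mk _⟩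
  obtain ⟨L, hL, -⟩ := Complex.isCoveringMap_exp.exists_path_lifts wc (Complex.log (w 0))
    (Subtype.ext (Complex.exp_log (hw0 0)).symm)
  have hLw : ∀ t, Complex.exp (L t) = w t := fun t => congrArg Subtype.val (congrFun hL t)
  have hre : ∀ t, (L t).re ≤ 0 := by
    intro t
    have h1 : ‖w t‖ < 1 := hint t
    rw [← hLw, Complex.norm_exp, Real.exp_lt_one_iff] at h1
    exact h1.le
  obtain ⟨n, hn⟩ := Complex.exp_eq_exp_iff_exists_int.1
    (show Complex.exp (L 1) = Complex.exp (L 0) by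
      rw [hLw, hLw]
      simp only [w, hv1])
  refine θ.val_eq_zero_of_lift F (a := 2 * Real.pi * Complex.I)
    (fun z => Subtype.ext (congrArg (fun z => k.symm (proj g z)) (expDisc_add_period z)))
    h hh hbd L n hn c1 fun t => Subtype.ext ?_
  obtain ⟨hm, e⟩ := hwp t
  change E.toFun (ε • v t) = k.symm (proj g (expDisc (L t)))
  rw [eq_comm, Homeomorph.symm_apply_eq, ← e]
  exact congrArg (proj g) (Subtype.ext ((expDisc_of_re_le (hre t)).trans (hLw t)))

/-! ## The outside of a disc -/

/-- The open annulus around the unit disc is path connected. -/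
lemma joinedIn_annulus {v w : Plane} (hv : 1 < ‖v‖ ∧ ‖v‖ < 2) (hw : 1 < ‖w‖ ∧ ‖w‖ < 2) :
    JoinedIn {x : Plane | 1 < ‖x‖ ∧ ‖x‖ < 2} v w := by
  have hr : 1 < Module.rank ℝ Plane := by
    rw [← Module.finrank_eq_rank]
    simp
  have hs : ∀ u : Plane, 1 < ‖u‖ ∧ ‖u‖ < 2 → ‖u‖⁻¹ • u ∈ Metric.sphere (0 : Plane) 1 := by
    intro u hu
    rw [mem_sphere_zero_iff_norm, norm_smul, norm_inv, norm_norm, inv_mul_cancel₀]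
    linarith
  obtain ⟨p, hp⟩ := (isPathConnected_sphere hr (0 : Plane) zero_le_one).joinedIn _ (hs v hv) _
    (hs w hw)
  have hp1 : ∀ t, ‖p t‖ = 1 := fun t => mem_sphere_zero_iff_norm.1 (hp t)
  let r : I → ℝ := fun t => (1 - t) * ‖v‖ + t * ‖w‖
  have hr0 : ∀ t : I, 1 < r t ∧ r t < 2 := fun t =>
    convex_Ioo (1 : ℝ) 2 hv hw (sub_nonneg.2 t.2.2) t.2.1 (sub_add_cancel 1 (t : ℝ))
  refine ⟨⟨⟨fun t => r t • p t, by fun_prop⟩, ?_, ?_⟩, fun t => ?_⟩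
  · have : ‖v‖ ≠ 0 := by linarith
    simp [r, smul_inv_smul₀ this]
  · have : ‖w‖ ≠ 0 := by linarith
    simp [r, smul_inv_smul₀ this]
  · change 1 < ‖r t • p t‖ ∧ ‖r t • p t‖ < 2
    rw [norm_smul, hp1, mul_one, Real.norm_of_nonneg (by linarith [(hr0 t).1])]
    exact hr0 t

namespace SmoothDisc

variable {M : Type} [TopologicalSpace M] [ChartedSpace Plane M] (E : SmoothDisc M)

/-- The complement of the closed disc. -/
def Outside : Set M := (E.toFun '' Metric.closedBall 0 1)ᶜ

variable {E}

lemma mem_outside {y : M} : y ∈ E.Outside ↔ y ∉ E.toFun '' Metric.closedBall 0 1 := Iff.rfl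

lemma isOpen_outside [T2Space M] : IsOpen E.Outside := (E.isClosed_image_closedBall 1).isOpen_compl

/-- Every point can be moved close to the disc by an isotopy that fixes the disc. -/
theorem exists_isotopy_near [T2Space M] [ConnectedSpace M] [IsManifold (𝓡 2) ∞ M] (y : M) :
    ∃ ψ : ℝ → Diffeo M, IsSmoothIsotopy ψ ∧
      (∀ t, ∀ x ∈ E.toFun '' Metric.closedBall 0 1, ψ t x = x) ∧
      ψ 1 y ∈ E.toFun '' Metric.ball 0 2 := by
  have hb : IsOpen (E.toFun '' Metric.ball 0 2) :=
    E.isOpenEmbedding.isOpenMap _ Metric.isOpen_ball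
  let W : Set M := {y | ∃ ψ : ℝ → Diffeo M, IsSmoothIsotopy ψ ∧
    (∀ t, ∀ x ∈ E.toFun '' Metric.closedBall 0 1, ψ t x = x) ∧ ψ 1 y ∈ E.toFun '' Metric.ball 0 2}
  have hsub : E.toFun '' Metric.ball 0 2 ⊆ W := fun y hy =>
    ⟨_, IsSmoothIsotopy.refl, fun _ _ _ => rfl, hy⟩
  have ho : IsOpen W := by
    rw [isOpen_iff_mem_nhds]
    rintro y ⟨ψ, h1, h2, h3⟩
    filter_upwards [(hb.preimage (ψ 1).continuous).mem_nhds h3] with z hz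
    exact ⟨ψ, h1, h2, hz⟩
  -- If some point of a small disc around `y`, away from `E`, could be moved, then so could `y`, by
  -- first translating `y` to that point inside the small disc.
  have hc : IsClosed W := by
    rw [← isOpen_compl_iff, isOpen_iff_mem_nhds]
    intro y hy
    have hyo : y ∈ E.Outside := fun h => hy (hsub (Set.image_mono (fun v hv => by
      rw [mem_closedBall_zero_iff] at hv
      rw [mem_ball_zero_iff]
      linarith) h))
    obtain ⟨E', rfl, hE'⟩ := exists_center_subset isOpen_outside hyo
    filter_upwards [(E'.isOpenEmbedding.isOpenMap _ Metric.isOpen_ball).mem_nhds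
      ⟨0, Metric.mem_ball_self one_pos, rfl⟩]
    rintro z ⟨v, hv, rfl⟩ ⟨ψ, h1, h2, h3⟩
    obtain ⟨τ, t1, t2, t3⟩ := E'.exists_translation (u := 0) (v := v) (by simp)
      (mem_ball_zero_iff.1 hv).le
    refine hy ⟨_, t1.trans h1, fun t x hx => ?_, ?_⟩
    · change ψ t (τ t x) = x
      rw [t3 t x fun h => hE' h hx, h2 t x hx]
    · change ψ 1 (τ 1 (E'.toFun 0)) ∈ _
      rw [t2, Real.smoothTransition.one]
      simpa using h3
  have : W = Set.univ := IsClopen.eq_univ ⟨hc, ho⟩ ⟨E.toFun 0, hsub ⟨0, by simp, rfl⟩⟩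
  exact this.ge (Set.mem_univ y)

lemma mem_annulus {y : M} (hy : y ∈ E.Outside) (hy' : y ∈ E.toFun '' Metric.ball 0 2) :
    ∃ v, (1 < ‖v‖ ∧ ‖v‖ < 2) ∧ E.toFun v = y := by
  obtain ⟨v, hv, rfl⟩ := hy'
  rw [mem_outside, mem_image_iff, mem_closedBall_zero_iff, not_le] at hy
  exact ⟨v, ⟨hy, mem_ball_zero_iff.1 hv⟩, rfl⟩

/-- Points outside but close to the disc are joined by paths of such points. -/
lemma exists_path_annulus {y z : E.Outside} (hy : (y : M) ∈ E.toFun '' Metric.ball 0 2)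
    (hz : (z : M) ∈ E.toFun '' Metric.ball 0 2) :
    ∃ p : Path y z, ∀ t, (p t : M) ∈ E.toFun '' Metric.ball 0 2 := by
  obtain ⟨v, hv, hvy⟩ := mem_annulus y.2 hy
  obtain ⟨w, hw, hwz⟩ := mem_annulus z.2 hz
  obtain ⟨p, hp⟩ := joinedIn_annulus hv hw
  have hm : ∀ t, E.toFun (p t) ∈ E.Outside := fun t => by
    rw [mem_outside, mem_image_iff, mem_closedBall_zero_iff, not_le]
    exact (hp t).1
  exact ⟨⟨⟨fun t => ⟨E.toFun (p t), hm t⟩, (E.continuous.comp p.continuous).subtype_mk _⟩,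
    Subtype.ext (by simpa using hvy), Subtype.ext (by simpa using hwz)⟩,
    fun t => ⟨p t, mem_ball_zero_iff.2 (hp t).2, rfl⟩⟩

variable (E) in
lemma exists_annulus : ∃ b : E.Outside, (b : M) ∈ E.toFun '' Metric.ball 0 2 := by
  obtain ⟨v, hv⟩ := exists_norm_eq Plane (show (0 : ℝ) ≤ 3 / 2 by norm_num)
  refine ⟨⟨E.toFun v, ?_⟩, v, by rw [mem_ball_zero_iff, hv]; norm_num, rfl⟩
  rw [mem_outside, mem_image_iff, mem_closedBall_zero_iff, hv]
  norm_num

/-- An isotopy that fixes the disc pushes `y` close to it; the trace stays outside, and the annulus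
around the disc is path connected. -/
lemma exists_path_outside [T2Space M] [ConnectedSpace M] [IsManifold (𝓡 2) ∞ M] {b : E.Outside}
    (hb : (b : M) ∈ E.toFun '' Metric.ball 0 2) (y : E.Outside) : Nonempty (Path b y) := by
  obtain ⟨ψ, h1, h2, h3⟩ := E.exists_isotopy_near (y : M)
  have hm : ∀ t, ψ t y ∈ E.Outside := fun t => apply_notMem (h2 t) y.2
  let p : Path y ⟨ψ 1 y, hm 1⟩ :=
    ⟨⟨fun t => ⟨ψ t y, hm t⟩, (h1.continuous.comp
      (by fun_prop : Continuous fun t : I => ((t : ℝ), (y : M)))).subtype_mk _⟩,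
      Subtype.ext (h1.2 y), rfl⟩
  obtain ⟨q, -⟩ := exists_path_annulus hb (z := ⟨ψ 1 y, hm 1⟩) h3
  exact ⟨q.trans p.symm⟩

/-- A path functional on the outside of a disc vanishes on the loops close to the disc. -/
theorem val_eq_zero_of_annulus {g : ℕ} (hg : 0 < g) [T2Space M] [ConnectedSpace M]
    [IsManifold (𝓡 2) ∞ M] (hM : Nonempty (M ≃ₜ StandardSurface g)) {H : Type*} [AddCommGroup H]
    (θ : PathFunctional E.Outside H) {x : E.Outside} (c : Path x x)
    (hc : ∀ t, (c t : M) ∈ E.toFun '' Metric.ball 0 2) : θ.val c = 0 := by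
  obtain ⟨m⟩ := hM
  have : LocallyPathConnectedSpace M := ChartedSpace.locallyPathConnectedSpace Plane M
  have : PathConnectedSpace M := pathConnectedSpace_iff_connectedSpace.2 inferInstance
  obtain ⟨φ, -, h1, -⟩ := exists_isotopy_trace_homotopic
    (PathConnectedSpace.somePath (E.toFun 0) (m.symm (StandardSurface.center g)))
  -- The outside of the disc is identified with the complement of its centre by collapsing and
  -- opening the disc, so the functional can be moved to the punctured surface.
  let X : C({y : M // y ≠ E.toFun 0}, E.Outside) :=
    ⟨fun y => ⟨E.expand 0 y, expand_notMem_of_ne_center y.2⟩, by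
      refine Continuous.subtype_mk (continuous_iff_continuousAt.2 fun y => ?_) _
      exact ContinuousAt.comp (f := fun y : {y : M // y ≠ E.toFun 0} => ((0 : I), (y : M)))
        (E.continuousAt_expand 0 y.2) (by fun_prop)⟩
  let S : C(E.Outside, {y : M // y ≠ E.toFun 0}) :=
    ⟨fun y => ⟨E.shrink 0 y, shrink_ne_center y.2⟩, by
      refine Continuous.subtype_mk ?_ _
      exact E.continuous_shrink.comp (by fun_prop : Continuous fun y : E.Outside => ((0 : I), (y : M)))⟩
  have hXS : ∀ y, X (S y) = y := fun y => Subtype.ext (E.expand_shrink le_rfl zero_le_one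
    (notMem_closedBall_iff.1 y.2).1 (Or.inr (notMem_closedBall_iff.1 y.2).2))
  have h := E.val_eq_zero_of_punctured hg ((φ 1).toHomeomorph.trans m)
    (show m (φ 1 (E.toFun 0)) = _ by rw [h1, m.apply_symm_apply]) (θ.pullback X)
    (c.map S.continuous) fun t => by
      obtain ⟨v, -, hv⟩ := hc t
      change E.shrink 0 (c t) ∈ _
      rw [← hv, shrink_apply]
      exact ⟨_, rfl⟩
  rw [← h]
  exact θ.val_eq_of_forall_eq _ _ fun t => (hXS (c t)).symm

/-- The map of the outside of the disc induced by a diffeomorphism that fixes the disc. -/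
def restrictOutside (d : Diffeo M) (hd : ∀ y ∈ E.toFun '' Metric.closedBall 0 1, d y = y) :
    C(E.Outside, E.Outside) :=
  ⟨fun y => ⟨d y, apply_notMem hd y.2⟩, (d.continuous.comp continuous_subtype_val).subtype_mk _⟩

/-- The end of an isotopy that is the identity near the disc acts trivially on path functionals of
the outside, up to a primitive that vanishes near the disc. -/
theorem exists_primitive_outside {g : ℕ} (hg : 0 < g) [T2Space M] [ConnectedSpace M]
    [IsManifold (𝓡 2) ∞ M] (hM : Nonempty (M ≃ₜ StandardSurface g)) {H : Type*} [AddCommGroup H]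
    (θ : PathFunctional E.Outside H) {φ : ℝ → Diffeo M} (hφ : IsSmoothIsotopy φ)
    (hd : ∀ y ∈ E.toFun '' Metric.closedBall 0 1, φ 1 y = y)
    (hd' : ∀ y ∈ E.toFun '' Metric.ball 0 2, φ 1 y = y) :
    ∃ h : E.Outside → H, (∀ {x y : E.Outside} (p : Path x y),
      θ.val (p.map (restrictOutside _ hd).continuous) - θ.val p = h y - h x) ∧
      ∀ y : E.Outside, (y : M) ∈ E.toFun '' Metric.ball 0 2 → h y = 0 := by
  obtain ⟨b, hb⟩ := exists_annulus E
  -- A primitive of `θ` in the annulus. Subtracting its coboundary makes `θ` vanish on the paths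
  -- there without changing its values on loops.
  obtain ⟨h0, hh0⟩ := θ.exists_eq_diff_of_loops (b := b)
    (A := {y | (y : M) ∈ E.toFun '' Metric.ball 0 2}) (fun y hy => exists_path_annulus hb hy)
    (fun p hp => val_eq_zero_of_annulus hg hM θ p hp)
  have hloop : ∀ {x : E.Outside} (c : Path x x),
      θ.val (c.map (restrictOutside _ hd).continuous) = θ.val c := by
    intro x c
    let K : C(I × I, M) := ⟨fun q => φ q.1 (c q.2), hφ.continuous.comp
      (by fun_prop : Continuous fun q : I × I => ((q.1 : ℝ), (c q.2 : M)))⟩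
    have hcov : E.Outside ∪ E.toFun '' Metric.ball 0 2 = Set.univ := by
      refine Set.eq_univ_of_forall fun y => ?_
      by_cases hy : y ∈ E.Outside
      · exact Or.inl hy
      · rw [mem_outside, not_not] at hy
        refine Or.inr (Set.image_mono (fun v hv => ?_) hy)
        rw [mem_closedBall_zero_iff] at hv
        rw [mem_ball_zero_iff]
        linarith
    -- The isotopy is a free homotopy in `M` from `c` to `φ₁ ∘ c` that may cross the disc; the
    -- corrected functional does not detect the crossing.
    have e := PathFunctional.val_eq_of_freeHomotopy_cover isOpen_outside
      (E.isOpenEmbedding.isOpenMap _ Metric.isOpen_ball) hcov (θ - PathFunctional.diff h0)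
      (fun p hp => by
        rw [PathFunctional.sub_val, PathFunctional.diff_val, hh0 p hp, sub_self]) K
      (fun s => by simp [K]) c (c.map (restrictOutside _ hd).continuous)
      (fun t => (hφ.2 _).symm) (fun t => rfl)
    rw [PathFunctional.sub_val, PathFunctional.sub_val, PathFunctional.diff_val,
      PathFunctional.diff_val, sub_self, sub_self, sub_zero, sub_zero] at e
    exact e.symm
  obtain ⟨h, hh⟩ := (θ.pullback (restrictOutside _ hd) - θ).exists_eq_diff_of_loops (b := b)
    (A := Set.univ) (fun y _ => ⟨(exists_path_outside hb y).some, fun _ => Set.mem_univ _⟩)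
    (fun c _ => sub_eq_zero.2 (hloop c))
  -- The primitive is normalized at a point `b` of the annulus. It then vanishes throughout the
  -- annulus, which is path connected and fixed by `φ₁`.
  refine ⟨fun y => h y - h b, fun p => ?_, fun y hy => ?_⟩
  · rw [sub_sub_sub_cancel_right]
    exact hh p fun _ => Set.mem_univ _
  · obtain ⟨p, hp⟩ := exists_path_annulus hb hy
    change h y - h b = 0
    rw [← hh p fun _ => Set.mem_univ _]
    refine sub_eq_zero.2 (θ.val_eq_of_forall_eq _ _ fun t => ?_)
    exact Subtype.ext (hd' _ (hp t))

end SmoothDisc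

/-! ## Isotopies of embedded discs -/

/-- The radial shrinking of the plane into the disc of radius `r`. -/
def shrinkPlane (r : ℝ) (q : I × Plane) : Plane :=
  (1 - q.1 + q.1 * r : ℝ) • (Real.sqrt (1 + ‖(q.1 : ℝ) • q.2‖ ^ 2))⁻¹ • q.2

lemma continuous_shrinkPlane (r : ℝ) : Continuous (shrinkPlane r) := by
  unfold shrinkPlane
  have h1 : Continuous fun q : I × Plane => (Real.sqrt (1 + ‖(q.1 : ℝ) • q.2‖ ^ 2))⁻¹ :=
    Continuous.inv₀ (by fun_prop) fun q => by positivity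
  fun_prop

/-- For `s ≠ 0` the map is the standard embedding onto the unit ball, conjugated by the scaling by
`s` and followed by a positive scaling. At `s = 0` the conjugation degenerates and the map is the
identity. -/
lemma isOpenEmbedding_shrinkPlane {r : ℝ} (hr : 0 < r) (s : I) :
    Topology.IsOpenEmbedding fun x => shrinkPlane r (s, x) := by
  have hu : Topology.IsOpenEmbedding
      (OpenPartialHomeomorph.univUnitBall : OpenPartialHomeomorph Plane Plane) :=
    OpenPartialHomeomorph.isOpenEmbedding _ rfl
  have hc : 0 < 1 - (s : ℝ) + s * r := by
    rcases eq_or_lt_of_le s.2.2 with h | h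
    · rw [h]
      linarith
    · nlinarith [s.2.1]
  have hsm : ∀ a : ℝ, a ≠ 0 → Topology.IsOpenEmbedding fun x : Plane => a • x := fun a ha =>
    (Homeomorph.smulOfNeZero a ha).isOpenEmbedding
  rcases eq_or_ne (s : ℝ) 0 with h | h
  · convert hsm _ hc.ne' using 2 with x
    simp [shrinkPlane, h]
  · convert (hsm _ hc.ne').comp ((hsm _ (inv_ne_zero h)).comp (hu.comp (hsm _ h))) using 2 with x
    simp only [shrinkPlane, Function.comp_apply, OpenPartialHomeomorph.univUnitBall_apply]
    congr 1
    rw [smul_smul, smul_smul]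
    congr 1
    rw [mul_comm _ (s : ℝ), mul_inv_cancel_left₀ h]

section Discs

variable {S : Type} [TopologicalSpace S]

lemma joinedIn_embeddedDiscs {e e' : C(Plane, S)} (K : C(I × Plane, S))
    (h : ∀ t, Topology.IsOpenEmbedding fun x => K (t, x)) (h0 : ∀ x, K (0, x) = e x)
    (h1 : ∀ x, K (1, x) = e' x) : JoinedIn (embeddedDiscs S) e e' :=
  ⟨⟨K.curry, ContinuousMap.ext h0, ContinuousMap.ext h1⟩, h⟩

/-- An embedded disc can be shrunk into a neighbourhood of its centre. -/
lemma exists_shrink_disc {e : C(Plane, S)} (he : e ∈ embeddedDiscs S) {W : Set S} (hW : IsOpen W)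
    (h0 : e 0 ∈ W) : ∃ e' ∈ embeddedDiscs S, JoinedIn (embeddedDiscs S) e e' ∧ e' 0 = e 0 ∧
      ∀ x, e' x ∈ W := by
  obtain ⟨r, hr, hb⟩ := Metric.isOpen_iff.1 (hW.preimage e.continuous) 0 h0
  have he' : Topology.IsOpenEmbedding e := he
  let K : C(I × Plane, S) :=
    ⟨fun q => e (shrinkPlane r q), e.continuous.comp (continuous_shrinkPlane r)⟩
  have hK : ∀ t, Topology.IsOpenEmbedding fun x => K (t, x) := fun t =>
    he'.comp (isOpenEmbedding_shrinkPlane hr t)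
  refine ⟨K.curry 1, hK 1, joinedIn_embeddedDiscs K hK (fun x => ?_) fun x => rfl, ?_,
    fun x => hb ?_⟩
  · simp [K, shrinkPlane]
  · simp [K, shrinkPlane]
  · have hx : shrinkPlane r (1, x) = r • (OpenPartialHomeomorph.univUnitBall x : Plane) := by
      simp [shrinkPlane, OpenPartialHomeomorph.univUnitBall_apply]
    have hm : (OpenPartialHomeomorph.univUnitBall x : Plane) ∈ Metric.ball (0 : Plane) 1 :=
      OpenPartialHomeomorph.univUnitBall.map_source (Set.mem_univ x)
    rw [mem_ball_zero_iff] at hm ⊢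
    rw [hx, norm_smul, Real.norm_of_nonneg hr.le]
    exact mul_lt_of_lt_one_right hr hm

/-- If `e` is isotopic to a disc `e'` in the fixed set, then `f ∘ e` is isotopic to `f ∘ e' = e'`,
hence to `e`. -/
lemma mem_homeoPlus_of_forall (f : HomeoRel S ∅) (N : Set S)
    (hN : ∀ x ∈ N, (f : S ≃ₜ S) x = x)
    (h : ∀ e ∈ embeddedDiscs S, ∃ e', JoinedIn (embeddedDiscs S) e e' ∧ ∀ x, e' x ∈ N) :
    f ∈ homeoPlus S := by
  intro e he
  obtain ⟨e', ⟨p, hp⟩, hN'⟩ := h e he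
  have h1 : JoinedIn (embeddedDiscs S) (((f : S ≃ₜ S) : C(S, S)).comp e)
      (((f : S ≃ₜ S) : C(S, S)).comp e') :=
    ⟨p.map (ContinuousMap.continuous_postcomp _), fun t =>
      (f : S ≃ₜ S).isOpenEmbedding.comp (hp t)⟩
  have h2 : ((f : S ≃ₜ S) : C(S, S)).comp e' = e' := ContinuousMap.ext fun x => hN _ (hN' x)
  rw [h2] at h1
  exact JoinedIn.trans ⟨p, hp⟩ h1.symm

end Discs

/-! ## Doubles of the outside of a disc -/

namespace SmoothDisc

variable {M : Type} [TopologicalSpace M] [ChartedSpace Plane M] {E : SmoothDisc M}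

section Double

variable {S : Type} [TopologicalSpace S] {d : Diffeo M}
  (hd : ∀ y ∈ E.toFun '' Metric.closedBall 0 1, d y = y)

/-- A space covered by two copies of the outside of a disc and a set of fixed points of a
homeomorphism, which acts on the two copies by a diffeomorphism. -/
structure IsDouble (f : S ≃ₜ S) (N : Set S) (j : Bool → C(E.Outside, S)) : Prop where
  isOpenEmbedding : ∀ b, Topology.IsOpenEmbedding (j b)
  disjoint : ∀ {b b' y y'}, j b y = j b' y' → b = b'
  apply_eq : ∀ b y, f (j b y) = j b (restrictOutside d hd y)
  isOpen : IsOpen N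
  fixed : ∀ x ∈ N, f x = x
  mem_iff : ∀ b y, j b y ∈ N ↔ (y : M) ∈ E.toFun '' Metric.ball 0 2
  cover : ∀ x, x ∈ N ∨ ∃ b y, j b y = x

variable {hd} {f : HomeoRel S ∅} {N : Set S} {j : Bool → C(E.Outside, S)}

include hd in
-- Every embedded disc can be moved into the fixed set `N`. If its centre lies in `N`, it is shrunk.
-- Otherwise it is shrunk into one of the copies, its centre is carried close to the removed disc by
-- an isotopy, and it is shrunk again.
theorem IsDouble.mem_homeoPlus [T2Space M] [ConnectedSpace M] [IsManifold (𝓡 2) ∞ M]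
    (h : IsDouble hd (f : S ≃ₜ S) N j) : f ∈ homeoPlus S := by
  refine mem_homeoPlus_of_forall f N h.fixed fun e he => ?_
  rcases h.cover (e 0) with h0 | ⟨b, y, hy⟩
  · obtain ⟨e', -, h1, -, h2⟩ := exists_shrink_disc he h.isOpen h0
    exact ⟨e', h1, h2⟩
  · obtain ⟨e₁, he₁, h1, h10, h1r⟩ := exists_shrink_disc he (h.isOpenEmbedding b).isOpen_range
      ⟨y, hy⟩
    choose e₂ he₂ using h1r
    have hc₂ : Continuous e₂ := by
      rw [(h.isOpenEmbedding b).isInducing.continuous_iff]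
      have : j b ∘ e₂ = e₁ := funext he₂
      rw [this]
      exact e₁.continuous
    have ho₂ : Topology.IsOpenEmbedding e₂ := by
      refine Topology.IsOpenEmbedding.of_comp e₂ (h.isOpenEmbedding b) ?_
      have : j b ∘ e₂ = e₁ := funext he₂
      rw [this]
      exact he₁
    have hy₂ : e₂ 0 = y := (h.isOpenEmbedding b).injective (by rw [he₂, h10, hy])
    obtain ⟨ψ, p1, p2, p3⟩ := E.exists_isotopy_near (y : M)
    let K : C(I × Plane, S) := ⟨fun q => j b ⟨ψ q.1 (e₂ q.2), apply_notMem (p2 _) (e₂ q.2).2⟩, by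
      refine (j b).continuous.comp (Continuous.subtype_mk ?_ _)
      exact p1.continuous.comp
        (by fun_prop : Continuous fun q : I × Plane => ((q.1 : ℝ), (e₂ q.2 : M)))⟩
    have hK : ∀ t, Topology.IsOpenEmbedding fun x => K (t, x) := by
      intro t
      have hs := symm_eq_self (p2 t)
      have : IsHomeomorph (restrictOutside (ψ t) (p2 t)) :=
        isHomeomorph_of_inverse (g := restrictOutside (ψ t).symm hs) (map_continuous _)
          (map_continuous _) (fun x => Subtype.ext ((ψ t).symm_apply_apply x))
          fun x => Subtype.ext ((ψ t).apply_symm_apply x)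
      exact (h.isOpenEmbedding b).comp (this.isOpenEmbedding.comp ho₂)
    have h2 : JoinedIn (embeddedDiscs S) e₁ (K.curry 1) :=
      joinedIn_embeddedDiscs K hK (fun x => by
        rw [← he₂ x]
        exact congrArg (j b) (Subtype.ext (p1.2 _))) fun x => rfl
    obtain ⟨e', -, h3, -, h4⟩ := exists_shrink_disc (e := K.curry 1) (hK 1) h.isOpen (by
      change j b ⟨ψ ((1 : I) : ℝ) (e₂ 0), _⟩ ∈ N
      rw [h.mem_iff]
      simpa only [hy₂, Set.Icc.coe_one] using p3)
    exact ⟨e', (h1.trans h2).trans h3, h4⟩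

/-- On each copy, the change of the singular path functional under `f` has a primitive that vanishes
close to the disc. Extended by zero over `N`, the two primitives form one function on `S`. The
coboundary identity holds in each member of an open cover, hence for all paths. -/
theorem IsDouble.mem_homologyTrivial {g : ℕ} (hg : 0 < g) [T2Space M] [ConnectedSpace M]
    [IsManifold (𝓡 2) ∞ M] (hM : Nonempty (M ≃ₜ StandardSurface g)) {φ : ℝ → Diffeo M}
    (hφ : IsSmoothIsotopy φ) (hd : ∀ y ∈ E.toFun '' Metric.closedBall 0 1, φ 1 y = y)
    (hd' : ∀ y ∈ E.toFun '' Metric.ball 0 2, φ 1 y = y)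
    (h : IsDouble hd (f : S ≃ₜ S) N j) : f ∈ homologyTrivial S := by
  classical
  let θ := singularPathFunctional S
  choose k hk hk0 using fun b =>
    exists_primitive_outside hg hM (θ.pullback (j b)) hφ hd hd'
  -- The choice is harmless: the copies are disjoint and embedded, so a point has at most one
  -- preimage.
  let h0 : S → ChainsModBoundaries S := fun x =>
    if hx : ∃ q : Bool × E.Outside, j q.1 q.2 = x then k hx.choose.1 hx.choose.2 else 0
  have hj0 : ∀ b y, h0 (j b y) = k b y := by
    intro b y
    have hx : ∃ q : Bool × E.Outside, j q.1 q.2 = j b y := ⟨(b, y), rfl⟩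
    have e1 : hx.choose.1 = b := h.disjoint hx.choose_spec
    have e2 : hx.choose.2 = y := (h.isOpenEmbedding b).injective (by
      have := hx.choose_spec
      rwa [e1] at this)
    simp only [h0]
    rw [dif_pos hx, e1, e2]
  have hN0 : ∀ x ∈ N, h0 x = 0 := by
    intro x hx
    by_cases hx' : ∃ q : Bool × E.Outside, j q.1 q.2 = x
    · obtain ⟨⟨b, y⟩, rfl⟩ := hx'
      rw [hj0]
      exact hk0 b y ((h.mem_iff b y).1 hx)
    · simp only [h0]
      rw [dif_neg hx']
  refine H1_map_eq_id _ h0 fun p => ?_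
  refine (θ.pullback ((f : S ≃ₜ S) : C(S, S)) - θ).eq_diff_of_openCover
    (U := fun i : Option Bool => i.elim N fun b => Set.range (j b)) (fun i => ?_) (fun x => ?_) h0
    (fun i {x y} p hp => ?_) p
  · cases i
    exacts [h.isOpen, (h.isOpenEmbedding _).isOpen_range]
  · rcases h.cover x with hx | ⟨b, y, hy⟩
    exacts [⟨none, hx⟩, ⟨some b, y, hy⟩]
  · rcases i with _ | b
    · have hx : x ∈ N := by simpa using hp 0
      have hy : y ∈ N := by simpa using hp 1
      rw [hN0 x hx, hN0 y hy, sub_zero, PathFunctional.sub_val, sub_eq_zero]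
      exact θ.val_eq_of_forall_eq _ _ fun t => h.fixed _ (hp t)
    · choose q hq using hp
      have hqc : Continuous q := by
        rw [(h.isOpenEmbedding b).isInducing.continuous_iff]
        have : j b ∘ q = p := funext hq
        rw [this]
        exact p.continuous
      let q' : Path (q 0) (q 1) := ⟨⟨q, hqc⟩, rfl, rfl⟩
      have hx : x = j b (q 0) := by rw [hq, p.source]
      have hy : y = j b (q 1) := by rw [hq, p.target]
      have e := hk b q'
      rw [PathFunctional.sub_val]
      have e1 : (θ.pullback ((f : S ≃ₜ S) : C(S, S))).val p =
          (θ.pullback (j b)).val (q'.map (restrictOutside _ hd).continuous) :=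
        θ.val_eq_of_forall_eq _ _ fun t => by
          change (f : S ≃ₜ S) (p t) = j b (restrictOutside _ hd (q t))
          rw [← h.apply_eq, hq]
      have e2 : θ.val p = (θ.pullback (j b)).val q' :=
        θ.val_eq_of_forall_eq _ _ fun t => (hq t).symm
      rw [e1, e2, e, hx, hy, hj0, hj0]

end Double

end SmoothDisc

/-! ## The glued surface as a double -/

namespace SmoothDisc

variable {M : Type} [TopologicalSpace M] [ChartedSpace Plane M] (E : SmoothDisc M)

/-- The inclusion of the outside of the open unit disc into the surface with boundary. -/
def outsideIncl : C(E.Outside, E.Compl) :=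
  ⟨fun y => ⟨y, (notMem_closedBall_iff.1 y.2).1⟩, by fun_prop⟩

variable {E}

lemma outsideIncl_notMem (y : E.Outside) : E.outsideIncl y ∉ E.boundary :=
  (notMem_closedBall_iff.1 y.2).2

lemma outsideIncl_injective : Function.Injective E.outsideIncl := fun _ _ h =>
  Subtype.ext (congrArg (fun x : E.Compl => (x : M)) h)

lemma exists_outsideIncl {x : E.Compl} (hx : x ∉ E.boundary) : ∃ y, E.outsideIncl y = x :=
  ⟨⟨x, notMem_closedBall_iff.2 ⟨x.2, hx⟩⟩, rfl⟩

lemma isOpenMap_outsideIncl [T2Space M] : IsOpenMap E.outsideIncl := by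
  intro V hV
  obtain ⟨W, hW, rfl⟩ := isOpen_induced_iff.1 hV
  have e : E.outsideIncl '' (Subtype.val ⁻¹' W) =
      (fun x : E.Compl => (x : M)) ⁻¹' (W ∩ E.Outside) := by
    ext x
    constructor
    · rintro ⟨y, hy, rfl⟩
      exact ⟨hy, y.2⟩
    · rintro ⟨h1, h2⟩
      exact ⟨⟨x, h2⟩, h1, rfl⟩
  rw [e]
  exact (hW.inter isOpen_outside).preimage continuous_subtype_val

lemma boundary_near {x : E.Compl} (hx : x ∈ E.boundary) : (x : M) ∈ E.toFun '' Metric.ball 0 2 := by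
  obtain ⟨v, hv, e⟩ := hx
  rw [mem_sphere_zero_iff_norm] at hv
  refine ⟨v, ?_, e⟩
  rw [mem_ball_zero_iff, hv]
  norm_num

end SmoothDisc

namespace Glue

variable {M : Type} [TopologicalSpace M] [ChartedSpace Plane M] {E : SmoothDisc M}
  {F : E.Compl ≃ₜ E.Compl} (hF : ∀ a ∈ E.boundary, F a ∈ E.boundary)

lemma isQuotientMap_mk (F : E.Compl ≃ₜ E.Compl) :
    Topology.IsQuotientMap (Y := Glue E.boundary F) (Quot.mk _) := isQuotientMap_quot_mk

/-- The copies of the outside of the disc in the glued surface. -/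
def copy (F : E.Compl ≃ₜ E.Compl) (b : Bool) : C(E.Outside, Glue E.boundary F) :=
  ⟨fun y => Quot.mk _ (bif b then Sum.inl (E.outsideIncl y) else Sum.inr (F.symm (E.outsideIncl y))),
    continuous_quot_mk.comp (by
      have h := F.symm.continuous
      cases b <;> simp only [cond_true, cond_false] <;> fun_prop)⟩

open Classical in
/-- The copy of the outside to which a point belongs, and its coordinate there. -/
def side (hF : ∀ a ∈ E.boundary, F a ∈ E.boundary) :
    Glue E.boundary F → Option (Bool × E.Compl) :=
  Quot.lift (Sum.elim (fun x => if x ∈ E.boundary then none else some (true, x))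
    fun x => if F x ∈ E.boundary then none else some (false, F x)) (by
      rintro _ _ ⟨a, ha, rfl, rfl⟩
      simp only [Sum.elim_inl, Sum.elim_inr]
      rw [if_pos (hF a ha), if_pos (hF a ha)])

lemma side_copy (b : Bool) (y : E.Outside) :
    side hF (copy F b y) = some (b, E.outsideIncl y) := by
  classical
  cases b
  · change (if F (F.symm (E.outsideIncl y)) ∈ E.boundary then none else some (false, F (F.symm (E.outsideIncl y)))) = _
    rw [F.apply_symm_apply, if_neg (SmoothDisc.outsideIncl_notMem y)]
  · exact if_neg (SmoothDisc.outsideIncl_notMem y)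

include hF in
-- The function `side` recovers the copy and the coordinate. This gives injectivity and shows that
-- the image of an open set is empty in one summand and open in the other.
lemma isOpenEmbedding_copy [T2Space M] (b : Bool) : Topology.IsOpenEmbedding (copy F b) := by
  classical
  refine Topology.IsOpenEmbedding.of_continuous_injective_isOpenMap (map_continuous _)
    (fun y z h => ?_) fun V hV => ?_
  · have h1 := congrArg (side hF) h
    rw [side_copy, side_copy, Option.some_inj, Prod.mk.injEq] at h1
    exact SmoothDisc.outsideIncl_injective h1.2
  · have hq : Topology.IsQuotientMap (Quot.mk _ : E.Compl ⊕ E.Compl → Glue E.boundary F) :=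
      isQuotientMap_quot_mk
    rw [← (isQuotientMap_mk F).isOpen_preimage, isOpen_sum_iff]
    have hV' := SmoothDisc.isOpenMap_outsideIncl _ hV
    have key : ∀ p, Quot.mk _ p ∈ copy F b '' V → ∃ y ∈ V,
        side hF (Quot.mk _ p) = some (b, E.outsideIncl y) := by
      rintro p ⟨y, hy, hp⟩
      exact ⟨y, hy, hp ▸ side_copy hF b y⟩
    have inl_side : ∀ x b y, side hF (Quot.mk _ (Sum.inl x)) = some (b, y) → b = true ∧ y = x := by
      intro x b y h
      change (if x ∈ E.boundary then none else some (true, x)) = some (b, y) at h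
      split_ifs at h
      simp_all
    have inr_side : ∀ x b y, side hF (Quot.mk _ (Sum.inr x)) = some (b, y) →
        b = false ∧ y = F x := by
      intro x b y h
      change (if F x ∈ E.boundary then none else some (false, F x)) = some (b, y) at h
      split_ifs at h
      simp_all
    cases b
    · constructor
      · convert isOpen_empty
        refine Set.eq_empty_of_forall_notMem fun x hx => ?_
        obtain ⟨y, -, e⟩ := key _ hx
        exact absurd (inl_side _ _ _ e).1 (by simp)
      · convert hV'.preimage F.continuous
        ext x
        constructor
        · intro hx
          obtain ⟨y, hy, e⟩ := key _ hx
          exact ⟨y, hy, (inr_side _ _ _ e).2⟩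
        · rintro ⟨y, hy, e⟩
          exact ⟨y, hy, congrArg (fun z => Quot.mk _ (Sum.inr z))
            (show F.symm (E.outsideIncl y) = x by rw [e, F.symm_apply_apply])⟩
    · constructor
      · convert hV'
        ext x
        constructor
        · intro hx
          obtain ⟨y, hy, e⟩ := key _ hx
          exact ⟨y, hy, (inl_side _ _ _ e).2⟩
        · rintro ⟨y, hy, e⟩
          exact ⟨y, hy, congrArg (fun z => Quot.mk _ (Sum.inl z)) e⟩
      · convert isOpen_empty
        refine Set.eq_empty_of_forall_notMem fun x hx => ?_
        obtain ⟨y, -, e⟩ := key _ hx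
        exact absurd (inr_side _ _ _ e).1 (by simp)

/-- The points of the glued surface near the seam. -/
def seam (F : E.Compl ≃ₜ E.Compl) : Set (Glue E.boundary F) :=
  {s | Quot.lift (Sum.elim (fun x : E.Compl => (x : M) ∈ E.toFun '' Metric.ball 0 2)
    fun x => (F x : M) ∈ E.toFun '' Metric.ball 0 2) (by
      rintro _ _ ⟨a, ha, rfl, rfl⟩
      rfl) s}

/-- The second half is read in the coordinate `F`, in which the conjugate `F⁻¹uF` acts as `d`. Both
halves then look alike, and near the seam `d` is the identity because it fixes the ball of radius 2.
-/
theorem isDouble [T2Space M] {d : Diffeo M}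
    (hd : ∀ y ∈ E.toFun '' Metric.closedBall 0 1, d y = y)
    (hd' : ∀ y ∈ E.toFun '' Metric.ball 0 2, d y = y)
    (u : HomeoRel E.Compl E.boundary) (hu : ∀ x, ((u : E.Compl ≃ₜ E.Compl) x : M) = d x) :
    SmoothDisc.IsDouble hd (glueHomeo hF u (conjHomeo F hF u) : Glue E.boundary F ≃ₜ _) (seam F)
      (copy F) where
  isOpenEmbedding := isOpenEmbedding_copy hF
  disjoint {b b' y y'} h := by
    have h1 := congrArg (side hF) h
    rw [side_copy, side_copy, Option.some_inj, Prod.mk.injEq] at h1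
    exact h1.1
  apply_eq b y := by
    have e : (u : E.Compl ≃ₜ E.Compl) (E.outsideIncl y) =
        E.outsideIncl (SmoothDisc.restrictOutside d hd y) := Subtype.ext (hu _)
    cases b
    · change Quot.mk _ (Sum.inr (F.symm ((u : E.Compl ≃ₜ E.Compl) (F (F.symm _))))) = _
      rw [F.apply_symm_apply, e]
      rfl
    · change Quot.mk _ (Sum.inl ((u : E.Compl ≃ₜ E.Compl) _)) = _
      rw [e]
      rfl
  isOpen := by
    have hb : IsOpen ((fun x : E.Compl => (x : M)) ⁻¹' (E.toFun '' Metric.ball 0 2)) :=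
      (E.isOpenEmbedding.isOpenMap _ Metric.isOpen_ball).preimage continuous_subtype_val
    rw [← (isQuotientMap_mk F).isOpen_preimage, isOpen_sum_iff]
    exact ⟨hb, hb.preimage F.continuous⟩
  fixed := by
    rintro ⟨x | x⟩ hx
    · exact congrArg (fun z => Quot.mk _ (Sum.inl z)) (Subtype.ext ((hu x).trans (hd' _ hx)))
    · have e : (u : E.Compl ≃ₜ E.Compl) (F x) = F x := Subtype.ext ((hu _).trans (hd' _ hx))
      change Quot.mk _ (Sum.inr (F.symm ((u : E.Compl ≃ₜ E.Compl) (F x)))) = _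
      rw [e, F.symm_apply_apply]
  mem_iff b y := by
    cases b
    · change (F (F.symm (E.outsideIncl y)) : M) ∈ E.toFun '' Metric.ball 0 2 ↔ _
      rw [F.apply_symm_apply]
      rfl
    · exact Iff.rfl
  cover := by
    rintro ⟨x | x⟩
    · by_cases hx : x ∈ E.boundary
      · exact Or.inl (SmoothDisc.boundary_near hx)
      · obtain ⟨y, rfl⟩ := SmoothDisc.exists_outsideIncl hx
        exact Or.inr ⟨true, y, rfl⟩
    · by_cases hx : F x ∈ E.boundary
      · exact Or.inl (SmoothDisc.boundary_near hx)
      · obtain ⟨y, hy⟩ := SmoothDisc.exists_outsideIncl hx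
        refine Or.inr ⟨false, y, congrArg (fun z => Quot.mk _ (Sum.inr z)) ?_⟩
        rw [hy, F.symm_apply_apply]

end Glue

/-! ## The normalized trace of a tangent vector under an isotopy -/

section TangentTrace

variable {M : Type} [TopologicalSpace M] [ChartedSpace Plane M]

/-- The image of a tangent vector under the differential of one diffeomorphism of an isotopy, in terms
of the differential of the whole isotopy. -/
lemma IsSmoothIsotopy.tangentMap_eq {φ : ℝ → Diffeo M} (hφ : IsSmoothIsotopy φ) (t : ℝ)
    (b : M) (w : TangentSpace (𝓡 2) b) :
    tangentMap (𝓘(ℝ, ℝ).prod (𝓡 2)) (𝓡 2) (fun q : ℝ × M => φ q.1 q.2)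
      ((equivTangentBundleProd 𝓘(ℝ, ℝ) ℝ (𝓡 2) M).symm
        ((⟨t, 0⟩ : TangentBundle 𝓘(ℝ, ℝ) ℝ), ⟨b, w⟩)) =
      ⟨φ t b, mfderiv (𝓡 2) (𝓡 2) (φ t) b w⟩ := by
  have h1 : MDifferentiableAt (𝓘(ℝ, ℝ).prod (𝓡 2)) (𝓡 2) (fun q : ℝ × M => φ q.1 q.2) (t, b) :=
    (hφ.1.mdifferentiable (by simp)) _
  have h2 : MDifferentiableAt (𝓡 2) (𝓘(ℝ, ℝ).prod (𝓡 2)) (fun y : M => (t, y)) b :=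
    mdifferentiableAt_const.prodMk mdifferentiableAt_id
  have e := mfderiv_comp b h1 h2
  have e' : mfderiv (𝓡 2) (𝓡 2) (φ t) b w =
      mfderiv (𝓘(ℝ, ℝ).prod (𝓡 2)) (𝓡 2) (fun q : ℝ × M => φ q.1 q.2) (t, b) ((0 : ℝ), w) := by
    change mfderiv (𝓡 2) (𝓡 2) ((fun q : ℝ × M => φ q.1 q.2) ∘ fun y : M => (t, y)) b w = _
    rw [e, mfderiv_prod_right]
    rfl
  rw [e']
  rfl

/-- All tangent spaces are the same plane by definition, so vectors over propositionally equal
points can be compared there. -/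
lemma tangentVector_ext {x y : M} {w : TangentSpace (𝓡 2) x} {w' : TangentSpace (𝓡 2) y}
    (h : x = y) (h' : (show Plane from w) = (show Plane from w')) :
    (⟨x, w⟩ : TangentBundle (𝓡 2) M) = ⟨y, w'⟩ := by
  subst h
  exact congrArg _ h'

lemma tangentVector_eq_of_eventuallyEq {f : M → M} {b : M} (hf : ∀ᶠ y in nhds b, f y = y)
    (w : TangentSpace (𝓡 2) b) :
    (⟨f b, mfderiv (𝓡 2) (𝓡 2) f b w⟩ : TangentBundle (𝓡 2) M) = ⟨b, w⟩ := by
  have h : HasMFDerivAt (𝓡 2) (𝓡 2) f b (ContinuousLinearMap.id ℝ (TangentSpace (𝓡 2) b)) :=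
    (hasMFDerivAt_id b).congr_of_eventuallyEq hf
  refine tangentVector_ext hf.self_of_nhds ?_
  rw [h.mfderiv]
  rfl

lemma Diffeo.mfderiv_ne_zero (d : Diffeo M) {b : M} {w : TangentSpace (𝓡 2) b} (hw : w ≠ 0) :
    mfderiv (𝓡 2) (𝓡 2) d b w ≠ 0 := by
  have h := (d.mfderivToContinuousLinearEquiv (by simp) b).injective.ne hw
  rwa [map_zero] at h

variable [IsManifold (𝓡 2) ∞ M]

/-- A continuously scaled tangent vector moves continuously under the differentials of an
isotopy. -/
lemma IsSmoothIsotopy.continuous_mfderiv {φ : ℝ → Diffeo M} (hφ : IsSmoothIsotopy φ) {b : M}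
    {w : ℝ → TangentSpace (𝓡 2) b}
    (hw : Continuous fun t => (⟨b, w t⟩ : TangentBundle (𝓡 2) M)) :
    Continuous fun t : ℝ =>
      (⟨φ t b, mfderiv (𝓡 2) (𝓡 2) (φ t) b (w t)⟩ : TangentBundle (𝓡 2) M) := by
  simp_rw [← hφ.tangentMap_eq]
  have h0 : Continuous fun t : ℝ => (⟨t, 0⟩ : TangentBundle 𝓘(ℝ, ℝ) ℝ) :=
    (contMDiff_zeroSection (n := ∞) ℝ (TangentSpace 𝓘(ℝ, ℝ) (M := ℝ)) (IB := 𝓘(ℝ, ℝ))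
      (F := ℝ)).continuous
  exact (hφ.1.continuous_tangentMap (by simp)).comp
    ((contMDiff_equivTangentBundleProd_symm (n := ∞)).continuous.comp (h0.prodMk hw))

variable [RiemannianBundle (fun x : M => TangentSpace (𝓡 2) x)]
  [IsContMDiffRiemannianBundle (𝓡 2) ∞ Plane (fun x : M => TangentSpace (𝓡 2) x)]

lemma IsSmoothIsotopy.continuous_norm {φ : ℝ → Diffeo M} (hφ : IsSmoothIsotopy φ) {b : M}
    (w : TangentSpace (𝓡 2) b) :
    Continuous fun t : ℝ => ‖mfderiv (𝓡 2) (𝓡 2) (φ t) b w‖ := by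
  obtain ⟨g, hg, hg'⟩ := IsContMDiffRiemannianBundle.exists_contMDiff (IB := 𝓡 2) (n := ∞)
    (F := Plane) (E := fun x : M => TangentSpace (𝓡 2) x)
  have : IsContinuousRiemannianBundle Plane (fun x : M => TangentSpace (𝓡 2) x) :=
    ⟨⟨g, hg.continuous, hg'⟩⟩
  have hv := hφ.continuous_mfderiv (b := b) (w := fun _ => w) continuous_const
  have h := Continuous.inner_bundle (F := Plane) (E := fun x : M => TangentSpace (𝓡 2) x) hv hv
  have h' := h.sqrt
  convert h' using 2 with t
  rw [real_inner_self_eq_norm_sq, Real.sqrt_sq (norm_nonneg _)]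

/-- The normalized trace of a unit tangent vector under an isotopy that ends with the identity near
its base point. -/
theorem IsSmoothIsotopy.exists_tangent_trace {φ : ℝ → Diffeo M} (hφ : IsSmoothIsotopy φ)
    (v : UnitTangent M) (h1 : ∀ᶠ y in nhds v.1.proj, φ 1 y = y) :
    ∃ c : Path v v, ∀ t : I, ∃ r : ℝ, 0 < r ∧ (c t : TangentBundle (𝓡 2) M) =
      ⟨φ t v.1.proj, r • mfderiv (𝓡 2) (𝓡 2) (φ t) v.1.proj v.1.2⟩ := by
  obtain ⟨⟨b, w⟩, hw⟩ := v
  change ‖w‖ = 1 at hw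
  change ∀ᶠ y in nhds b, φ 1 y = y at h1
  have hw0 : w ≠ 0 := by
    rintro rfl
    simp at hw
  let A : ∀ t : ℝ, TangentSpace (𝓡 2) (φ t b) := fun t => mfderiv (𝓡 2) (𝓡 2) (φ t) b w
  have hA : ∀ t, 0 < ‖A t‖ := fun t => norm_pos_iff.2 (Diffeo.mfderiv_ne_zero _ hw0)
  have hAc : Continuous fun t => ‖A t‖ := hφ.continuous_norm w
  -- The normalizing factor is moved inside the differential, so that continuity follows from that
  -- of the differential applied to a moving vector over a fixed point.
  have hsc : Continuous fun t => (⟨b, ‖A t‖⁻¹ • w⟩ : TangentBundle (𝓡 2) M) :=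
    (FiberBundle.continuous_totalSpaceMk Plane (fun x : M => TangentSpace (𝓡 2) x) b).comp
      ((hAc.inv₀ fun t => (hA t).ne').smul continuous_const)
  have hc : Continuous fun t => (⟨φ t b, ‖A t‖⁻¹ • A t⟩ : TangentBundle (𝓡 2) M) := by
    convert hφ.continuous_mfderiv hsc using 3 with t
    exact (map_smul _ _ _).symm
  -- At the times 0 and 1 the diffeomorphism is the identity near the base point, so the
  -- differential fixes the vector and the path closes up.
  have hend : ∀ t, (∀ᶠ y in nhds b, φ t y = y) →
      (⟨φ t b, ‖A t‖⁻¹ • A t⟩ : TangentBundle (𝓡 2) M) = ⟨b, w⟩ := by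
    intro t ht
    have e := tangentVector_eq_of_eventuallyEq ht w
    have e1 : ‖A t‖ = 1 :=
      (congrArg (fun v : TangentBundle (𝓡 2) M => ‖v.2‖) e).trans hw
    rw [e1, inv_one, one_smul]
    exact e
  refine ⟨⟨⟨fun t => ⟨⟨φ t b, ‖A t‖⁻¹ • A t⟩, ?_⟩, ?_⟩, ?_, ?_⟩, fun t => ?_⟩
  · change ‖‖A t‖⁻¹ • A t‖ = 1
    rw [norm_smul, norm_inv, norm_norm, inv_mul_cancel₀ (hA t).ne']
  · exact (hc.comp continuous_subtype_val).subtype_mk _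
  · exact Subtype.ext (hend 0 (Filter.Eventually.of_forall hφ.2))
  · exact Subtype.ext (hend 1 h1)
  · exact ⟨‖A t‖⁻¹, inv_pos.2 (hA t), rfl⟩

end TangentTrace

/-! ## Pushing the disc along a loop of points -/

section PointPush

variable {M : Type} [TopologicalSpace M] [ChartedSpace Plane M]

/-- The restriction to the complement of a disc of a diffeomorphism that is the identity on the
disc. -/
def SmoothDisc.restrictCompl (E : SmoothDisc M) (d : Diffeo M)
    (hd : ∀ y ∈ E.toFun '' Metric.closedBall 0 1, d y = y) : HomeoRel E.Compl E.boundary where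
  val :=
    { toFun := fun x => ⟨d x, SmoothDisc.apply_notMem
        (fun y hy => hd y (Set.image_mono Metric.ball_subset_closedBall hy)) x.2⟩
      invFun := fun x => ⟨d.symm x, SmoothDisc.apply_notMem
        (SmoothDisc.symm_eq_self
          fun y hy => hd y (Set.image_mono Metric.ball_subset_closedBall hy)) x.2⟩
      left_inv := fun x => Subtype.ext (d.symm_apply_apply x)
      right_inv := fun x => Subtype.ext (d.apply_symm_apply x)
      continuous_toFun := (d.continuous.comp continuous_subtype_val).subtype_mk _
      continuous_invFun := (d.symm.continuous.comp continuous_subtype_val).subtype_mk _ }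
  property := fun a ha => Subtype.ext
    (hd a (Set.image_mono Metric.sphere_subset_closedBall ha))

/-- The homomorphism that juxtaposes a homeomorphism with its conjugate. -/
def doubleHom {X : Type} [TopologicalSpace X] {A : Set X} (F : X ≃ₜ X) (hF : ∀ a ∈ A, F a ∈ A) :
    HomeoRel X A →* HomeoRel (Glue A F) ∅ :=
  MonoidHom.mk' (fun u => glueHomeo hF u (conjHomeo F hF u)) fun u u' => by
    rw [map_mul, glueHomeo_mul]

variable (E : SmoothDisc M) (F : E.Compl ≃ₜ E.Compl) (hF : ∀ a ∈ E.boundary, F a ∈ E.boundary)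

/-- `x` is the class on the glued surface of the double of the end of an isotopy that pushes the
disc along a loop in the class `γ`. -/
def IsPointPush {b : M} (γ : FundamentalGroup M b) (x : MCG (Glue E.boundary F) ∅) : Prop :=
  ∃ (φ : ℝ → Diffeo M) (hφ : IsSmoothIsotopy φ) (h1 : φ 1 b = b),
    (∀ y ∈ E.toFun '' Metric.closedBall 0 1, φ 1 y = y) ∧
    γ = FundamentalGroup.fromPath (Path.Homotopic.Quotient.mk (hφ.trace h1)) ∧
    ∃ u : HomeoRel E.Compl E.boundary,
      (∀ y, ((u : E.Compl ≃ₜ E.Compl) y : M) = φ 1 y) ∧ x = MCG.mk (doubleHom F hF u)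

variable {E F hF}

namespace IsPointPush

/-- Both products perform the right factor first, so the isotopy for `γ * γ'` is that of `γ'`
combined with that of `γ` after it. -/
lemma mul {b : M} {γ γ' : FundamentalGroup M b} {x x' : MCG (Glue E.boundary F) ∅}
    (h : IsPointPush E F hF γ x) (h' : IsPointPush E F hF γ' x') :
    IsPointPush E F hF (γ * γ') (x * x') := by
  obtain ⟨φ, hφ, h1, hd, rfl, u, hu, rfl⟩ := h
  obtain ⟨ψ, hψ, k1, kd, rfl, v, hv, rfl⟩ := h'
  refine ⟨_, hψ.trans hφ, (congrArg (φ 1) k1).trans h1, fun y hy => ?_, ?_, u * v, fun y => ?_, ?_⟩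
  · change φ 1 (ψ 1 y) = y
    rw [kd y hy, hd y hy]
  · exact (Quotient.sound (hψ.trace_trans hφ k1 h1)).symm
  · change ((u : E.Compl ≃ₜ E.Compl) ((v : E.Compl ≃ₜ E.Compl) y) : M) = φ 1 (ψ 1 y)
    rw [hu, hv]
  · rw [map_mul, map_mul]

variable [IsManifold (𝓡 2) ∞ M]

/-- Pushing along a loop of unit tangent vectors is pushing along the loop of base points. -/
lemma of_isPush [RiemannianBundle (fun x : M => TangentSpace (𝓡 2) x)]
    {v : UnitTangent M} (hv : UnitTangent.proj M v = E.toFun 0)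
    {α : FundamentalGroup (UnitTangent M) v} {m : MCG E.Compl E.boundary} (h : IsPush E v α m) :
    IsPointPush E F hF (FundamentalGroup.map (UnitTangent.proj M) v α)
      (juxtapose hF (m, conjMCG F hF m)) := by
  obtain ⟨φ, hφ, h0, hd, ⟨c, rfl, hc⟩, u, hu, rfl⟩ := h
  refine ⟨φ, ⟨hφ, h0⟩, hd _ ⟨0, by simp, hv.symm⟩, hd, ?_, u, hu, rfl⟩
  refine congrArg (fun p : Path _ _ => Path.Homotopic.Quotient.mk p) (?_ :
    c.map (UnitTangent.proj M).continuous = _)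
  ext t
  obtain ⟨r, -, e⟩ := hc t
  exact congrArg (fun w : TangentBundle (𝓡 2) M => w.proj) e

variable [T2Space M]

/-- The class of the double depends only on the homotopy class of the loop. -/
theorem unique {b : M} (hb : b = E.toFun 0) {γ : FundamentalGroup M b}
    {x x' : MCG (Glue E.boundary F) ∅} (h : IsPointPush E F hF γ x)
    (h' : IsPointPush E F hF γ x') : x = x' := by
  subst hb
  obtain ⟨φ, hφ, h1, hd, rfl, u, hu, rfl⟩ := h
  obtain ⟨ψ, hψ, k1, kd, e, v, hv, rfl⟩ := h'
  have hh : (hφ.trace h1).Homotopic (hψ.trace k1) := Quotient.exact e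
  have hus : ∀ y, (((u⁻¹ : HomeoRel E.Compl E.boundary) : E.Compl ≃ₜ E.Compl) y : M) =
      (φ 1).symm y := fun y => by
    rw [← (φ 1).symm_apply_apply (((u⁻¹ : HomeoRel E.Compl E.boundary) : E.Compl ≃ₜ E.Compl) y : M),
      ← hu]
    exact congrArg (fun z : E.Compl => (φ 1).symm z) ((u : E.Compl ≃ₜ E.Compl).apply_symm_apply y)
  have hsc : (φ 1).symm (E.toFun 0) = E.toFun 0 := (φ 1).toEquiv.symm_apply_eq.2 h1.symm
  have hr : (φ 1).symm.trans (φ (1 - 1)) (E.toFun 0) = E.toFun 0 := by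
    change φ (1 - 1) ((φ 1).symm (E.toFun 0)) = _
    rw [sub_self, hφ.2, hsc]
  have hs : hφ.reverse.trace hr = (hφ.trace h1).symm := by
    ext t
    change φ (1 - t) ((φ 1).symm (E.toFun 0)) = φ (unitInterval.symm t) (E.toFun 0)
    rw [hsc]
    rfl
  have hχ : ∀ y, (ψ 1).trans ((φ 1).symm.trans (φ (1 - 1))) y = (φ 1).symm (ψ 1 y) := fun y => by
    change φ (1 - 1) ((φ 1).symm (ψ 1 y)) = _
    rw [sub_self, hφ.2]
  -- The isotopy `ψ` followed by the reverse of `φ` ends at `φ₁⁻¹ ∘ ψ₁`, and its trace is one loop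
  -- followed by the inverse of a homotopic loop.
  have hnull : ((hψ.trans hφ.reverse).trace ((hχ _).trans ((congrArg _ k1).trans hsc))).Homotopic
      (Path.refl _) := by
    refine (hψ.trace_trans hφ.reverse k1 hr).trans ?_
    rw [hs]
    exact (hh.symm.hcomp (Path.Homotopic.refl _)).trans
      ⟨(Path.Homotopy.reflTransSymm (hφ.trace h1)).symm⟩
  obtain ⟨H, H1, H2, H3, H4⟩ := E.exists_isotopy_compl (hψ.trans hφ.reverse) (fun y hy => by
    rw [hχ, kd y hy, SmoothDisc.symm_eq_self hd y hy]) _ hnull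
  refine QuotientGroup.eq.2 ?_
  rw [← map_inv, ← map_mul]
  refine glueHomeo_conj_isotopicToId F hF (fun a => E.symm_mem_boundary F hF) _ H H1 H2 H3
    (fun y => Subtype.ext ?_) fun t a ha => ?_
  · rw [H4, hχ]
    change _ = (((u⁻¹ : HomeoRel E.Compl E.boundary) : E.Compl ≃ₜ E.Compl)
      ((v : E.Compl ≃ₜ E.Compl) y) : M)
    rw [hus, hv]
  -- A homeomorphism that maps the boundary circle into itself maps it onto itself.
  · exact ⟨_, E.symm_mem_boundary (H1 t).homeomorph (H2 t) ha,
      (H1 t).homeomorph.apply_symm_apply a⟩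

/-- Every loop pushes the disc, by an isotopy that ends with the identity near the disc. -/
theorem exists_push (hor : OrientedAtlas M) {b : M} (hb : b = E.toFun 0)
    (γ : FundamentalGroup M b) : ∃ (φ : ℝ → Diffeo M) (hφ : IsSmoothIsotopy φ) (h1 : φ 1 b = b),
      γ = FundamentalGroup.fromPath (Path.Homotopic.Quotient.mk (hφ.trace h1)) ∧
      ∀ y ∈ E.toFun '' Metric.closedBall 0 2, φ 1 y = y := by
  subst hb
  obtain ⟨p, hp⟩ := Quotient.exists_rep γ
  obtain ⟨φ, hφ, h1, h, hd⟩ := exists_isotopy_of_loop hor E p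
  refine ⟨φ, hφ, h1, ?_, ?_⟩
  · rw [← hp]
    exact (Quotient.sound h).symm
  · rintro _ ⟨y, hy, rfl⟩
    exact hd y (by simpa using hy)

/-- The push is chosen to be the identity on the ball of radius 2, which leaves a neighbourhood of
the seam fixed by the double. -/
theorem exists_mem_torelli {g : ℕ} (hg : 0 < g) [ConnectedSpace M] (hor : OrientedAtlas M)
    (hM : Nonempty (M ≃ₜ StandardSurface g)) {b : M} (hb : b = E.toFun 0)
    (γ : FundamentalGroup M b) :
    ∃ x ∈ Torelli (Glue E.boundary F), IsPointPush E F hF γ x := by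
  obtain ⟨φ, hφ, h1, hγ, hd2⟩ := exists_push (E := E) hor hb γ
  have hd : ∀ y ∈ E.toFun '' Metric.closedBall 0 1, φ 1 y = y := fun y hy =>
    hd2 y (Set.image_mono (Metric.closedBall_subset_closedBall (by norm_num)) hy)
  have hd' : ∀ y ∈ E.toFun '' Metric.ball 0 2, φ 1 y = y := fun y hy =>
    hd2 y (Set.image_mono Metric.ball_subset_closedBall hy)
  have h := Glue.isDouble hF hd hd' (E.restrictCompl (φ 1) hd) fun _ => rfl
  exact ⟨_, ⟨doubleHom F hF (E.restrictCompl (φ 1) hd), ⟨h.mem_homeoPlus,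
    h.mem_homologyTrivial hg hM hφ hd hd'⟩, rfl⟩, φ, hφ, h1, hd, hγ, _, fun _ => rfl, rfl⟩

variable [RiemannianBundle (fun x : M => TangentSpace (𝓡 2) x)]
  [IsContMDiffRiemannianBundle (𝓡 2) ∞ Plane (fun x : M => TangentSpace (𝓡 2) x)]

/-- Every loop of points lifts to a loop of unit tangent vectors along which the disc is pushed. -/
theorem exists_isPush (hor : OrientedAtlas M) {v : UnitTangent M}
    (hv : UnitTangent.proj M v = E.toFun 0) (γ : FundamentalGroup M (UnitTangent.proj M v)) :
    ∃ α m, FundamentalGroup.map (UnitTangent.proj M) v α = γ ∧ IsPush E v α m := by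
  obtain ⟨φ, hφ, h1, rfl, hd2⟩ := exists_push hor hv γ
  have hd : ∀ y ∈ E.toFun '' Metric.closedBall 0 1, φ 1 y = y := fun y hy =>
    hd2 y (Set.image_mono (Metric.closedBall_subset_closedBall (by norm_num)) hy)
  have hn : ∀ᶠ y in nhds v.1.proj, φ 1 y = y := by
    have ho : IsOpen (E.toFun '' Metric.ball 0 1) :=
      E.isOpenEmbedding.isOpenMap _ Metric.isOpen_ball
    filter_upwards [ho.mem_nhds ⟨0, by simp, hv.symm⟩] with y hy
    exact hd y (Set.image_mono Metric.ball_subset_closedBall hy)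
  obtain ⟨c, hc⟩ := hφ.exists_tangent_trace v hn
  refine ⟨FundamentalGroup.fromPath (Path.Homotopic.Quotient.mk c),
    MCG.mk (E.restrictCompl (φ 1) hd), ?_, φ, hφ.1, hφ.2, hd, ⟨c, rfl, hc⟩, _, fun _ => rfl, rfl⟩
  refine congrArg (fun p : Path _ _ => Path.Homotopic.Quotient.mk p) (?_ :
    c.map (UnitTangent.proj M).continuous = _)
  ext t
  obtain ⟨r, -, e⟩ := hc t
  exact congrArg (fun w : TangentBundle (𝓡 2) M => w.proj) e

end IsPointPush

end PointPush

end

/-! ### Assembly of the theorem -/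

theorem lemma2p2 {g : ℕ} (hg : 2 ≤ g) {M : Type} [TopologicalSpace M] [T2Space M]
    [CompactSpace M] [ConnectedSpace M] [ChartedSpace Plane M] [IsManifold (𝓡 2) ∞ M]
    (hor : OrientedAtlas M) (hM : Nonempty (M ≃ₜ StandardSurface g))
    [RiemannianBundle (fun x : M => TangentSpace (𝓡 2) x)]
    [IsContMDiffRiemannianBundle (𝓡 2) ∞ Plane (fun x : M => TangentSpace (𝓡 2) x)]
    (δ : SmoothDisc M) (v₀ : UnitTangent M) (hv₀ : UnitTangent.proj M v₀ = δ.toFun 0)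
    (F : δ.Compl ≃ₜ δ.Compl) (hF : ∀ a ∈ δ.boundary, F a ∈ δ.boundary) :
    (∃! ρ : FundamentalGroup M (UnitTangent.proj M v₀) →* MCG (Glue δ.boundary F) ∅,
      IsKorkmaz δ v₀ F hF ρ) ∧
    ∀ ρ : FundamentalGroup M (UnitTangent.proj M v₀) →* MCG (Glue δ.boundary F) ∅,
      IsKorkmaz δ v₀ F hF ρ → ρ.range ≤ Torelli (Glue δ.boundary F) := by
  have hex := IsPointPush.exists_mem_torelli (E := δ) (F := F) (hF := hF) (by omega : 0 < g) hor hM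
    hv₀
  choose x hxT hx using hex
  -- Every class in `π₁(M)` lifts to a loop of unit tangent vectors along which a push exists. This
  -- forces the value of `ρ`, which agrees with the chosen `x γ` because doubles are determined by
  -- `γ`.
  have hval : ∀ ρ : FundamentalGroup M (UnitTangent.proj M v₀) →* MCG (Glue δ.boundary F) ∅,
      IsKorkmaz δ v₀ F hF ρ → ∀ γ, ρ γ = x γ := by
    intro ρ hρ γ
    obtain ⟨α, m, rfl, hm⟩ := IsPointPush.exists_isPush hor hv₀ γ
    rw [hρ α m hm]
    exact (IsPointPush.of_isPush hv₀ hm).unique hv₀ (hx _)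
  -- Multiplicativity and independence of the choices both come from `unique`: products of pushes,
  -- and pushes along tangent vectors, are point pushes along the expected loops.
  refine ⟨⟨MonoidHom.mk' x fun γ γ' => (hx _).unique hv₀ ((hx γ).mul (hx γ')), fun α m hm =>
    (hx _).unique hv₀ (IsPointPush.of_isPush hv₀ hm), fun ρ hρ => MonoidHom.ext (hval ρ hρ)⟩, ?_⟩
  rintro ρ hρ _ ⟨γ, rfl⟩
  rw [hval ρ hρ γ]
  exact hxT γ
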